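/- \textbf{Setting.} Let $p\ge 1$, $r\ge 1$, $G\ge 1$ and $k=2pr$ be integers. In the clusterwise linear regression model a response $y_i$ with covariate $\mathbf z_i\in\mathbb R^p$ and regressor $\mathbf x_i=(1,\mathbf z_i^T)^T$ has density $f_\theta(y\mid\mathbf x_i)=\sum_{g=1}^G\pi_g\,\phi(y\mid\mathbf x_i^T\boldsymbol\beta_g,\sigma_g^2)$, where $\phi(\cdot\mid\mu,\sigma^2)$ is the $N(\mu,\sigma^2)$ density, $\sigma_g>0$, $\pi_g>0$, $\sum_g\pi_g=1$ and $\boldsymbol\beta_g=(\beta_{g,0},\beta_{g,1},\dots,\beta_{g,p})^T$. The parameter $\theta$ consists of all $\boldsymbol\beta_g$, all $\sigma_g^2$ and $\pi_1,\dots,\pi_{G-1}$ (with $\pi_G=1-\sum_{g<G}\pi_g$). Let $$\mathbf I(\mathbf x)=\int_{\mathbb R}\big(\partial_\theta\log f_\theta(y\mid\mathbf x)\big)\big(\partial_\theta\log f_\theta(y\mid\mathbf x)\big)^T f_\theta(y\mid\mathbf x)\,dy$$ be the Fisher information matrix of one observation, and $\mathbf I(\boldsymbol\delta)=\sum_{i\in\boldsymbol\delta}\mathbf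 I(\mathbf x_i)$ that of the subdata with index set $\boldsymbol\delta$. For nonsingular $\mathbf I(\boldsymbol\delta)$ the variance $V(\hat{\boldsymbol\beta}_g^{\boldsymbol\delta})$ of the (maximum likelihood) estimator of $\boldsymbol\beta_g$ from the subdata, given the covariates, is understood as the $\boldsymbol\beta_g$-block of $\mathbf I(\boldsymbol\delta)^{-1}$, and $V(\mathbf M\hat{\boldsymbol\beta}_g^{\boldsymbol\delta})=\mathbf M\,V(\hat{\boldsymbol\beta}_g^{\boldsymbol\delta})\,\mathbf M^T$ for a matrix $\mathbf M$. The IBOSS subdata $\boldsymbol\delta^*=\boldsymbol\delta^*_N\subset\{1,\dots,N\}$ are selected as follows: for $j=1,\dots,p$ in turn, among the points not selected before, select the $r$ points with the smallest and the $r$ points with the largest values of the $j$-th covariate (ties broken by the index). Let $\boldsymbol\mu_z\in\mathbb R^p$ and let $\boldsymbol\Sigma_z=\boldsymbol\Phi_z\boldsymbol\rho\boldsymbol\Phi_z$ be a positive definite covariance matrix, where $\boldsymbol\Phi_z=\mathrm{diag}(\sigma_{z1},\dots,\sigma_{zp})$, $\sigma_{zj}>0$, and $\boldsymbol\rho=(\rho_{jj'})$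 is a correlation matrix. Let $\mathbf z_1,\mathbf z_2,\dots$ be i.i.d.; all parameters and $r$ are fixed, and $N\to\infty$. \textbf{Theorem.} (a) Suppose $\mathbf z_i\sim N(\boldsymbol\mu_z,\boldsymbol\Sigma_z)$ and $\sum_{l=1}^p\rho_{lj}\sigma_{zl}(\beta_{g,l}-\beta_{g',l})\ne 0$ for all $g\ne g'$ in $\{1,\dots,G\}$ and all $j\in\{1,\dots,p\}$. Then $\mathbf I(\boldsymbol\delta^*)$ is nonsingular with probability tending to one and, for every $g$, in probability (entrywise), $$V(\mathbf A_N\hat{\boldsymbol\beta}_g^{\boldsymbol\delta^*})\to\frac{\sigma_g^2}{\pi_g}\begin{pmatrix}\frac1k&\mathbf 0\\ \mathbf 0&\frac1{4r}(\boldsymbol\Phi_z\boldsymbol\rho^2\boldsymbol\Phi_z)^{-1}\end{pmatrix},\qquad \mathbf A_N=\mathrm{diag}(1,\sqrt{\log N},\dots,\sqrt{\log N}).$$ (b) Suppose $\mathbf z_i\sim LN(\boldsymbol\mu_z,\boldsymbol\Sigma_z)$, i.e. $\mathbf z_i$ is the coordinatewise exponential of an $N(\boldsymbol\mu_z,\boldsymbol\Sigma_z)$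 vector, and for all $g\ne g'$ and all $j$ it holds that $\beta_{g,j}\ne\beta_{g',j}$, $\rho_{\min,j}:=\min_l\rho_{lj}<0$ and $\sum_{l:\,\rho_{lj}=\rho_{\min,j}}(\beta_{g,l}-\beta_{g',l})\ne0$. Then $\mathbf I(\boldsymbol\delta^*)$ is nonsingular with probability tending to one and, for every $g$, in probability (entrywise), $$V(\mathbf B_N\hat{\boldsymbol\beta}_g^{\boldsymbol\delta^*})\to\frac{2\sigma_g^2}{k\pi_g}\begin{pmatrix}1&-\boldsymbol\nu^T\\-\boldsymbol\nu&p\boldsymbol\Psi+\boldsymbol\nu\boldsymbol\nu^T\end{pmatrix},$$ where $\mathbf B_N=\mathrm{diag}\big(1,e^{\sigma_{z1}\sqrt{2\log N}},\dots,e^{\sigma_{zp}\sqrt{2\log N}}\big)$, $\boldsymbol\nu=(e^{-\mu_{z1}},\dots,e^{-\mu_{zp}})^T$ and $\boldsymbol\Psi=\mathrm{diag}(e^{-2\mu_{z1}},\dots,e^{-2\mu_{zp}})$. In both cases the rate of the slope variances is asymptotically optimal. Put $\tau_{N,j}=1/\log N$ in case (a) and $\tau_{N,j}=e^{-2\sigma_{zj}\sqrt{2\log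 N}}$ in case (b). For every $g$ and $j$ there are constants $c,C>0$, not depending on $N$, such that, with probability tending to one, $V(\hat\beta_{g,j}^{\boldsymbol\delta^*})\le C\,\tau_{N,j}$, while simultaneously $V(\hat\beta_{g,j}^{\boldsymbol\delta})\ge c\,\tau_{N,j}$ for all $\boldsymbol\delta\subset\{1,\dots,N\}$ of size $k$ with nonsingular $\mathbf I(\boldsymbol\delta)$. -/

import Mathlib

open MeasureTheory ProbabilityTheory Filter Topology

namespace CLR

noncomputable section

/-- Index set of a coefficient vector `β_g = (β_{g,0}, β_{g,1}, …, β_{g,p})`: the left summand is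
the intercept, the right summand holds the slopes. -/
abbrev Coef (p : ℕ) : Type := Unit ⊕ Fin p

/-- Coordinates of the full parameter `θ` of a clusterwise linear regression model with `G = m + 1`
clusters: the `G (p + 1)` regression coefficients, the `G` error variances `σ_g²`, and the
`G - 1 = m` free mixing probabilities `π_1, …, π_{G-1}`. -/
abbrev ParamIdx (m p : ℕ) : Type := (Fin (m + 1) × Coef p) ⊕ (Fin (m + 1) ⊕ Fin m)

variable {m p : ℕ}

/-- The parameter vector with coefficients `β`, error standard deviations `σ` and mixing
probabilities `π` (the last one is redundant and is left out). -/
def param (β : Fin (m + 1) → Coef p → ℝ) (σ π : Fin (m + 1) → ℝ) : ParamIdx m p → ℝ :=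
  Sum.elim (fun gc => β gc.1 gc.2) (Sum.elim (fun g => σ g ^ 2) (fun h => π h.castSucc))

/-- The mixing probabilities encoded by `θ`, with `π_G = 1 - ∑_{g < G} π_g`. -/
def mixWeight (θ : ParamIdx m p → ℝ) : Fin (m + 1) → ℝ :=
  Fin.snoc (α := fun _ => ℝ) (fun h : Fin m => θ (Sum.inr (Sum.inr h)))
    (1 - ∑ h : Fin m, θ (Sum.inr (Sum.inr h)))

/-- The regressor `x = (1, zᵀ)ᵀ`. -/
def regressor (z : EuclideanSpace ℝ (Fin p)) : Coef p → ℝ :=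
  Sum.elim (fun _ => 1) (fun j => z j)

/-- Density `∑_g π_g φ(y | xᵀ β_g, σ_g²)` of a response with regressor `x`. -/
def mixDensity (θ : ParamIdx m p → ℝ) (x : Coef p → ℝ) (y : ℝ) : ℝ :=
  ∑ g, mixWeight θ g *
    gaussianPDFReal (∑ c, x c * θ (Sum.inl (g, c))) (θ (Sum.inr (Sum.inl g))).toNNReal y

/-- Score: the partial derivative of the loglikelihood of one observation with respect to the
`a`-th coordinate of the parameter. -/
def score (θ : ParamIdx m p → ℝ) (x : Coef p → ℝ) (y : ℝ) (a : ParamIdx m p) : ℝ :=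
  deriv (fun t : ℝ => Real.log (mixDensity (Function.update θ a t) x y)) (θ a)

/-- Fisher information matrix of one observation with regressor `x`: the expectation of the outer
product of the score with itself under the response density at `θ`. -/
def fisherInfo (θ : ParamIdx m p → ℝ) (x : Coef p → ℝ) :
    Matrix (ParamIdx m p) (ParamIdx m p) ℝ :=
  Matrix.of fun a b => ∫ y : ℝ, score θ x y a * score θ x y b * mixDensity θ x y

/-- Fisher information matrix of the subdata with index set `δ`. -/
def subdataInfo (θ : ParamIdx m p → ℝ) (z : ℕ → EuclideanSpace ℝ (Fin p)) (δ : Finset ℕ) :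
    Matrix (ParamIdx m p) (ParamIdx m p) ℝ :=
  ∑ i ∈ δ, fisherInfo θ (regressor (z i))

/-- The variance matrix of the maximum likelihood estimator of `β_g` from the subdata `δ`, given the
covariates: the `β_g`-block of the inverse Fisher information matrix of all the parameters. -/
def varBeta (θ : ParamIdx m p → ℝ) (z : ℕ → EuclideanSpace ℝ (Fin p)) (δ : Finset ℕ)
    (g : Fin (m + 1)) : Matrix (Coef p) (Coef p) ℝ :=
  (subdataInfo θ z δ)⁻¹.submatrix (fun c => Sum.inl (g, c)) (fun c => Sum.inl (g, c))

/-- The `r` indices in `R` with the smallest values `v i`; ties are broken by the index. -/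
def smallest (R : Finset ℕ) (v : ℕ → ℝ) (r : ℕ) : Finset ℕ :=
  R.filter fun i => (R.filter fun i' => v i' < v i ∨ (v i' = v i ∧ i' < i)).card < r

/-- The `r` indices in `R` with the largest values `v i`; ties are broken by the index. -/
def largest (R : Finset ℕ) (v : ℕ → ℝ) (r : ℕ) : Finset ℕ :=
  R.filter fun i => (R.filter fun i' => v i < v i' ∨ (v i = v i' ∧ i < i')).card < r

/-- The IBOSS subdata of the first `N` data points: for each covariate in turn, add the `r` smallest
and the `r` largest among the points not selected before. -/
def iboss (r N : ℕ) (z : ℕ → EuclideanSpace ℝ (Fin p)) : Finset ℕ :=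
  (List.finRange p).foldl
    (fun S j => S ∪ (smallest (Finset.range N \ S) (fun i => z i j) r ∪
      largest (Finset.range N \ S) (fun i => z i j) r)) ∅

/-- The lognormal distribution `LN(μ, S)`: the law of `(exp u_1, …, exp u_p)` for `u ∼ N(μ, S)`. -/
def multivariateLogNormal (μ : EuclideanSpace ℝ (Fin p)) (S : Matrix (Fin p) (Fin p) ℝ) :
    Measure (EuclideanSpace ℝ (Fin p)) :=
  (multivariateGaussian μ S).map fun u => WithLp.toLp 2 fun j => Real.exp (u j)

/-- `Σ_z = Φ ρ Φ` with `Φ` the diagonal matrix of the standard deviations. -/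
def covMatrix (σz : Fin p → ℝ) (ρ : Matrix (Fin p) (Fin p) ℝ) : Matrix (Fin p) (Fin p) ℝ :=
  Matrix.diagonal σz * ρ * Matrix.diagonal σz

/-- `ρ_{min,j} = min_l ρ_{lj}`. -/
def minCorr (ρ : Matrix (Fin p) (Fin p) ℝ) (j : Fin p) : ℝ := ⨅ l, ρ l j

/-- The diagonal matrix `blkdiag(1, d_1, …, d_p)`. -/
def scaling (d : Fin p → ℝ) : Matrix (Coef p) (Coef p) ℝ :=
  Matrix.diagonal (Sum.elim (fun _ => 1) d)

/-- Limit matrix for normal covariates, `k = 2 p r`. -/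
def normalLimit (r : ℕ) (σz : Fin p → ℝ) (ρ : Matrix (Fin p) (Fin p) ℝ) (σg πg : ℝ) :
    Matrix (Coef p) (Coef p) ℝ :=
  (σg ^ 2 / πg) •
    Matrix.fromBlocks (Matrix.of fun _ _ => 1 / (2 * p * r : ℝ)) 0 0
      ((1 / (4 * r : ℝ)) • (Matrix.diagonal σz * ρ ^ 2 * Matrix.diagonal σz)⁻¹)

/-- Limit matrix for lognormal covariates, `k = 2 p r`. -/
def logNormalLimit (r : ℕ) (μ : EuclideanSpace ℝ (Fin p)) (σg πg : ℝ) :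
    Matrix (Coef p) (Coef p) ℝ :=
  (2 * σg ^ 2 / ((2 * p * r : ℝ) * πg)) •
    Matrix.fromBlocks (Matrix.of fun _ _ => 1)
      (Matrix.of fun _ j => -Real.exp (-μ j)) (Matrix.of fun j _ => -Real.exp (-μ j))
      ((p : ℝ) • Matrix.diagonal (fun j => Real.exp (-2 * μ j)) +
        Matrix.vecMulVec (fun j => Real.exp (-μ j)) (fun j => Real.exp (-μ j)))

variable {Ω : Type*} [MeasurableSpace Ω]

/-- The subdata rule `δ` gives a nonsingular information matrix with probability tending to one,
and, with the scaling matrices `A N`, the variance matrix of `A_N β̂_g` tends to `L`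
in probability (entry by entry). -/
def ScaledVarTendsto (P : Measure Ω) (θ : ParamIdx m p → ℝ)
    (z : ℕ → Ω → EuclideanSpace ℝ (Fin p)) (δ : ℕ → Ω → Finset ℕ) (g : Fin (m + 1))
    (A : ℕ → Matrix (Coef p) (Coef p) ℝ) (L : Matrix (Coef p) (Coef p) ℝ) : Prop :=
  Tendsto (fun N => P {ω | ¬ IsUnit (subdataInfo θ (fun i => z i ω) (δ N ω)).det}) atTop (𝓝 0) ∧
  ∀ a b : Coef p, TendstoInMeasure P
    (fun N ω => (A N * varBeta θ (fun i => z i ω) (δ N ω) g * (A N).transpose) a b) atTop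
    (fun _ => L a b)

/-- The rule `δ` attains the rate `rate N` for the variance of the `j`-th slope of cluster `g`, and
no subdata of size `k` can beat it: with probability tending to one, that variance is at least
`c * rate N` simultaneously for all subdata of size `k` of the first `N` points (subdata with a
singular information matrix have no finite variance and do not compete). -/
def RateOptimal (P : Measure Ω) (θ : ParamIdx m p → ℝ)
    (z : ℕ → Ω → EuclideanSpace ℝ (Fin p)) (δ : ℕ → Ω → Finset ℕ) (k : ℕ) (g : Fin (m + 1))
    (j : Fin p) (rate : ℕ → ℝ) : Prop :=
  (∃ C : ℝ, 0 < C ∧ Tendsto (fun N => P {ω |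
      C * rate N < varBeta θ (fun i => z i ω) (δ N ω) g (Sum.inr j) (Sum.inr j)})
    atTop (𝓝 0)) ∧
  (∃ c : ℝ, 0 < c ∧ Tendsto (fun N => P {ω | ∃ s ⊆ Finset.range N, s.card = k ∧
      IsUnit (subdataInfo θ (fun i => z i ω) s).det ∧
      varBeta θ (fun i => z i ω) s g (Sum.inr j) (Sum.inr j) < c * rate N})
    atTop (𝓝 0))

end

end CLR

/-! Write T = √(2 log N) (`maxRate`) and let W_l be the standardized coordinates, of the log
covariates in the lognormal case. A union bound shows that no point has |W_j| beyond T + δ, and a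
second moment bound shows that the points beyond T - δ on either side outnumber every constant
(`eventually_std_lt`, `eventually_le_card_std_ge`). The selection discards boundedly many points
before it reaches coordinate j, so its choice there satisfies W_j = ±(T + o(1)). The regression of
W_l on W_j then gives W_l = ±ρ_lj T + o(T) (`exists_selection`, `tendsto_std_sub_maxRate`,
`tendsto_std_div_maxRate`).

At such points the cluster means drift infinitely far apart, so the response reveals its cluster.
Posterior weights of different clusters no longer overlap (`tendsto_respMoment_of_ne`,
`tendsto_respMoment_self`), and the rescaled Fisher information of one observation tends to that of
a model with observed labels (`tendsto_scaled_fisherInfo`). That limit splits into least squares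
blocks for the β_g, a diagonal block for the variances and a multinomial block for the weights.
Summing over the 2p groups of r points gives a matrix with an explicit inverse, and matrix inversion
is continuous there (`sum_sepInfo_mul_sepInfoInv`, `tendsto_scaled_inverse`).

Separation of the means is immediate for normal covariates: the difference divided by T has a
nonzero limit. For lognormal covariates the difference is a combination of exponentials which might
cancel. If the extreme of coordinate j drives another coordinate l to infinity, then, given the
rest, the combination stays bounded only if the residual of coordinate l falls into a window of
length O(e^{-cT}). This costs more than the roughly e^{δT} candidate points can make up for, once δ
< c (`eventually_le_abs_exp_combination`). Otherwise the group consists of largest values, and the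
j-th exponential dominates all others (`tendsto_abs_exp_combination_of_nonpos`).

For optimality, observing labels can only add information, so a diagonal entry of the information
about a slope is at most a constant times the sum of the squared covariates. A diagonal entry of the
inverse is at least the reciprocal of that entry, and the maximum of the covariate over all N points
bounds every subset at once (`fisherInfo_coef_self_le`, `inv_le_inv_apply_self`,
`rateOptimal_of_whp`). -/

namespace CLR

/-! ### Convergence in probability expressed by a filter -/

/-- The filter of events on `ℕ × Ω` whose `N`-th section has probability tending to one. -/
def whp {Ω : Type*} [MeasurableSpace Ω] (P : Measure Ω) : Filter (ℕ × Ω) where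
  sets := {A | Tendsto (fun N => P {ω | (N, ω) ∉ A}) atTop (𝓝 0)}
  univ_sets := by simp
  sets_of_superset := fun {A B} hA hAB =>
    tendsto_of_tendsto_of_tendsto_of_le_of_le tendsto_const_nhds hA (fun _ => zero_le)
      fun N => measure_mono fun ω h h' => h (hAB h')
  inter_sets := fun {A B} hA hB => by
    have h : Tendsto (fun N => P {ω | (N, ω) ∉ A} + P {ω | (N, ω) ∉ B}) atTop (𝓝 0) := by
      simpa using Tendsto.add hA hB
    refine tendsto_of_tendsto_of_tendsto_of_le_of_le tendsto_const_nhds h (fun _ => zero_le)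
      fun N => (measure_mono fun ω hω => ?_).trans (measure_union_le _ _)
    by_contra hc
    simp only [Set.mem_union, Set.mem_ofPred_eq, not_or, not_not] at hc
    exact hω hc

section Whp

variable {Ω : Type*} [MeasurableSpace Ω] {P : Measure Ω}

lemma eventually_whp_iff {A : ℕ × Ω → Prop} :
    (∀ᶠ q in whp P, A q) ↔ Tendsto (fun N => P {ω | ¬ A (N, ω)}) atTop (𝓝 0) := Iff.rfl

lemma tendsto_fst_whp : Tendsto Prod.fst (whp P) atTop := by
  intro s hs
  rw [mem_map]
  obtain ⟨a, ha⟩ := mem_atTop_sets.1 hs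
  refine Tendsto.congr' ?_ (tendsto_const_nhds (x := 0))
  filter_upwards [eventually_ge_atTop a] with N hN
  have : {ω : Ω | (N, ω) ∉ Prod.fst ⁻¹' s} = ∅ := by
    ext ω; simpa using ha N hN
  rw [this, measure_empty]

lemma eventually_whp_of_ae {A : Ω → Prop} (h : ∀ᵐ ω ∂P, A ω) : ∀ᶠ q in whp P, A q.2 := by
  rw [eventually_whp_iff]
  have : P {ω | ¬ A ω} = 0 := h
  simp [this]

/-- The way back from filter limits to probability. Until here, convergence in probability obeys the
ordinary calculus of `Tendsto`, including composition with continuous maps. -/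
lemma tendstoInMeasure_of_tendsto_whp {f : ℕ → Ω → ℝ} {c : ℝ}
    (h : Tendsto (fun q : ℕ × Ω => f q.1 q.2) (whp P) (𝓝 c)) :
    TendstoInMeasure P f atTop (fun _ => c) := by
  rw [tendstoInMeasure_iff_dist]
  intro ε hε
  have := (Metric.tendsto_nhds.1 h) ε hε
  rw [eventually_whp_iff] at this
  simpa using this

/-- Union bound: an event of probability `o(1/N)` happens for none of the first `N` points. -/
lemma eventually_whp_forall_lt {E : Type*} [MeasurableSpace E] {γ : Measure E}
    {u : ℕ → Ω → E} (hu : ∀ i, HasLaw (u i) γ P) {A : ℕ → Set E}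
    (hA : ∀ N, MeasurableSet (A N)) {q : ℕ → ℝ}
    (hq : ∀ᶠ N in atTop, γ (A N) ≤ ENNReal.ofReal (q N))
    (hlim : Tendsto (fun N : ℕ => N * q N) atTop (𝓝 0)) :
    ∀ᶠ x in whp P, ∀ i < x.1, u i x.2 ∉ A x.1 := by
  rw [eventually_whp_iff]
  have h0 : Tendsto (fun N : ℕ => ENNReal.ofReal (N * q N)) atTop (𝓝 0) := by
    simpa using ENNReal.tendsto_ofReal hlim
  refine tendsto_of_tendsto_of_tendsto_of_le_of_le' tendsto_const_nhds h0
    (Eventually.of_forall fun _ => zero_le) ?_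
  filter_upwards [hq] with N hN
  have : {ω | ¬ ∀ i < N, u i ω ∉ A N} ⊆ ⋃ i ∈ Finset.range N, {ω | u i ω ∈ A N} := by
    intro ω; simp
  calc P {ω | ¬ ∀ i < N, u i ω ∉ A N} ≤ ∑ i ∈ Finset.range N, P {ω | u i ω ∈ A N} :=
        (measure_mono this).trans (measure_biUnion_finset_le _ _)
    _ = ∑ i ∈ Finset.range N, γ (A N) :=
        Finset.sum_congr rfl fun i _ => (hu i).measure_eq (p := fun x => x ∈ A N) (hA N)
    _ ≤ ENNReal.ofReal (N * q N) := by
        rw [Finset.sum_const, Finset.card_range, nsmul_eq_mul, ENNReal.ofReal_mul (by positivity),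
          ENNReal.ofReal_natCast]
        gcongr

end Whp

/-! ### Uniform convergence over random index sets -/

/-- The filter of events that hold eventually along `l` for all selected indices. -/
def onSel {α : Type*} (l : Filter α) (sel : α → Finset ℕ) : Filter (α × ℕ) where
  sets := {A | ∀ᶠ q in l, ∀ i ∈ sel q, (q, i) ∈ A}
  univ_sets := by simp
  sets_of_superset := fun {A B} hA hAB => by
    filter_upwards [hA] with q hq i hi using hAB (hq i hi)
  inter_sets := fun {A B} hA hB => by
    filter_upwards [hA, hB] with q h1 h2 i hi using ⟨h1 i hi, h2 i hi⟩

section OnSel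

variable {α : Type*} {l : Filter α} {sel : α → Finset ℕ}

lemma eventually_onSel_iff {A : α × ℕ → Prop} :
    (∀ᶠ x in onSel l sel, A x) ↔ ∀ᶠ q in l, ∀ i ∈ sel q, A (q, i) := Iff.rfl

lemma tendsto_fst_onSel : Tendsto Prod.fst (onSel l sel) l := by
  intro s hs
  rw [mem_map]
  change ∀ᶠ q in l, ∀ i ∈ sel q, q ∈ s
  filter_upwards [hs] with q hq i _ using hq

lemma tendsto_sum_onSel {F : α × ℕ → ℝ} {c : ℝ} {r : ℕ}
    (hF : Tendsto F (onSel l sel) (𝓝 c)) (hr : ∀ᶠ q in l, (sel q).card = r) :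
    Tendsto (fun q => ∑ i ∈ sel q, F (q, i)) l (𝓝 (r * c)) := by
  rw [Metric.tendsto_nhds]
  intro ε hε
  -- Dividing by r + 1 rather than r keeps the tolerance positive for r = 0 and the final inequality
  -- strict.
  have h := (Metric.tendsto_nhds.1 hF) (ε / (r + 1)) (by positivity)
  rw [eventually_onSel_iff] at h
  filter_upwards [h, hr] with q hq hc
  have h1 : ∑ i ∈ sel q, F (q, i) - r * c = ∑ i ∈ sel q, (F (q, i) - c) := by
    rw [Finset.sum_sub_distrib, Finset.sum_const, hc, nsmul_eq_mul]
  rw [Real.dist_eq, h1]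
  calc |∑ i ∈ sel q, (F (q, i) - c)| ≤ ∑ i ∈ sel q, |F (q, i) - c| :=
        Finset.abs_sum_le_sum_abs _ _
    _ ≤ ∑ i ∈ sel q, ε / (r + 1) := Finset.sum_le_sum fun i hi => (hq i hi).le
    _ = r * (ε / (r + 1)) := by rw [Finset.sum_const, hc, nsmul_eq_mul]
    _ < ε := by
        rw [mul_div_assoc', div_lt_iff₀ (by positivity)]
        nlinarith

end OnSel

/-! ### Ranks and the combinatorics of the selection -/

section Ranks

/-- Ranks of a finite set with respect to an injective key take every value below its size. -/
lemma card_filter_rank_lt {κ : Type*} [LinearOrder κ] (R : Finset ℕ) (key : ℕ → κ)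
    (hkey : Function.Injective key) {r : ℕ} (hr : r ≤ R.card) :
    (R.filter fun i => (R.filter fun i' => key i' < key i).card < r).card = r := by
  set rk : ℕ → ℕ := fun i => (R.filter fun i' => key i' < key i).card with hrk
  have hlt : ∀ i ∈ R, ∀ i' ∈ R, key i < key i' → rk i < rk i' := by
    intro i hi i' hi' h
    refine Finset.card_lt_card (Finset.ssubset_iff_of_subset ?_ |>.2 ⟨i, ?_, ?_⟩)
    · intro a ha
      simp only [Finset.mem_filter] at ha ⊢
      exact ⟨ha.1, ha.2.trans h⟩
    · simp [hi, h]
    · simp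
  have hinj : Set.InjOn rk R := by
    intro i hi i' hi' h
    rcases lt_trichotomy (key i) (key i') with h1 | h1 | h1
    · exact absurd h (hlt i hi i' hi' h1).ne
    · exact hkey h1
    · exact absurd h (hlt i' hi' i hi h1).ne'
  -- Ranks are distinct and lie below the size of R, so by counting they take each of these values
  -- exactly once.
  have himg : R.image rk = Finset.range R.card := by
    refine Finset.eq_of_subset_of_card_le ?_ ?_
    · intro a ha
      obtain ⟨i, hi, rfl⟩ := Finset.mem_image.1 ha
      refine Finset.mem_range.2 (Finset.card_lt_card (Finset.filter_ssubset.2 ⟨i, hi, by simp⟩))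
    · rw [Finset.card_image_of_injOn hinj, Finset.card_range]
  have : (R.filter fun i => rk i < r).image rk = Finset.range r := by
    ext a
    simp only [Finset.mem_image, Finset.mem_filter, Finset.mem_range]
    constructor
    · rintro ⟨i, ⟨_, h⟩, rfl⟩; exact h
    · intro ha
      have : a ∈ R.image rk := by rw [himg]; exact Finset.mem_range.2 (ha.trans_le hr)
      obtain ⟨i, hi, rfl⟩ := Finset.mem_image.1 this
      exact ⟨i, ⟨hi, ha⟩, rfl⟩
  have h := Finset.card_image_of_injOn (hinj.mono (Finset.coe_subset.2
    (Finset.filter_subset (fun i => rk i < r) R)))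
  rw [this, Finset.card_range] at h
  exact h.symm

/-- The lexicographic key (value, index) turns tie breaking into a strict linear order with distinct
keys; `card_largest` uses the dual of the same order. -/
lemma card_smallest {R : Finset ℕ} (v : ℕ → ℝ) {r : ℕ} (hr : r ≤ R.card) :
    (smallest R v r).card = r := by
  have h := card_filter_rank_lt R (fun i => toLex (v i, i))
    (fun a b h => by simpa using (congrArg (fun x => (ofLex x).2) h)) hr
  simpa [smallest, Prod.Lex.toLex_lt_toLex] using h

lemma card_largest {R : Finset ℕ} (v : ℕ → ℝ) {r : ℕ} (hr : r ≤ R.card) :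
    (largest R v r).card = r := by
  have h := card_filter_rank_lt R (fun i => OrderDual.toDual (toLex (v i, i)))
    (fun a b h => by simpa using (congrArg (fun x => (ofLex (OrderDual.ofDual x)).2) h)) hr
  simpa [largest, Prod.Lex.toLex_lt_toLex] using h

lemma smallest_subset (R : Finset ℕ) (v : ℕ → ℝ) (r : ℕ) : smallest R v r ⊆ R :=
  Finset.filter_subset _ _

lemma largest_subset (R : Finset ℕ) (v : ℕ → ℝ) (r : ℕ) : largest R v r ⊆ R :=
  Finset.filter_subset _ _

/-- A common element would have at most r - 1 elements of R below it and at most r - 1 above it,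
which leaves room for only 2r - 1 elements. -/
lemma disjoint_smallest_largest {R : Finset ℕ} (v : ℕ → ℝ) {r : ℕ} (hr : 2 * r ≤ R.card) :
    Disjoint (smallest R v r) (largest R v r) := by
  rw [Finset.disjoint_left]
  intro i h1 h2
  simp only [smallest, largest, Finset.mem_filter] at h1 h2
  have h3 : R ⊆ insert i ((R.filter fun i' => v i' < v i ∨ (v i' = v i ∧ i' < i)) ∪
      (R.filter fun i' => v i < v i' ∨ (v i = v i' ∧ i < i'))) := by
    intro a ha
    simp only [Finset.mem_insert, Finset.mem_union, Finset.mem_filter, ha, true_and]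
    rcases lt_trichotomy (v a) (v i) with h | h | h
    · tauto
    · rcases lt_trichotomy a i with h' | h' | h' <;> tauto
    · tauto
  have h4 := (Finset.card_le_card h3).trans ((Finset.card_insert_le _ _).trans
    (Nat.add_le_add_right (Finset.card_union_le _ _) 1))
  omega

/-- Of the k + r indices with value at least t, at most k are missing from R. A chosen index below t
would thus be outranked by r indices of R. This transfers extremeness from the whole sample to what
earlier rounds left over. -/
lemma le_of_mem_largest {N k r : ℕ} {R : Finset ℕ} {v : ℕ → ℝ} {t : ℝ} {i : ℕ}
    (hR : R ⊆ Finset.range N) (hk : N ≤ R.card + k)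
    (ht : k + r ≤ ((Finset.range N).filter fun i => t ≤ v i).card) (hi : i ∈ largest R v r) :
    t ≤ v i := by
  by_contra hc
  push Not at hc
  simp only [largest, Finset.mem_filter] at hi
  have h1 : ((Finset.range N).filter fun i => t ≤ v i) ⊆ (Finset.range N \ R) ∪
      (R.filter fun i' => v i < v i' ∨ (v i = v i' ∧ i < i')) := by
    intro a ha
    simp only [Finset.mem_filter, Finset.mem_union, Finset.mem_sdiff] at ha ⊢
    by_cases haR : a ∈ R
    · exact Or.inr ⟨haR, Or.inl (hc.trans_le ha.2)⟩
    · exact Or.inl ⟨ha.1, haR⟩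
  have h2 := (Finset.card_le_card h1).trans (Finset.card_union_le _ _)
  have h3 := Finset.card_sdiff_add_card_eq_card hR
  rw [Finset.card_range] at h3
  omega

lemma ge_of_mem_smallest {N k r : ℕ} {R : Finset ℕ} {v : ℕ → ℝ} {t : ℝ} {i : ℕ}
    (hR : R ⊆ Finset.range N) (hk : N ≤ R.card + k)
    (ht : k + r ≤ ((Finset.range N).filter fun i => v i ≤ t).card) (hi : i ∈ smallest R v r) :
    v i ≤ t := by
  by_contra hc
  push Not at hc
  simp only [smallest, Finset.mem_filter] at hi
  have h1 : ((Finset.range N).filter fun i => v i ≤ t) ⊆ (Finset.range N \ R) ∪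
      (R.filter fun i' => v i' < v i ∨ (v i' = v i ∧ i' < i)) := by
    intro a ha
    simp only [Finset.mem_filter, Finset.mem_union, Finset.mem_sdiff] at ha ⊢
    by_cases haR : a ∈ R
    · exact Or.inr ⟨haR, Or.inl (ha.2.trans_lt hc)⟩
    · exact Or.inl ⟨ha.1, haR⟩
  have h2 := (Finset.card_le_card h1).trans (Finset.card_union_le _ _)
  have h3 := Finset.card_sdiff_add_card_eq_card hR
  rw [Finset.card_range] at h3
  omega

/-- Induction over the covariates. All that is remembered of a round is the set R j of points
available to it: it misses a bounded number of points and has room for two disjoint groups of r.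
Since the identity is stated for sums of an arbitrary F, disjointness of the groups need not be
carried along. -/
lemma foldl_select_decomposition {ι : Type*} [DecidableEq ι] (r N : ℕ) (v : ι → ℕ → ℝ) :
    ∀ (L : List ι) (S : Finset ℕ), L.Nodup → S ⊆ Finset.range N →
      S.card + 2 * r * L.length ≤ N →
      ∃ R : ι → Finset ℕ,
        (∀ j ∈ L, R j ⊆ Finset.range N ∧ N ≤ (R j).card + (S.card + 2 * r * L.length) ∧
          2 * r ≤ (R j).card) ∧
        ∀ F : ℕ → ℝ, ∑ i ∈ L.foldl (fun S j => S ∪ (smallest (Finset.range N \ S) (v j) r ∪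
            largest (Finset.range N \ S) (v j) r)) S, F i =
          ∑ i ∈ S, F i + (L.map fun j => ∑ i ∈ smallest (R j) (v j) r, F i +
            ∑ i ∈ largest (R j) (v j) r, F i).sum := by
  intro L
  induction L with
  | nil => intro S _ _ _; exact ⟨fun _ => ∅, by simp, by simp⟩
  | cons j L ih =>
    intro S hL hS hN
    rw [List.nodup_cons] at hL
    rw [List.length_cons] at hN
    set R₀ := Finset.range N \ S with hR₀
    have hcard : R₀.card + S.card = N := by
      rw [Finset.card_sdiff_add_card_eq_card hS, Finset.card_range]
    have hr : 2 * r ≤ R₀.card := by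
      have : 2 * r ≤ 2 * r * (L.length + 1) := by nlinarith
      omega
    have hd1 := disjoint_smallest_largest (v j) hr
    have hd2 : Disjoint S (smallest R₀ (v j) r ∪ largest R₀ (v j) r) := by
      refine Finset.disjoint_of_subset_right (Finset.union_subset (smallest_subset _ _ _)
        (largest_subset _ _ _)) Finset.disjoint_sdiff
    have hc : (S ∪ (smallest R₀ (v j) r ∪ largest R₀ (v j) r)).card = S.card + 2 * r := by
      rw [Finset.card_union_of_disjoint hd2, Finset.card_union_of_disjoint hd1,
        card_smallest _ (by omega), card_largest _ (by omega)]
      ring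
    have hN' : 2 * r * (L.length + 1) = 2 * r * L.length + 2 * r := by ring
    obtain ⟨R, hR, hsum⟩ := ih (S ∪ (smallest R₀ (v j) r ∪ largest R₀ (v j) r)) hL.2
      (Finset.union_subset hS (Finset.union_subset
        ((smallest_subset _ _ _).trans Finset.sdiff_subset)
        ((largest_subset _ _ _).trans Finset.sdiff_subset))) (by omega)
    have hne : ∀ j' ∈ L, j' ≠ j := fun j' h h' => hL.1 (h' ▸ h)
    refine ⟨Function.update R j R₀, ?_, ?_⟩
    · intro j' hj'
      rw [List.length_cons]
      by_cases h : j' = j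
      · subst h
        rw [Function.update_self]
        exact ⟨Finset.sdiff_subset, by omega, hr⟩
      · rw [Function.update_of_ne h]
        obtain ⟨h1, h2, h3⟩ := hR j' ((List.mem_cons.1 hj').resolve_left h)
        exact ⟨h1, by omega, h3⟩
    · intro F
      rw [List.foldl_cons, hsum, Finset.sum_union hd2, Finset.sum_union hd1, List.map_cons,
        List.sum_cons, Function.update_self, add_assoc]
      congr 3
      refine List.map_congr_left fun j' hj' => ?_
      rw [Function.update_of_ne (hne j' hj')]

lemma iboss_decomposition {p : ℕ} (r N : ℕ) (z : ℕ → EuclideanSpace ℝ (Fin p))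
    (hN : 2 * p * r ≤ N) :
    ∃ R : Fin p → Finset ℕ,
      (∀ j, R j ⊆ Finset.range N ∧ N ≤ (R j).card + 2 * p * r ∧ 2 * r ≤ (R j).card) ∧
      ∀ F : ℕ → ℝ, ∑ i ∈ iboss r N z, F i =
        ∑ j, (∑ i ∈ smallest (R j) (fun i => z i j) r, F i +
          ∑ i ∈ largest (R j) (fun i => z i j) r, F i) := by
  have hN' : 2 * r * p = 2 * p * r := by ring
  obtain ⟨R, hR, hsum⟩ := foldl_select_decomposition r N (fun j i => z i j) (List.finRange p) ∅
    (List.nodup_finRange p) (by simp) (by simp; omega)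
  refine ⟨R, fun j => ?_, fun F => ?_⟩
  · have := hR j (List.mem_finRange j)
    simpa [hN'] using this
  · rw [iboss, hsum, Finset.sum_empty, zero_add, Fin.sum_univ_def]

/-- The selection depends only on the order within each coordinate. Lognormal covariates can
therefore be replaced by their logarithms. -/
lemma iboss_congr {p : ℕ} (r N : ℕ) {z u : ℕ → EuclideanSpace ℝ (Fin p)} {f : ℝ → ℝ}
    (hf : StrictMono f) (h : ∀ i j, z i j = f (u i j)) : iboss r N z = iboss r N u := by
  simp only [iboss, smallest, largest, h, hf.lt_iff_lt, hf.injective.eq_iff]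

end Ranks

/-! ### Tail and small-set bounds for the one-dimensional normal law -/

section GaussianTails

/-- Chernoff bound with tilt t / V. Only an upper bound V of the variance enters, so degenerate laws
need no separate treatment. -/
lemma gaussianReal_ge_le {v : NNReal} {V t : ℝ} (hV : 0 < V) (hv : v ≤ V) (ht : 0 ≤ t) :
    gaussianReal 0 v {x | t ≤ x} ≤ ENNReal.ofReal (Real.exp (-(t ^ 2 / (2 * V)))) := by
  have h := measure_ge_le_exp_mul_mgf (μ := gaussianReal 0 v) (X := id) t (t := t / V)
    (by positivity) (by simpa using integrable_exp_mul_gaussianReal (t / V))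
  rw [mgf_id_gaussianReal] at h
  rw [← ENNReal.ofReal_toReal (measure_ne_top (gaussianReal 0 v) {x | t ≤ x})]
  refine ENNReal.ofReal_le_ofReal (h.trans ?_)
  rw [← Real.exp_add, Real.exp_le_exp]
  have h1 : (v : ℝ) * (t / V) ^ 2 / 2 ≤ V * (t / V) ^ 2 / 2 := by gcongr
  have h2 : -(t / V) * t + V * (t / V) ^ 2 / 2 = -(t ^ 2 / (2 * V)) := by
    field_simp; ring
  simp only [zero_mul, zero_add]
  linarith

/-- On [t, t + h] the density is at least its value at the right end. This crude bound suffices,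
since the threshold will be lowered by more than h. -/
lemma le_gaussianReal_ge {t h : ℝ} (ht : 0 ≤ t) :
    ENNReal.ofReal (h * ((√(2 * Real.pi))⁻¹ * Real.exp (-(t + h) ^ 2 / 2))) ≤
      gaussianReal 0 1 {x | t ≤ x} := by
  rw [gaussianReal_apply _ one_ne_zero]
  calc ENNReal.ofReal (h * ((√(2 * Real.pi))⁻¹ * Real.exp (-(t + h) ^ 2 / 2)))
      = ∫⁻ _ in Set.Icc t (t + h),
          ENNReal.ofReal ((√(2 * Real.pi))⁻¹ * Real.exp (-(t + h) ^ 2 / 2)) := by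
        rw [setLIntegral_const, Real.volume_Icc, mul_comm h, ENNReal.ofReal_mul (by positivity)]
        simp
    _ ≤ ∫⁻ x in Set.Icc t (t + h), gaussianPDF 0 1 x := by
        refine setLIntegral_mono (measurable_gaussianPDF 0 1) fun x hx => ?_
        rw [gaussianPDF]
        refine ENNReal.ofReal_le_ofReal ?_
        simp only [gaussianPDFReal, NNReal.coe_one, mul_one, sub_zero]
        gcongr
        exacts [ht.trans hx.1, hx.2]
    _ ≤ ∫⁻ x in {x | t ≤ x}, gaussianPDF 0 1 x := lintegral_mono_set fun x hx => hx.1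

/-- The density never exceeds its peak, and the volume of a set of reals is at most its diameter.
Using the diameter spares the description of the set as an interval. -/
lemma gaussianReal_le_ediam {m : ℝ} {v : NNReal} (hv : v ≠ 0) (s : Set ℝ) :
    gaussianReal m v s ≤ ENNReal.ofReal (√(2 * Real.pi * v))⁻¹ * Metric.ediam s := by
  rw [gaussianReal_apply _ hv]
  calc ∫⁻ x in s, gaussianPDF m v x ≤ ∫⁻ _ in s, ENNReal.ofReal (√(2 * Real.pi * v))⁻¹ := by
        refine lintegral_mono fun x => ENNReal.ofReal_le_ofReal ?_
        rw [gaussianPDFReal]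
        refine mul_le_of_le_one_right (by positivity) (Real.exp_le_one_iff.2 ?_)
        rw [neg_div, neg_nonpos]
        positivity
    _ ≤ _ := by
        rw [setLIntegral_const]
        gcongr
        exact Real.volume_le_diam s

end GaussianTails

/-! ### Linear functionals of a Gaussian vector -/

section Functionals

variable {p : ℕ}

lemma hasLaw_sum_mul_sub {μ : EuclideanSpace ℝ (Fin p)} {S : Matrix (Fin p) (Fin p) ℝ}
    (hS : S.PosSemidef) (w : Fin p → ℝ) :
    HasLaw (fun x : EuclideanSpace ℝ (Fin p) => ∑ l, w l * (x l - μ l))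
      (gaussianReal 0 (w ⬝ᵥ S.mulVec w).toNNReal) (multivariateGaussian μ S) := by
  set L : EuclideanSpace ℝ (Fin p) →L[ℝ] ℝ := innerSL ℝ (WithLp.toLp 2 w) with hL
  have hLa : ∀ x, L x = ∑ l, w l * x l := by
    intro x
    simp [hL, PiLp.inner_apply, mul_comm]
  have h1 : HasLaw L (gaussianReal (L μ) (w ⬝ᵥ S.mulVec w).toNNReal)
      (multivariateGaussian μ S) := by
    refine ⟨L.continuous.aemeasurable, ?_⟩
    rw [IsGaussian.map_eq_gaussianReal L]
    congr 2
    · rw [L.integral_comp_id_comm IsGaussian.integrable_id, integral_id_multivariateGaussian]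
    · have h := covarianceBilin_multivariateGaussian (μ := μ) hS (WithLp.toLp 2 w) (WithLp.toLp 2 w)
      rw [covarianceBilin_self IsGaussian.memLp_two_id] at h
      simpa [hL] using h
  have h2 := gaussianReal_sub_const h1 (L μ)
  rw [sub_self] at h2
  refine h2.congr (ae_of_all _ fun x => ?_)
  simp only [hLa, ← Finset.sum_sub_distrib, mul_sub]

/-- Standardized coordinate. -/
noncomputable def std (μ : EuclideanSpace ℝ (Fin p)) (σ : Fin p → ℝ)
    (x : EuclideanSpace ℝ (Fin p)) (l : Fin p) : ℝ := (x l - μ l) / σ l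

@[fun_prop]
lemma continuous_std (μ : EuclideanSpace ℝ (Fin p)) (σ : Fin p → ℝ) (l : Fin p) :
    Continuous fun x => std μ σ x l := by
  unfold std; fun_prop

variable {μ : EuclideanSpace ℝ (Fin p)} {σ : Fin p → ℝ} {ρ : Matrix (Fin p) (Fin p) ℝ}

lemma eq_add_mul_std (hσ : ∀ j, 0 < σ j) (x : EuclideanSpace ℝ (Fin p)) (l : Fin p) :
    x l = μ l + σ l * std μ σ x l := by
  rw [std, mul_div_cancel₀ _ (hσ l).ne']; ring

lemma covMatrix_apply (a b : Fin p) : covMatrix σ ρ a b = σ a * ρ a b * σ b := by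
  simp [covMatrix, Matrix.mul_diagonal, Matrix.diagonal_mul]

lemma corr_symm (hσ : ∀ j, 0 < σ j) (hcov : (covMatrix σ ρ).PosDef) (a b : Fin p) :
    ρ a b = ρ b a := by
  have h := hcov.1.apply a b
  rw [covMatrix_apply, covMatrix_apply] at h
  simp only [star_trivial] at h
  have h1 := (hσ a).ne'
  have h2 := (hσ b).ne'
  have : σ a * σ b * (ρ a b - ρ b a) = 0 := by linarith
  have h3 := (mul_eq_zero.1 this).resolve_left (mul_ne_zero h1 h2)
  linarith

lemma hasLaw_sum_mul_std (hσ : ∀ j, 0 < σ j) (hcov : (covMatrix σ ρ).PosDef) (w : Fin p → ℝ) :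
    HasLaw (fun x : EuclideanSpace ℝ (Fin p) => ∑ l, w l * std μ σ x l)
      (gaussianReal 0 (w ⬝ᵥ ρ.mulVec w).toNNReal) (multivariateGaussian μ (covMatrix σ ρ)) := by
  have h := hasLaw_sum_mul_sub (μ := μ) hcov.posSemidef (fun l => w l / σ l)
  have h1 : (fun l => w l / σ l) ⬝ᵥ (covMatrix σ ρ).mulVec (fun l => w l / σ l) =
      w ⬝ᵥ ρ.mulVec w := by
    simp only [dotProduct, Matrix.mulVec, covMatrix_apply, Finset.mul_sum]
    refine Finset.sum_congr rfl fun a _ => Finset.sum_congr rfl fun b _ => ?_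
    have h1 := (hσ a).ne'
    have h2 := (hσ b).ne'
    field_simp
  rw [h1] at h
  refine h.congr (ae_of_all _ fun x => ?_)
  refine Finset.sum_congr rfl fun l _ => ?_
  rw [std, div_mul_eq_mul_div, mul_div_assoc]

lemma hasLaw_std (hσ : ∀ j, 0 < σ j) (hρ : ∀ j, ρ j j = 1) (hcov : (covMatrix σ ρ).PosDef)
    {s : ℝ} (hs : s ^ 2 = 1) (j : Fin p) :
    HasLaw (fun x : EuclideanSpace ℝ (Fin p) => s * std μ σ x j) (gaussianReal 0 1)
      (multivariateGaussian μ (covMatrix σ ρ)) := by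
  have h := hasLaw_sum_mul_std (μ := μ) hσ hcov (Pi.single j s)
  have h1 : Pi.single j s ⬝ᵥ ρ.mulVec (Pi.single j s) = 1 := by
    simp [Matrix.mulVec_single, hρ, ← pow_two, hs]
  rw [h1, Real.toNNReal_one] at h
  refine h.congr (ae_of_all _ fun x => ?_)
  simp [Pi.single_apply]

/-- Positive definiteness is tested on e_l - ρ_lj e_j in standardized coordinates, where the
quadratic form equals 1 - ρ_lj². -/
lemma corr_sq_lt_one (hσ : ∀ j, 0 < σ j) (hρ : ∀ j, ρ j j = 1) (hcov : (covMatrix σ ρ).PosDef)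
    {l j : Fin p} (hlj : l ≠ j) : ρ l j ^ 2 < 1 := by
  have hw : (fun i => (Pi.single l 1 - Pi.single j (ρ l j) : Fin p → ℝ) i / σ i) ≠ 0 := by
    intro h
    have := congrFun h l
    simp [hlj, (hσ l).ne'] at this
  have h := hcov.dotProduct_mulVec_pos hw
  have h1 : star (fun i => (Pi.single l 1 - Pi.single j (ρ l j) : Fin p → ℝ) i / σ i) ⬝ᵥ
      (covMatrix σ ρ).mulVec
        (fun i => (Pi.single l 1 - Pi.single j (ρ l j) : Fin p → ℝ) i / σ i) =
      (Pi.single l 1 - Pi.single j (ρ l j)) ⬝ᵥ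
        ρ.mulVec (Pi.single l 1 - Pi.single j (ρ l j)) := by
    simp only [dotProduct, Matrix.mulVec, covMatrix_apply, Finset.mul_sum, Pi.star_apply,
      star_trivial]
    refine Finset.sum_congr rfl fun a _ => Finset.sum_congr rfl fun b _ => ?_
    have h1 := (hσ a).ne'
    have h2 := (hσ b).ne'
    field_simp
  rw [h1] at h
  simp [Matrix.mulVec_sub, Matrix.mulVec_single, sub_dotProduct, hρ, corr_symm hσ hcov j l] at h
  nlinarith

/-- Large values of a coordinate together with a large deviation of another coordinate from its
regression on the first. -/
lemma measure_std_ge_and_noise_ge_le (hσ : ∀ j, 0 < σ j) (hρ : ∀ j, ρ j j = 1)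
    (hcov : (covMatrix σ ρ).PosDef) {s b a c : ℝ} (hs : s ^ 2 = 1) (hb : 0 ≤ b) {s' : ℝ}
    (hs' : s' ^ 2 = 1) (l j : Fin p) (hac : 0 ≤ a + b * c) :
    multivariateGaussian μ (covMatrix σ ρ)
        {x | a ≤ s * std μ σ x j ∧ c ≤ s' * (std μ σ x l - ρ l j * std μ σ x j)} ≤
      ENNReal.ofReal (Real.exp (-((a + b * c) ^ 2 / (2 * (1 + b ^ 2))))) := by
  -- The noise W_l - ρ_lj W_j is uncorrelated with W_j, so this one functional covers both events
  -- with variance 1 + b²(1 - ρ_lj²) ≤ 1 + b². The weight b remains free for optimization.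
  set w : Fin p → ℝ := Pi.single j s + (b * s') • (Pi.single l 1 - Pi.single j (ρ l j)) with hw
  have h := hasLaw_sum_mul_std (μ := μ) hσ hcov w
  have hsum : ∀ x : EuclideanSpace ℝ (Fin p), ∑ i, w i * std μ σ x i =
      s * std μ σ x j + b * (s' * (std μ σ x l - ρ l j * std μ σ x j)) := by
    intro x
    simp [hw, add_mul, sub_mul, mul_sub, Finset.sum_add_distrib, Finset.sum_sub_distrib,
      Pi.single_apply]
    ring
  have hvar : w ⬝ᵥ ρ.mulVec w ≤ 1 + b ^ 2 := by
    have : w ⬝ᵥ ρ.mulVec w = s ^ 2 + b ^ 2 * s' ^ 2 * (1 - ρ l j ^ 2) := by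
      simp [hw, Matrix.mulVec_add, Matrix.mulVec_sub, Matrix.mulVec_smul, Matrix.mulVec_single,
        sub_dotProduct, hρ, corr_symm hσ hcov j l]
      ring
    rw [this, hs, hs']
    nlinarith [mul_nonneg (sq_nonneg b) (sq_nonneg (ρ l j))]
  have hm := h.measure_eq (p := fun y => a + b * c ≤ y) measurableSet_Ici
  calc _ ≤ multivariateGaussian μ (covMatrix σ ρ) {x | a + b * c ≤ ∑ i, w i * std μ σ x i} := by
        refine measure_mono fun x hx => ?_
        simp only [Set.mem_ofPred_eq] at hx ⊢
        rw [hsum]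
        exact add_le_add hx.1 (mul_le_mul_of_nonneg_left hx.2 hb)
    _ ≤ _ := by
        rw [hm]
        refine gaussianReal_ge_le (by positivity) ?_ hac
        rw [Real.coe_toNNReal']
        exact max_le hvar (by positivity)

end Functionals

/-! ### The scale of Gaussian maxima -/

/-- The growth rate `√(2 log N)` of the maximum of `N` standard normal variables. -/
noncomputable def maxRate (N : ℕ) : ℝ := √(2 * Real.log N)

section Rates

lemma tendsto_maxRate : Tendsto maxRate atTop atTop :=
  Real.tendsto_sqrt_atTop.comp
    ((Real.tendsto_log_atTop.comp tendsto_natCast_atTop_atTop).const_mul_atTop two_pos)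

lemma maxRate_sq {N : ℕ} (hN : 1 ≤ N) : maxRate N ^ 2 = 2 * Real.log N :=
  Real.sq_sqrt (mul_nonneg zero_le_two (Real.log_nonneg (by exact_mod_cast hN)))

lemma natCast_eq_exp {N : ℕ} (hN : 1 ≤ N) : (N : ℝ) = Real.exp (maxRate N ^ 2 / 2) := by
  rw [maxRate_sq hN, mul_div_cancel_left₀ _ two_ne_zero, Real.exp_log (by exact_mod_cast hN)]

/-- `N` times a Gaussian type probability tends to zero if its exponent beats `-T² / 2`. -/
lemma tendsto_natCast_mul_exp {g : ℝ → ℝ} (hg : Tendsto (fun T => T ^ 2 / 2 + g T) atTop atBot) :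
    Tendsto (fun N : ℕ => (N : ℝ) * Real.exp (g (maxRate N))) atTop (𝓝 0) := by
  refine (Real.tendsto_exp_atBot.comp (hg.comp tendsto_maxRate)).congr' ?_
  filter_upwards [eventually_ge_atTop 1] with N hN
  simp only [Function.comp]
  rw [Real.exp_add, ← natCast_eq_exp hN]

lemma tendsto_quadratic_atBot {a b c : ℝ} (h : a < 0 ∨ a = 0 ∧ b < 0) :
    Tendsto (fun T : ℝ => a * T ^ 2 + b * T + c) atTop atBot := by
  rcases h with h | ⟨rfl, h⟩
  · have h1 : Tendsto (fun T : ℝ => T * (a * T + b)) atTop atBot :=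
      tendsto_id.atTop_mul_atBot₀
        (tendsto_atBot_add_const_right _ _ (tendsto_id.const_mul_atTop_of_neg h))
    refine (tendsto_atBot_add_const_right _ c h1).congr fun T => ?_
    ring
  · refine (tendsto_atBot_add_const_right _ c (tendsto_id.const_mul_atTop_of_neg h)).congr
      fun T => ?_
    simp

end Rates

/-! ### Extreme points of a Gaussian sample -/

section Extremes

variable {Ω : Type*} [MeasurableSpace Ω] {P : Measure Ω} {p : ℕ}
  {μ : EuclideanSpace ℝ (Fin p)} {σ : Fin p → ℝ} {ρ : Matrix (Fin p) (Fin p) ℝ}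
  {u : ℕ → Ω → EuclideanSpace ℝ (Fin p)}

/-- Since N = exp(T²/2), the union bound equals exp(-δT - δ²/2), which vanishes for every fixed δ >
0. -/
lemma eventually_std_lt (hσ : ∀ j, 0 < σ j) (hρ : ∀ j, ρ j j = 1)
    (hcov : (covMatrix σ ρ).PosDef)
    (hu : ∀ i, HasLaw (u i) (multivariateGaussian μ (covMatrix σ ρ)) P)
    {s : ℝ} (hs : s ^ 2 = 1) (j : Fin p) {δ : ℝ} (hδ : 0 < δ) :
    ∀ᶠ q in whp P, ∀ i < q.1, s * std μ σ (u i q.2) j < maxRate q.1 + δ := by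
  have h := eventually_whp_forall_lt hu
    (A := fun N => {x | maxRate N + δ ≤ s * std μ σ x j})
    (q := fun N => Real.exp (-((maxRate N + δ) ^ 2 / (2 * 1))))
    (fun N => (isClosed_le continuous_const (by fun_prop)).measurableSet)
    (by
      filter_upwards [tendsto_maxRate.eventually_ge_atTop 0] with N hN
      rw [(hasLaw_std hσ hρ hcov hs j).measure_eq (p := fun y => maxRate N + δ ≤ y)
        measurableSet_Ici]
      exact gaussianReal_ge_le one_pos (by simp) (by positivity))
    (tendsto_natCast_mul_exp (g := fun T => -((T + δ) ^ 2 / (2 * 1)))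
      ((tendsto_quadratic_atBot (a := 0) (b := -δ) (c := -δ ^ 2 / 2)
        (Or.inr ⟨rfl, by linarith⟩)).congr fun T => by ring))
  filter_upwards [h] with q hq i hi
  simpa using hq i hi

lemma eventually_abs_std_lt (hσ : ∀ j, 0 < σ j) (hρ : ∀ j, ρ j j = 1)
    (hcov : (covMatrix σ ρ).PosDef)
    (hu : ∀ i, HasLaw (u i) (multivariateGaussian μ (covMatrix σ ρ)) P)
    (j : Fin p) {δ : ℝ} (hδ : 0 < δ) :
    ∀ᶠ q in whp P, ∀ i < q.1, |std μ σ (u i q.2) j| < maxRate q.1 + δ := by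
  filter_upwards [eventually_std_lt hσ hρ hcov hu (s := 1) (by norm_num) j hδ,
    eventually_std_lt hσ hρ hcov hu (s := -1) (by norm_num) j hδ] with q h1 h2 i hi
  have h1 := h1 i hi
  have h2 := h2 i hi
  rw [abs_lt]
  constructor <;> linarith

/-- With weight b = η and noise level ηT, the joint tail exponent is -(1 + η²)T²/2 + δT up to a
constant. Multiplication by N = exp(T²/2) still leaves -η²T²/2 in the lead. -/
lemma eventually_noise_lt (hσ : ∀ j, 0 < σ j) (hρ : ∀ j, ρ j j = 1)
    (hcov : (covMatrix σ ρ).PosDef)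
    (hu : ∀ i, HasLaw (u i) (multivariateGaussian μ (covMatrix σ ρ)) P)
    {s s' : ℝ} (hs : s ^ 2 = 1) (hs' : s' ^ 2 = 1) (l j : Fin p) (δ : ℝ) {η : ℝ} (hη : 0 < η) :
    ∀ᶠ q in whp P, ∀ i < q.1, maxRate q.1 - δ ≤ s * std μ σ (u i q.2) j →
      s' * (std μ σ (u i q.2) l - ρ l j * std μ σ (u i q.2) j) < η * maxRate q.1 := by
  have h := eventually_whp_forall_lt hu
    (A := fun N => {x | maxRate N - δ ≤ s * std μ σ x j} ∩
      {x | η * maxRate N ≤ s' * (std μ σ x l - ρ l j * std μ σ x j)})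
    (q := fun N => Real.exp (-((maxRate N - δ + η * (η * maxRate N)) ^ 2 / (2 * (1 + η ^ 2)))))
    (fun N => ((isClosed_le continuous_const (by fun_prop)).inter
      (isClosed_le continuous_const (by fun_prop))).measurableSet)
    (by
      filter_upwards [tendsto_maxRate.eventually_ge_atTop (max 0 δ)] with N hN
      have h1 := (le_max_left _ _).trans hN
      have h2 := (le_max_right _ _).trans hN
      refine measure_std_ge_and_noise_ge_le hσ hρ hcov hs hη.le hs' l j ?_
      have : 0 ≤ η * (η * maxRate N) := by positivity
      linarith)
    (tendsto_natCast_mul_exp (g := fun T => -((T - δ + η * (η * T)) ^ 2 / (2 * (1 + η ^ 2))))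
      ((tendsto_quadratic_atBot (a := -η ^ 2 / 2) (b := δ) (c := -δ ^ 2 / (2 * (1 + η ^ 2)))
        (Or.inl (by nlinarith))).congr fun T => by field_simp; ring))
  filter_upwards [h] with q hq i hi h1
  exact lt_of_not_ge fun h2 => hq i hi ⟨h1, h2⟩

lemma eventually_abs_noise_lt (hσ : ∀ j, 0 < σ j) (hρ : ∀ j, ρ j j = 1)
    (hcov : (covMatrix σ ρ).PosDef)
    (hu : ∀ i, HasLaw (u i) (multivariateGaussian μ (covMatrix σ ρ)) P)
    {s : ℝ} (hs : s ^ 2 = 1) (l j : Fin p) (δ : ℝ) {η : ℝ} (hη : 0 < η) :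
    ∀ᶠ q in whp P, ∀ i < q.1, maxRate q.1 - δ ≤ s * std μ σ (u i q.2) j →
      |std μ σ (u i q.2) l - ρ l j * std μ σ (u i q.2) j| < η * maxRate q.1 := by
  filter_upwards [eventually_noise_lt hσ hρ hcov hu hs (s' := 1) (by norm_num) l j δ hη,
    eventually_noise_lt hσ hρ hcov hu hs (s' := -1) (by norm_num) l j δ hη] with q h1 h2 i hi h
  have h1 := h1 i hi h
  have h2 := h2 i hi h
  rw [abs_lt]
  constructor <;> linarith

/-- A binomial count with mean tending to infinity exceeds any constant. -/
lemma eventually_le_card_filter [IsProbabilityMeasure P] {E : Type*} [MeasurableSpace E]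
    {γ : Measure E} {u : ℕ → Ω → E} (hu : ∀ i, HasLaw (u i) γ P) (hind : iIndepFun u P)
    {A : ℕ → E → Prop} [∀ N x, Decidable (A N x)] (hA : ∀ N, MeasurableSet {x | A N x})
    (hlim : Tendsto (fun N : ℕ => N * γ.real {x | A N x}) atTop atTop) (K : ℕ) :
    ∀ᶠ q in whp P, K ≤ ((Finset.range q.1).filter fun i => A q.1 (u i q.2)).card := by
  rw [eventually_whp_iff]
  set m : ℕ → ℝ := fun N => N * γ.real {x | A N x} with hm
  have h0 : Tendsto (fun N : ℕ => ENNReal.ofReal (4 / m N)) atTop (𝓝 0) := by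
    simpa using ENNReal.tendsto_ofReal (hlim.const_div_atTop 4)
  refine tendsto_of_tendsto_of_tendsto_of_le_of_le' tendsto_const_nhds h0
    (Eventually.of_forall fun _ => zero_le) ?_
  filter_upwards [hlim.eventually_ge_atTop (2 * K), hlim.eventually_gt_atTop 0] with N hN hN0
  change 2 * (K : ℝ) ≤ m N at hN
  change 0 < m N at hN0
  set f : E → ℝ := Set.indicator {x | A N x} 1 with hf
  have hfm : Measurable f := measurable_one.indicator (hA N)
  set X : ℕ → Ω → ℝ := fun i => f ∘ u i with hX
  have hXm : ∀ i, AEMeasurable (X i) P := fun i => hfm.comp_aemeasurable (hu i).aemeasurable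
  have hXb : ∀ i ω, X i ω ∈ Set.Icc (0 : ℝ) 1 := by
    intro i ω
    simp only [hX, hf, Function.comp, Set.indicator_apply]
    split_ifs <;> simp
  have hX2 : ∀ i, MemLp (X i) 2 P := fun i =>
    memLp_of_bounded (ae_of_all _ (hXb i)) (hXm i).aestronglyMeasurable 2
  have hmean : ∀ i, ∫ ω, X i ω ∂P = γ.real {x | A N x} := by
    intro i
    have := (hu i).integral_comp (f := f) hfm.aestronglyMeasurable
    rw [hX, this, hf, integral_indicator_one (hA N)]
  have hvar : ∀ i, Var[X i; P] ≤ γ.real {x | A N x} := by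
    intro i
    refine (variance_le_expectation_sq (hXm i).aestronglyMeasurable).trans ?_
    rw [← hmean i]
    refine integral_mono (hX2 i).integrable_sq ((hX2 i).integrable (by norm_num)) fun ω => ?_
    have := hXb i ω
    simp only [Pi.pow_apply]
    nlinarith [this.1, this.2]
  have hsum : ∀ ω, (∑ i ∈ Finset.range N, X i) ω =
      ((Finset.range N).filter fun i => A N (u i ω)).card := by
    intro ω
    simp [hX, hf, Set.indicator_apply, Finset.sum_apply, Finset.sum_boole]
  have hS2 : MemLp (∑ i ∈ Finset.range N, X i) 2 P := memLp_finsetSum' _ fun i _ => hX2 i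
  have hES : ∫ ω, (∑ i ∈ Finset.range N, X i) ω ∂P = m N := by
    simp only [Finset.sum_apply]
    rw [integral_finsetSum _ fun i _ => (hX2 i).integrable (by norm_num)]
    simp [hmean, hm]
  have hVS : Var[∑ i ∈ Finset.range N, X i; P] ≤ m N := by
    rw [IndepFun.variance_sum (fun i _ => hX2 i) fun i _ j _ hij =>
      (hind.indepFun hij).comp hfm hfm]
    refine (Finset.sum_le_sum fun i _ => hvar i).trans ?_
    simp [hm]
  -- Chebyshev's inequality at distance m/2 from the mean m; as the variance is at most m, the
  -- failure probability is at most 4/m. A mean of at least 2K puts the event of fewer than K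
  -- successes into this deviation.
  have hcheb := meas_ge_le_variance_div_sq hS2 (half_pos hN0)
  rw [hES] at hcheb
  refine (measure_mono fun ω hω => ?_).trans (hcheb.trans (ENNReal.ofReal_le_ofReal ?_))
  · simp only [Set.mem_ofPred_eq, not_le] at hω ⊢
    rw [hsum]
    have : ((((Finset.range N).filter fun i => A N (u i ω)).card : ℕ) : ℝ) < K := by
      exact_mod_cast hω
    rw [abs_sub_comm, le_abs]
    left
    linarith
  · rw [div_le_div_iff₀ (by positivity) hN0]
    nlinarith

/-- The expected count is at least a constant times exp(T²/2 - (T - δ/2)²/2) = exp(δT/2 - δ²/8), by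
the lower tail bound on an interval of length δ/2. -/
lemma eventually_le_card_std_ge [IsProbabilityMeasure P] (hσ : ∀ j, 0 < σ j)
    (hρ : ∀ j, ρ j j = 1) (hcov : (covMatrix σ ρ).PosDef)
    (hu : ∀ i, HasLaw (u i) (multivariateGaussian μ (covMatrix σ ρ)) P) (hind : iIndepFun u P)
    {s : ℝ} (hs : s ^ 2 = 1) (j : Fin p) {δ : ℝ} (hδ : 0 < δ) (K : ℕ) :
    ∀ᶠ q in whp P, K ≤ ((Finset.range q.1).filter fun i =>
      maxRate q.1 - δ ≤ s * std μ σ (u i q.2) j).card := by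
  refine eventually_le_card_filter (A := fun N x => maxRate N - δ ≤ s * std μ σ x j) hu hind
    (fun N => (isClosed_le continuous_const (by fun_prop)).measurableSet) ?_ K
  have h1 : Tendsto (fun T : ℝ => δ / 2 * (√(2 * Real.pi))⁻¹ *
      Real.exp (T ^ 2 / 2 + -(T - δ + δ / 2) ^ 2 / 2)) atTop atTop := by
    refine Tendsto.const_mul_atTop (by positivity) (Real.tendsto_exp_atTop.comp ?_)
    have := tendsto_neg_atBot_atTop.comp (tendsto_quadratic_atBot (a := 0) (b := -(δ / 2))
      (c := δ ^ 2 / 8) (Or.inr ⟨rfl, by linarith⟩))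
    refine this.congr fun T => ?_
    simp only [Function.comp]
    ring
  refine tendsto_atTop_mono' _ ?_ (h1.comp tendsto_maxRate)
  filter_upwards [eventually_ge_atTop 1, tendsto_maxRate.eventually_ge_atTop δ] with N hN hT
  simp only [Function.comp]
  rw [measureReal_def, (hasLaw_std hσ hρ hcov hs j).measure_eq
    (p := fun y => maxRate N - δ ≤ y) measurableSet_Ici]
  have h2 := le_gaussianReal_ge (t := maxRate N - δ) (h := δ / 2) (by linarith)
  have h3 := ENNReal.toReal_mono (measure_ne_top _ _) h2
  rw [ENNReal.toReal_ofReal (by positivity)] at h3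
  rw [Real.exp_add, ← natCast_eq_exp hN]
  calc _ = (N : ℝ) * (δ / 2 * ((√(2 * Real.pi))⁻¹ *
        Real.exp (-(maxRate N - δ + δ / 2) ^ 2 / 2))) := by ring
    _ ≤ _ := by gcongr

end Extremes

/-! ### Anti-concentration of exponential combinations -/

section AntiConcentration

variable {p : ℕ} {μ : EuclideanSpace ℝ (Fin p)} {S : Matrix (Fin p) (Fin p) ℝ}

/-- Probabilistically: the functional given by a row of the precision matrix has covariance 1 with
its own coordinate and 0 with all others. -/
lemma posDef_mulVec_inv_row (hS : S.PosDef) (l : Fin p) : S.mulVec (S⁻¹ l) = Pi.single l 1 := by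
  have hsym : S⁻¹.IsHermitian := hS.1.inv
  have h1 : S⁻¹ l = S⁻¹.mulVec (Pi.single l 1) := by
    ext i
    have := hsym.apply i l
    simp only [star_trivial] at this
    simp [this]
  rw [h1, Matrix.mulVec_mulVec, Matrix.mul_nonsing_inv _ (isUnit_iff_ne_zero.2 hS.det_pos.ne'),
    Matrix.one_mulVec]

/-- The residual of the `l`-th coordinate given the others, up to a factor. -/
noncomputable def residual (S : Matrix (Fin p) (Fin p) ℝ) (l : Fin p) :
    EuclideanSpace ℝ (Fin p) →L[ℝ] ℝ := innerSL ℝ (WithLp.toLp 2 (S⁻¹ l))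

/-- The part of a Gaussian vector that is independent of the `l`-th residual. -/
noncomputable def residualFree (S : Matrix (Fin p) (Fin p) ℝ) (l : Fin p) :
    EuclideanSpace ℝ (Fin p) →L[ℝ] EuclideanSpace ℝ (Fin p) :=
  ContinuousLinearMap.id ℝ _ - (residual S l).smulRight (EuclideanSpace.single l (S⁻¹ l l)⁻¹)

lemma residualFree_add (x : EuclideanSpace ℝ (Fin p)) (l : Fin p) :
    residualFree S l x + residual S l x • EuclideanSpace.single l (S⁻¹ l l)⁻¹ = x := by
  simp [residualFree]

/-- The pair is jointly Gaussian, so vanishing covariances suffice. The residual has variance `S⁻¹ l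
l` and covariance 1 with coordinate l, so subtracting its multiple by `(S⁻¹ l l)⁻¹` in direction l
removes all correlation. -/
lemma indepFun_residualFree_residual (hS : S.PosDef) (l : Fin p) :
    IndepFun (residualFree S l) (residual S l) (multivariateGaussian μ S) := by
  have hQ : S⁻¹ l l ≠ 0 := (hS.inv.diag_pos (i := l)).ne'
  have hg : HasGaussianLaw (fun x => (residualFree S l x, residual S l x))
      (multivariateGaussian μ S) :=
    (IsGaussian.hasGaussianLaw_id (μ := multivariateGaussian μ S)).map_fun
      ((residualFree S l).prod (residual S l))
  refine hg.indepFun_of_covariance_inner fun x y => ?_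
  have h1 : (fun ω => inner ℝ x (residualFree S l ω)) =
      fun ω => inner ℝ (x - (x l / S⁻¹ l l) • WithLp.toLp 2 (S⁻¹ l)) ω := by
    ext ω
    simp only [residualFree, residual, sub_apply, ContinuousLinearMap.id_apply,
      ContinuousLinearMap.smulRight_apply, innerSL_apply_apply, inner_sub_right, inner_sub_left,
      inner_smul_right, inner_smul_left, EuclideanSpace.inner_single_right]
    simp
    ring
  have h2 : (fun ω => inner ℝ y (residual S l ω)) =
      fun ω => inner ℝ (y • WithLp.toLp 2 (S⁻¹ l)) ω := by
    ext ω
    simp [residual, inner_smul_left, mul_comm]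
  rw [h1, h2, ← covarianceBilin_apply_eq_cov IsGaussian.memLp_two_id,
    covarianceBilin_multivariateGaussian hS.posSemidef]
  simp only [WithLp.ofLp_smul, WithLp.ofLp_sub, Matrix.mulVec_smul, posDef_mulVec_inv_row hS]
  simp [hQ]

lemma map_residual_le_ediam (hS : S.PosDef) (l : Fin p) (s : Set ℝ) :
    (multivariateGaussian μ S).map (residual S l) s ≤
      ENNReal.ofReal (√(2 * Real.pi * S⁻¹ l l))⁻¹ * Metric.ediam s := by
  have hQ : 0 < S⁻¹ l l := hS.inv.diag_pos
  have hv : Var[residual S l; multivariateGaussian μ S] = S⁻¹ l l := by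
    have h := covarianceBilin_multivariateGaussian (μ := μ) hS.posSemidef
      (WithLp.toLp 2 (S⁻¹ l)) (WithLp.toLp 2 (S⁻¹ l))
    rw [covarianceBilin_self IsGaussian.memLp_two_id] at h
    simp only [posDef_mulVec_inv_row hS] at h
    simpa [residual] using h
  rw [IsGaussian.map_eq_gaussianReal, hv]
  refine (gaussianReal_le_ediam (by simpa using hQ) s).trans ?_
  rw [Real.coe_toNNReal _ hQ.le]

/-- Beyond c the exponential has slope at least e^c. Two points whose values lie within 2D of each
other after multiplication by |b| are therefore within 2D e^{-c} / |b|. -/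
lemma abs_sub_le_of_exp_combination {b y x x' c D : ℝ} (hb : b ≠ 0) (hx : c ≤ x) (hx' : c ≤ x')
    (h : |y + b * Real.exp x| < D) (h' : |y + b * Real.exp x'| < D) :
    |x - x'| ≤ 2 * D / |b| * Real.exp (-c) := by
  wlog hle : x' ≤ x generalizing x x'
  · rw [abs_sub_comm]
    exact this hx' hx h' h (le_of_not_ge hle)
  have h1 : |b| * (Real.exp x - Real.exp x') ≤ 2 * D := by
    have h2 : |b| * (Real.exp x - Real.exp x') =
        |(y + b * Real.exp x) - (y + b * Real.exp x')| := by
      rw [show (y + b * Real.exp x) - (y + b * Real.exp x') =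
          b * (Real.exp x - Real.exp x') by ring,
        abs_mul, abs_of_nonneg (a := Real.exp x - Real.exp x')
          (sub_nonneg.2 (Real.exp_le_exp.2 hle))]
    rw [h2]
    linarith [abs_sub (y + b * Real.exp x) (y + b * Real.exp x')]
  have h3 : Real.exp c * (x - x') ≤ Real.exp x - Real.exp x' := by
    have h4 : Real.exp x = Real.exp x' * Real.exp (x - x') := by rw [← Real.exp_add]; ring_nf
    have h5 := Real.add_one_le_exp (x - x')
    have h6 := Real.exp_le_exp.2 hx'
    have h7 := Real.exp_pos c
    rw [h4]
    nlinarith [mul_le_mul_of_nonneg_right h6 (sub_nonneg.2 hle), Real.exp_pos x']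
  rw [abs_of_nonneg (sub_nonneg.2 hle), Real.exp_neg, ← div_eq_mul_inv,
    le_div_iff₀ (Real.exp_pos c), le_div_iff₀ (abs_pos.2 hb)]
  nlinarith [mul_le_mul_of_nonneg_left h3 (abs_nonneg b)]

lemma measurableSet_exp_combination_small {l j : Fin p} (b : Fin p → ℝ) (b₀ : ℝ) {H : ℝ → Prop}
    (hH : MeasurableSet {t | H t}) (c D : ℝ) :
    MeasurableSet {x : EuclideanSpace ℝ (Fin p) |
      H (x j) ∧ c ≤ x l ∧ |b₀ + ∑ i, b i * Real.exp (x i)| < D} :=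
  (measurableSet_preimage (f := fun x : EuclideanSpace ℝ (Fin p) => x j) (by fun_prop) hH).inter
    (MeasurableSet.inter (s₁ := {x : EuclideanSpace ℝ (Fin p) | c ≤ x l})
      (s₂ := {x : EuclideanSpace ℝ (Fin p) | |b₀ + ∑ i, b i * Real.exp (x i)| < D})
      (measurableSet_le measurable_const (by fun_prop))
      (measurableSet_lt (by fun_prop) measurable_const))

/-- An exponential combination of the coordinates of a Gaussian vector is rarely small when one of
the coordinates is large, also among the vectors for which another coordinate is extreme. -/
lemma measure_exp_combination_small_le (hS : S.PosDef) {l j : Fin p} (hlj : l ≠ j)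
    (b : Fin p → ℝ) (b₀ : ℝ) (hb : b l ≠ 0) {H : ℝ → Prop} (hH : MeasurableSet {t | H t})
    (c D : ℝ) :
    multivariateGaussian μ S {x | H (x j) ∧ c ≤ x l ∧ |b₀ + ∑ i, b i * Real.exp (x i)| < D} ≤
      ENNReal.ofReal (√(2 * Real.pi * S⁻¹ l l))⁻¹ *
        ENNReal.ofReal (S⁻¹ l l * (2 * D / |b l| * Real.exp (-c))) *
        multivariateGaussian μ S {x | H (x j)} := by
  have hQ : 0 < S⁻¹ l l := hS.inv.diag_pos
  set γ := multivariateGaussian μ S with hγ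
  set A : Set (EuclideanSpace ℝ (Fin p)) :=
    {x | H (x j) ∧ c ≤ x l ∧ |b₀ + ∑ i, b i * Real.exp (x i)| < D} with hA
  have hAm : MeasurableSet A := measurableSet_exp_combination_small b b₀ hH c D
  set e : EuclideanSpace ℝ (Fin p) := EuclideanSpace.single l (S⁻¹ l l)⁻¹ with he
  -- Moving along e changes only coordinate l, so the event on coordinate j depends on the
  -- independent part alone and factors out of the product integral.
  have hej : e j = 0 := by simp [he, hlj.symm]
  have hel : e l = (S⁻¹ l l)⁻¹ := by simp [he]
  set comb : EuclideanSpace ℝ (Fin p) × ℝ → EuclideanSpace ℝ (Fin p) := fun y => y.1 + y.2 • e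
  have hcomb : Measurable comb := by fun_prop
  have hprod : γ.map (fun x => (residualFree S l x, residual S l x)) =
      (γ.map (residualFree S l)).prod (γ.map (residual S l)) :=
    (indepFun_iff_map_prod_eq_prod_map_map (by fun_prop) (by fun_prop)).1
      (indepFun_residualFree_residual hS l)
  have h1 : γ A = (γ.map (residualFree S l)).prod (γ.map (residual S l)) (comb ⁻¹' A) := by
    rw [← hprod, Measure.map_apply (by fun_prop) (hcomb hAm)]
    congr 1
    ext x
    simp only [Set.mem_preimage, comb, he, residualFree_add]
  have : IsProbabilityMeasure (γ.map (residual S l)) :=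
    Measure.isProbabilityMeasure_map (by fun_prop)
  set K := ENNReal.ofReal (√(2 * Real.pi * S⁻¹ l l))⁻¹ *
        ENNReal.ofReal (S⁻¹ l l * (2 * D / |b l| * Real.exp (-c))) with hK
  have hHm : MeasurableSet {y : EuclideanSpace ℝ (Fin p) | H (y j)} :=
    measurableSet_preimage (f := fun x : EuclideanSpace ℝ (Fin p) => x j) (by fun_prop) hH
  rw [h1, Measure.prod_apply (hcomb hAm)]
  calc ∫⁻ y, γ.map (residual S l) (Prod.mk y ⁻¹' (comb ⁻¹' A)) ∂(γ.map (residualFree S l))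
      ≤ ∫⁻ y, {y : EuclideanSpace ℝ (Fin p) | H (y j)}.indicator (fun _ => K) y
          ∂(γ.map (residualFree S l)) := by
        refine lintegral_mono fun y => ?_
        by_cases hy : H (y j)
        · rw [Set.indicator_of_mem (by exact hy)]
          refine (map_residual_le_ediam hS l _).trans ?_
          rw [hK]
          gcongr
          -- For fixed y the combination varies only through exp of coordinate l, so the slice has
          -- small diameter; the factor `S⁻¹ l l` converts displacements of that coordinate into
          -- displacements of the residual.
          refine Metric.ediam_le fun t ht t' ht' => ?_
          rw [edist_dist]
          refine ENNReal.ofReal_le_ofReal ?_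
          have key : ∀ t : ℝ, t ∈ Prod.mk y ⁻¹' (comb ⁻¹' A) → c ≤ y l + t * (S⁻¹ l l)⁻¹ ∧
              |(b₀ + ∑ i ∈ Finset.univ.erase l, b i * Real.exp ((y + t • e) i)) +
                b l * Real.exp (y l + t * (S⁻¹ l l)⁻¹)| < D := by
            rintro t ⟨-, h2, h3⟩
            simp only [comb, PiLp.add_apply, PiLp.smul_apply, hel, smul_eq_mul] at h2
            refine ⟨h2, ?_⟩
            rw [← Finset.add_sum_erase _ _ (Finset.mem_univ l)] at h3
            simp only [comb, PiLp.add_apply, PiLp.smul_apply, hel, smul_eq_mul] at h3 ⊢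
            convert h3 using 2
            ring
          have hrest : ∀ t : ℝ, ∑ i ∈ Finset.univ.erase l, b i * Real.exp ((y + t • e) i) =
              ∑ i ∈ Finset.univ.erase l, b i * Real.exp (y i) := by
            intro t
            refine Finset.sum_congr rfl fun i hi => ?_
            have : i ≠ l := Finset.ne_of_mem_erase hi
            simp [he, this]
          obtain ⟨h2, h3⟩ := key t ht
          obtain ⟨h2', h3'⟩ := key t' ht'
          rw [hrest] at h3 h3'
          have h4 := abs_sub_le_of_exp_combination hb h2 h2' h3 h3'
          have h5 : dist t t' = S⁻¹ l l *
              |y l + t * (S⁻¹ l l)⁻¹ - (y l + t' * (S⁻¹ l l)⁻¹)| := by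
            rw [Real.dist_eq, ← abs_of_pos hQ, ← abs_mul, abs_of_pos hQ]
            congr 1
            field_simp
            ring
          rw [h5]
          gcongr
        · have : Prod.mk y ⁻¹' (comb ⁻¹' A) = ∅ := by
            ext t
            simp [comb, hA, hej, hy]
          rw [this, measure_empty]
          exact zero_le
    _ = K * γ {x | H (x j)} := by
        rw [lintegral_indicator_const hHm, Measure.map_apply (by fun_prop) hHm]
        congr 2
        ext x
        have := congrArg (fun y : EuclideanSpace ℝ (Fin p) => y j) (residualFree_add (S := S) x l)
        simp only [← he, PiLp.add_apply, PiLp.smul_apply, hej, smul_zero, add_zero] at this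
        simp [this]

variable {Ω : Type*} [MeasurableSpace Ω] {P : Measure Ω} {σ : Fin p → ℝ}
  {ρ : Matrix (Fin p) (Fin p) ℝ} {u : ℕ → Ω → EuclideanSpace ℝ (Fin p)}

/-- Exponential combinations of the coordinates diverge over the points at which some coordinate is
extreme if this drives another coordinate to infinity. -/
lemma eventually_le_abs_exp_combination (hσ : ∀ j, 0 < σ j) (hρ : ∀ j, ρ j j = 1)
    (hcov : (covMatrix σ ρ).PosDef)
    (hu : ∀ i, HasLaw (u i) (multivariateGaussian μ (covMatrix σ ρ)) P)
    {s : ℝ} (hs : s ^ 2 = 1) {l j : Fin p} (hlj : l ≠ j) (hρs : 0 < s * ρ l j)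
    (b : Fin p → ℝ) (b₀ : ℝ) (hb : b l ≠ 0) :
    ∃ δ > 0, ∀ D > 0, ∀ᶠ q in whp P, ∀ i < q.1, maxRate q.1 - δ ≤ s * std μ σ (u i q.2) j →
      D ≤ |b₀ + ∑ a, b a * Real.exp (u i q.2 a)| := by
  -- Coordinate l grows like σ_l s ρ_lj T; half of this rate is a safe lower bound.
  set c := σ l * (s * ρ l j) / 2 with hc
  have hc0 : 0 < c := by have := hσ l; positivity
  -- Lowering the threshold by c/2 lets in a factor exp(cT/2), while the window costs exp(-cT); the
  -- union bound decays like exp(-cT/2).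
  refine ⟨c / 2, by positivity, fun D hD => ?_⟩
  set K := (√(2 * Real.pi * (covMatrix σ ρ)⁻¹ l l))⁻¹ *
    ((covMatrix σ ρ)⁻¹ l l * (2 * D / |b l|)) with hK
  have hQ : 0 < (covMatrix σ ρ)⁻¹ l l := hcov.inv.diag_pos
  have hcol : ∀ a : ℝ, MeasurableSet {t : ℝ | a ≤ s * ((t - μ j) / σ j)} := fun a =>
    (isClosed_le continuous_const (by fun_prop)).measurableSet
  have h := eventually_whp_forall_lt hu
    (A := fun N => {x | maxRate N - c / 2 ≤ s * ((x j - μ j) / σ j) ∧ c * maxRate N ≤ x l ∧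
      |b₀ + ∑ i, b i * Real.exp (x i)| < D})
    (q := fun N => K * Real.exp (-(c * maxRate N) + -((maxRate N - c / 2) ^ 2 / (2 * 1))))
    (fun N => measurableSet_exp_combination_small b b₀ (hcol _) _ D)
    (by
      filter_upwards [tendsto_maxRate.eventually_ge_atTop (c / 2)] with N hN
      refine (measure_exp_combination_small_le hcov hlj b b₀ hb (hcol _) _ D).trans ?_
      have hlaw : multivariateGaussian μ (covMatrix σ ρ)
          {x | maxRate N - c / 2 ≤ s * ((x j - μ j) / σ j)} = _ :=
        (hasLaw_std hσ hρ hcov hs j).measure_eq (p := fun y => maxRate N - c / 2 ≤ y)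
          measurableSet_Ici
      rw [hlaw]
      refine (mul_le_mul_right (gaussianReal_ge_le one_pos (by simp) (by linarith)) _).trans ?_
      rw [← ENNReal.ofReal_mul (by positivity), ← ENNReal.ofReal_mul (by positivity), Real.exp_add]
      refine ENNReal.ofReal_le_ofReal (le_of_eq ?_)
      rw [hK]; ring)
    (by
      have := (tendsto_natCast_mul_exp (g := fun T => -(c * T) + -((T - c / 2) ^ 2 / (2 * 1)))
        ((tendsto_quadratic_atBot (a := 0) (b := -(c / 2)) (c := -c ^ 2 / 8)
        (Or.inr ⟨rfl, by linarith⟩)).congr fun T => by ring)).const_mul K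
      rw [mul_zero] at this
      refine this.congr fun N => by ring)
  -- Noise of this size uses up a quarter of the drift. Another quarter absorbs the constants, and
  -- half remains, as the choice of c requires.
  have hη : 0 < s * ρ l j / 4 := by positivity
  have hT : Tendsto (fun q : ℕ × Ω => c / 2 * maxRate q.1) (whp P) atTop :=
    (tendsto_maxRate.comp tendsto_fst_whp).const_mul_atTop (by positivity)
  filter_upwards [h, eventually_abs_noise_lt hσ hρ hcov hu hs l j (c / 2) hη,
    hT.eventually_ge_atTop (σ l * (s * ρ l j) * (c / 2) - μ l)] with q h1 h2 h3 i hi h4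
  refine le_of_not_gt fun h5 => h1 i hi ⟨h4, ?_, h5⟩
  have h6 := (abs_lt.1 (h2 i hi h4)).1
  have h7 := eq_add_mul_std (μ := μ) hσ (u i q.2) l
  set W := std μ σ (u i q.2) j
  set V := std μ σ (u i q.2) l
  have h8 : ρ l j * W = (s * ρ l j) * (s * W) := by
    rw [show (s * ρ l j) * (s * W) = s ^ 2 * (ρ l j * W) by ring, hs, one_mul]
  have h9 := mul_le_mul_of_nonneg_left h4 hρs.le
  have h10 : (s * ρ l j) * (maxRate q.1 - c / 2) - s * ρ l j / 4 * maxRate q.1 ≤ V := by linarith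
  have h11 := mul_le_mul_of_nonneg_left h10 (hσ l).le
  rw [h7]
  have h12 : c * maxRate q.1 = σ l * (s * ρ l j) / 2 * maxRate q.1 := by rw [hc]
  have h13 : c / 2 * maxRate q.1 = σ l * (s * ρ l j) / 4 * maxRate q.1 := by rw [hc]; ring
  rw [h12]
  rw [h13] at h3
  linarith

end AntiConcentration

/-! ### Normal mixtures with separating means -/

section Mixture

variable {ι : Type*} {π σ : ι → ℝ}

/-- The contribution of cluster `g` to a normal mixture density. -/
noncomputable def comp (π σ ν : ι → ℝ) (g : ι) (y : ℝ) : ℝ :=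
  π g * gaussianPDFReal (ν g) (σ g ^ 2).toNNReal y

lemma comp_pos (hπ : ∀ g, 0 < π g) (hσ : ∀ g, 0 < σ g) (ν : ι → ℝ) (g : ι) (y : ℝ) :
    0 < comp π σ ν g y := by
  refine mul_pos (hπ g) (gaussianPDFReal_pos _ _ _ ?_)
  have := hσ g
  simpa using this.ne'

lemma continuous_comp (hσ : ∀ g, 0 < σ g) (ν : ι → ℝ) (g : ι) : Continuous (comp π σ ν g) := by
  unfold comp gaussianPDFReal
  have : 0 < σ g ^ 2 := pow_pos (hσ g) 2
  fun_prop

lemma one_add_sq_sq_le_exp {a : ℝ} (ha : 0 < a) :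
    ∃ C > 0, ∀ t : ℝ, (1 + t ^ 2) ^ 2 ≤ C * Real.exp (a * t ^ 2) := by
  refine ⟨2 * (1 + 1 / a) ^ 2, by positivity, fun t => ?_⟩
  have h1 := Real.quadratic_le_exp_of_nonneg (x := a * t ^ 2) (by positivity)
  refine le_trans ?_ (mul_le_mul_of_nonneg_left h1 (by positivity))
  set w := a * t ^ 2 with hw
  have hw0 : 0 ≤ w := by positivity
  have h2 : t ^ 2 = w / a := by rw [hw]; field_simp
  rw [h2]
  have h3 : 1 + w / a ≤ (1 + 1 / a) * (1 + w) := by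
    have : 0 ≤ 1 / a := by positivity
    have : w / a = w * (1 / a) := by ring
    nlinarith
  calc (1 + w / a) ^ 2 ≤ ((1 + 1 / a) * (1 + w)) ^ 2 := by
        have : 0 ≤ w / a := by positivity
        gcongr
    _ = (1 + 1 / a) ^ 2 * (1 + w) ^ 2 := by ring
    _ ≤ 2 * (1 + 1 / a) ^ 2 * (1 + w + w ^ 2 / 2) := by
        have : 0 ≤ (1 + 1 / a) ^ 2 := by positivity
        nlinarith

/-- The square root of a component decays like exp(-t²/(4σ²)) in the residual t. Half of this
exponent pays for the polynomial factor and the other half is kept. -/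
lemma sqrt_comp_mul_le (hπ : ∀ g, 0 < π g) (hσ : ∀ g, 0 < σ g) (g : ι) :
    ∃ κ > 0, ∃ C > 0, ∀ ν : ι → ℝ, ∀ y, √(comp π σ ν g y) * (1 + (y - ν g) ^ 2) ^ 2 ≤
      C * Real.exp (-κ * (y - ν g) ^ 2) := by
  have hσg := hσ g
  have hπg := hπ g
  obtain ⟨C, hC, hCt⟩ := one_add_sq_sq_le_exp (a := 1 / (8 * σ g ^ 2)) (by positivity)
  refine ⟨1 / (8 * σ g ^ 2), by positivity,
    √(π g * (√(2 * Real.pi * σ g ^ 2))⁻¹) * C, by positivity, fun ν y => ?_⟩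
  have h1 : comp π σ ν g y = (π g * (√(2 * Real.pi * σ g ^ 2))⁻¹) *
      Real.exp (-(1 / (4 * σ g ^ 2)) * (y - ν g) ^ 2) ^ 2 := by
    rw [comp, gaussianPDFReal, Real.coe_toNNReal _ (by positivity), ← mul_assoc,
      ← Real.exp_nat_mul]
    congr 2
    push_cast
    field_simp
    ring
  rw [h1, Real.sqrt_mul (by positivity), Real.sqrt_sq (by positivity), mul_assoc √_, mul_assoc √_]
  refine mul_le_mul_of_nonneg_left ?_ (Real.sqrt_nonneg _)
  refine (mul_le_mul_of_nonneg_left (hCt (y - ν g)) (by positivity)).trans (le_of_eq ?_)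
  rw [mul_left_comm, ← Real.exp_add]
  congr 2
  field_simp
  ring

lemma integral_comp_mul (ν : ι → ℝ) (f : ℝ → ℝ) (g : ι) :
    ∫ y, comp π σ ν g y * f (y - ν g) =
      π g * ∫ t, gaussianPDFReal 0 (σ g ^ 2).toNNReal t * f t := by
  rw [← integral_sub_right_eq_self (fun t => gaussianPDFReal 0 (σ g ^ 2).toNNReal t * f t) (ν g),
    ← integral_const_mul]
  congr 1
  ext y
  rw [comp, gaussianPDFReal_sub, zero_add, mul_assoc]

variable [Fintype ι]

/-- Normal mixture density with cluster means `ν`. -/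
noncomputable def mix (π σ ν : ι → ℝ) (y : ℝ) : ℝ := ∑ g, comp π σ ν g y

/-- The posterior probability of cluster `g`. -/
noncomputable def resp (π σ ν : ι → ℝ) (g : ι) (y : ℝ) : ℝ := comp π σ ν g y / mix π σ ν y

/-- Integral of a product of two posterior weighted residual functions. -/
noncomputable def respMoment (π σ ν : ι → ℝ) (q q' : ℝ → ℝ) (g h : ι) : ℝ :=
  ∫ y, resp π σ ν g y * q (y - ν g) * (resp π σ ν h y * q' (y - ν h)) * mix π σ ν y

lemma comp_le_mix (hπ : ∀ g, 0 < π g) (hσ : ∀ g, 0 < σ g) (ν : ι → ℝ) (g : ι) (y : ℝ) :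
    comp π σ ν g y ≤ mix π σ ν y :=
  Finset.single_le_sum (f := fun g => comp π σ ν g y) (fun h _ => (comp_pos hπ hσ ν h y).le)
    (Finset.mem_univ g)

lemma mix_pos (hπ : ∀ g, 0 < π g) (hσ : ∀ g, 0 < σ g) (ν : ι → ℝ) [Nonempty ι] (y : ℝ) :
    0 < mix π σ ν y :=
  (comp_pos hπ hσ ν (Classical.arbitrary ι) y).trans_le (comp_le_mix hπ hσ ν _ y)

lemma continuous_mix (hσ : ∀ g, 0 < σ g) (ν : ι → ℝ) : Continuous (mix π σ ν) := by
  unfold mix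
  exact continuous_finsetSum _ fun g _ => continuous_comp hσ ν g

lemma continuous_resp (hπ : ∀ g, 0 < π g) (hσ : ∀ g, 0 < σ g) (ν : ι → ℝ) (g : ι) :
    Continuous (resp π σ ν g) := by
  have : Nonempty ι := ⟨g⟩
  exact (continuous_comp hσ ν g).div (continuous_mix hσ ν) fun y => (mix_pos hπ hσ ν y).ne'

lemma resp_nonneg (hπ : ∀ g, 0 < π g) (hσ : ∀ g, 0 < σ g) (ν : ι → ℝ) (g : ι) (y : ℝ) :
    0 ≤ resp π σ ν g y :=
  div_nonneg (comp_pos hπ hσ ν g y).le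
    ((comp_pos hπ hσ ν g y).le.trans (comp_le_mix hπ hσ ν g y))

lemma resp_le_one (hπ : ∀ g, 0 < π g) (hσ : ∀ g, 0 < σ g) (ν : ι → ℝ) (g : ι) (y : ℝ) :
    resp π σ ν g y ≤ 1 :=
  div_le_one_of_le₀ (comp_le_mix hπ hσ ν g y)
    ((comp_pos hπ hσ ν g y).le.trans (comp_le_mix hπ hσ ν g y))

lemma resp_mul_mix (hπ : ∀ g, 0 < π g) (hσ : ∀ g, 0 < σ g) (ν : ι → ℝ) (g : ι) (y : ℝ) :
    resp π σ ν g y * mix π σ ν y = comp π σ ν g y :=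
  div_mul_cancel₀ _ ((comp_pos hπ hσ ν g y).trans_le (comp_le_mix hπ hσ ν g y)).ne'

lemma sum_resp (hπ : ∀ g, 0 < π g) (hσ : ∀ g, 0 < σ g) (ν : ι → ℝ) [Nonempty ι] (y : ℝ) :
    ∑ g, resp π σ ν g y = 1 := by
  simp only [resp, ← Finset.sum_div]
  exact div_self (mix_pos hπ hσ ν y).ne'

/-- The left side is f_g f_h / f. Both components are at most f, hence √(f_g f_h) ≤ f and one such
factor cancels. This handles the mixture in the denominator without any lower bound for it. -/
lemma resp_mul_resp_mul_mix_le (hπ : ∀ g, 0 < π g) (hσ : ∀ g, 0 < σ g) (ν : ι → ℝ) (g h : ι)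
    (y : ℝ) : resp π σ ν g y * resp π σ ν h y * mix π σ ν y ≤
      √(comp π σ ν g y) * √(comp π σ ν h y) := by
  have hg := comp_pos hπ hσ ν g y
  have hh := comp_pos hπ hσ ν h y
  have hgf := comp_le_mix hπ hσ ν g y
  have hhf := comp_le_mix hπ hσ ν h y
  have hf := hg.trans_le hgf
  have h1 : resp π σ ν g y * resp π σ ν h y * mix π σ ν y =
      (√(comp π σ ν g y) * √(comp π σ ν h y)) ^ 2 / mix π σ ν y := by
    rw [mul_pow, Real.sq_sqrt hg.le, Real.sq_sqrt hh.le, resp, resp]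
    field_simp
  rw [h1, div_le_iff₀ hf, pow_two]
  refine mul_le_mul_of_nonneg_left ?_ (by positivity)
  rw [← Real.sqrt_mul hg.le, Real.sqrt_le_left hf.le, pow_two]
  exact mul_le_mul hgf hhf hh.le hf.le

/-- Uniform Gaussian domination of the square roots of the mixture components. -/
lemma sqrt_comp_mul_le_uniform [Nonempty ι] (hπ : ∀ g, 0 < π g) (hσ : ∀ g, 0 < σ g) :
    ∃ κ > 0, ∃ C > 0, ∀ (g : ι) (ν : ι → ℝ) (y : ℝ),
      √(comp π σ ν g y) * (1 + (y - ν g) ^ 2) ^ 2 ≤ C * Real.exp (-κ * (y - ν g) ^ 2) := by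
  choose κ hκ C hC h using sqrt_comp_mul_le hπ hσ
  obtain ⟨g₀, hg₀⟩ := Finite.exists_min κ
  obtain ⟨g₁, hg₁⟩ := Finite.exists_max C
  refine ⟨κ g₀, hκ g₀, C g₁, hC g₁, fun g ν y => (h g ν y).trans ?_⟩
  have := hC g
  have := hC g₁
  gcongr
  · exact hg₁ g
  · exact hg₀ g

/-- Completing the square isolates a factor depending only on the distance of the centers; this
factor makes the overlap of separated clusters vanish. -/
lemma exp_two_centers (κ a b y : ℝ) :
    Real.exp (-κ * (y - a) ^ 2) * Real.exp (-κ * (y - b) ^ 2) =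
      Real.exp (-κ * (a - b) ^ 2 / 2) * Real.exp (-(2 * κ) * (y - (a + b) / 2) ^ 2) := by
  rw [← Real.exp_add, ← Real.exp_add]
  congr 1
  ring

lemma integrable_exp_two_centers {κ : ℝ} (hκ : 0 < κ) (a b : ℝ) :
    Integrable fun y : ℝ => Real.exp (-κ * (y - a) ^ 2) * Real.exp (-κ * (y - b) ^ 2) := by
  simp only [exp_two_centers]
  exact ((integrable_exp_neg_mul_sq (b := 2 * κ) (by positivity)).comp_sub_right _).const_mul _

lemma integral_exp_two_centers (κ a b : ℝ) :
    ∫ y : ℝ, Real.exp (-κ * (y - a) ^ 2) * Real.exp (-κ * (y - b) ^ 2) =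
      Real.exp (-κ * (a - b) ^ 2 / 2) * √(Real.pi / (2 * κ)) := by
  simp only [exp_two_centers]
  rw [integral_const_mul, integral_sub_right_eq_self (fun y => Real.exp (-(2 * κ) * y ^ 2)),
    integral_gaussian]

lemma mul_le_of_sqrt_dominated {κ C A B : ℝ} (hπ : ∀ g, 0 < π g) (hσ : ∀ g, 0 < σ g)
    (h : ∀ (g : ι) (ν : ι → ℝ) (y : ℝ),
      √(comp π σ ν g y) * (1 + (y - ν g) ^ 2) ^ 2 ≤ C * Real.exp (-κ * (y - ν g) ^ 2))
    (hA : 0 ≤ A) (hB : 0 ≤ B) (ν : ι → ℝ) (g g' : ι) (y : ℝ) {a b : ℝ}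
    (ha : |a| ≤ A * (1 + (y - ν g) ^ 2) ^ 2) (hb : |b| ≤ B * (1 + (y - ν g') ^ 2) ^ 2) :
    |resp π σ ν g y * a * (resp π σ ν g' y * b) * mix π σ ν y| ≤
      A * B * C ^ 2 *
        (Real.exp (-κ * (y - ν g) ^ 2) * Real.exp (-κ * (y - ν g') ^ 2)) := by
  have h0 : 0 ≤ mix π σ ν y := (comp_pos hπ hσ ν g y).le.trans (comp_le_mix hπ hσ ν g y)
  have h1 : |resp π σ ν g y * a * (resp π σ ν g' y * b) * mix π σ ν y| =
      (resp π σ ν g y * resp π σ ν g' y * mix π σ ν y) * (|a| * |b|) := by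
    rw [abs_mul, abs_mul, abs_mul, abs_mul, abs_of_nonneg (resp_nonneg hπ hσ ν g y),
      abs_of_nonneg (resp_nonneg hπ hσ ν g' y), abs_of_nonneg h0]
    ring
  rw [h1]
  calc _ ≤ (√(comp π σ ν g y) * √(comp π σ ν g' y)) *
        ((A * (1 + (y - ν g) ^ 2) ^ 2) * (B * (1 + (y - ν g') ^ 2) ^ 2)) := by
        refine mul_le_mul (resp_mul_resp_mul_mix_le hπ hσ ν g g' y)
          (mul_le_mul ha hb (abs_nonneg _) (by positivity)) (by positivity) (by positivity)
    _ = A * B * ((√(comp π σ ν g y) * (1 + (y - ν g) ^ 2) ^ 2) *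
        (√(comp π σ ν g' y) * (1 + (y - ν g') ^ 2) ^ 2)) := by ring
    _ ≤ A * B * ((C * Real.exp (-κ * (y - ν g) ^ 2)) * (C * Real.exp (-κ * (y - ν g') ^ 2))) := by
        have h2 := h g ν y
        have h3 := h g' ν y
        have h4 : 0 ≤ √(comp π σ ν g y) * (1 + (y - ν g) ^ 2) ^ 2 := by positivity
        gcongr
        exact h4.trans h2
    _ = _ := by ring

lemma integrable_respMoment (hπ : ∀ g, 0 < π g) (hσ : ∀ g, 0 < σ g) {A B : ℝ} (hA : 0 ≤ A)
    (hB : 0 ≤ B) {q q' : ℝ → ℝ} (hq : ∀ t, |q t| ≤ A * (1 + t ^ 2) ^ 2)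
    (hq' : ∀ t, |q' t| ≤ B * (1 + t ^ 2) ^ 2) (hqc : Continuous q) (hqc' : Continuous q')
    (ν : ι → ℝ) (g h : ι) :
    Integrable fun y =>
      resp π σ ν g y * q (y - ν g) * (resp π σ ν h y * q' (y - ν h)) * mix π σ ν y := by
  have : Nonempty ι := ⟨g⟩
  obtain ⟨κ, hκ, C, hC, hb⟩ := sqrt_comp_mul_le_uniform hπ hσ
  refine Integrable.mono' ((integrable_exp_two_centers hκ (ν g) (ν h)).const_mul (A * B * C ^ 2))
    (Continuous.aestronglyMeasurable ?_) (ae_of_all _ fun y => ?_)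
  · have h1 := continuous_resp hπ hσ ν g
    have h2 := continuous_resp hπ hσ ν h
    have h3 := continuous_mix (π := π) hσ ν
    fun_prop
  · exact mul_le_of_sqrt_dominated hπ hσ hb hA hB ν g h y (hq _) (hq' _)

variable {α : Type*} {l : Filter α} {ν : α → ι → ℝ}

lemma tendsto_respMoment_of_ne (hπ : ∀ g, 0 < π g) (hσ : ∀ g, 0 < σ g) {A B : ℝ} (hA : 0 ≤ A)
    (hB : 0 ≤ B) {q q' : ℝ → ℝ} (hq : ∀ t, |q t| ≤ A * (1 + t ^ 2) ^ 2)
    (hq' : ∀ t, |q' t| ≤ B * (1 + t ^ 2) ^ 2) {g h : ι}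
    (hsep : Tendsto (fun x => |ν x g - ν x h|) l atTop) :
    Tendsto (fun x => respMoment π σ (ν x) q q' g h) l (𝓝 0) := by
  have : Nonempty ι := ⟨g⟩
  obtain ⟨κ, hκ, C, hC, hb⟩ := sqrt_comp_mul_le_uniform hπ hσ
  have hlim : Tendsto (fun x => A * B * C ^ 2 *
      (Real.exp (-κ * (ν x g - ν x h) ^ 2 / 2) * √(Real.pi / (2 * κ)))) l (𝓝 0) := by
    have h1 : Tendsto (fun x => -κ * (ν x g - ν x h) ^ 2 / 2) l atBot := by
      have h2 : Tendsto (fun x => (κ / 2) * |ν x g - ν x h| ^ 2) l atTop :=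
        ((tendsto_pow_atTop two_ne_zero).comp hsep).const_mul_atTop (by positivity)
      refine (tendsto_neg_atTop_atBot.comp h2).congr fun x => ?_
      simp only [Function.comp, sq_abs]
      ring
    have := ((Real.tendsto_exp_atBot.comp h1).mul_const √(Real.pi / (2 * κ))).const_mul
      (A * B * C ^ 2)
    simpa using this
  refine squeeze_zero_norm (fun x => ?_) hlim
  rw [respMoment, ← integral_exp_two_centers, ← integral_const_mul]
  refine norm_integral_le_of_norm_le
    ((integrable_exp_two_centers hκ _ _).const_mul _) (ae_of_all _ fun y => ?_)
  exact mul_le_of_sqrt_dominated hπ hσ hb hA hB (ν x) g h y (hq _) (hq' _)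

lemma abs_mul_le_one_add_sq_sq {A B : ℝ} (hA : 0 ≤ A) {q q' : ℝ → ℝ}
    (hq : ∀ t, |q t| ≤ A * (1 + t ^ 2)) (hq' : ∀ t, |q' t| ≤ B * (1 + t ^ 2)) (t : ℝ) :
    |q t * q' t| ≤ (A * B) * (1 + t ^ 2) ^ 2 := by
  rw [abs_mul]
  refine (mul_le_mul (hq t) (hq' t) (abs_nonneg _) (by positivity)).trans (le_of_eq (by ring))

lemma abs_le_one_add_sq_sq {A : ℝ} (hA : 0 ≤ A) {q : ℝ → ℝ}
    (hq : ∀ t, |q t| ≤ A * (1 + t ^ 2)) (t : ℝ) : |q t| ≤ A * (1 + t ^ 2) ^ 2 := by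
  refine (hq t).trans (mul_le_mul_of_nonneg_left ?_ hA)
  nlinarith [sq_nonneg t]

/-- Because the posterior weights sum to one, the diagonal moment is the full integral over
component g minus the cross moments of q q' with 1, and these vanish by separation. The bounds on q
and q' are quadratic so that their product still fits the quartic domination. -/
lemma tendsto_respMoment_self [DecidableEq ι] (hπ : ∀ g, 0 < π g) (hσ : ∀ g, 0 < σ g) {A B : ℝ}
    (hA : 0 ≤ A) (hB : 0 ≤ B) {q q' : ℝ → ℝ} (hq : ∀ t, |q t| ≤ A * (1 + t ^ 2))
    (hq' : ∀ t, |q' t| ≤ B * (1 + t ^ 2)) (hqc : Continuous q) (hqc' : Continuous q') {g : ι}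
    (hsep : ∀ h, h ≠ g → Tendsto (fun x => |ν x g - ν x h|) l atTop) :
    Tendsto (fun x => respMoment π σ (ν x) q q' g g) l
      (𝓝 (π g * ∫ t, gaussianPDFReal 0 (σ g ^ 2).toNNReal t * (q t * q' t))) := by
  have : Nonempty ι := ⟨g⟩
  have hqq := abs_mul_le_one_add_sq_sq hA hq hq'
  have hone : ∀ t : ℝ, |(fun _ : ℝ => (1 : ℝ)) t| ≤ 1 * (1 + t ^ 2) ^ 2 := fun t => by
    rw [abs_one]; nlinarith [sq_nonneg t, sq_nonneg (t ^ 2)]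
  have hint : ∀ x h, Integrable fun y => resp π σ (ν x) g y * (q (y - ν x g) * q' (y - ν x g)) *
      (resp π σ (ν x) h y * 1) * mix π σ (ν x) y := fun x h =>
    integrable_respMoment (q := fun t => q t * q' t) (q' := fun _ => 1) hπ hσ
      (mul_nonneg hA hB) zero_le_one hqq hone (by fun_prop) continuous_const (ν x) g h
  have key : ∀ x, respMoment π σ (ν x) q q' g g =
      π g * (∫ t, gaussianPDFReal 0 (σ g ^ 2).toNNReal t * (q t * q' t)) -
        ∑ h ∈ Finset.univ.erase g, respMoment π σ (ν x) (fun t => q t * q' t) (fun _ => 1) g h := by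
    intro x
    rw [eq_sub_iff_add_eq, ← integral_comp_mul (ν x) (fun t => q t * q' t) g]
    have e1 : respMoment π σ (ν x) q q' g g =
        respMoment π σ (ν x) (fun t => q t * q' t) (fun _ => 1) g g := by
      unfold respMoment
      congr 1
      ext y
      ring
    rw [e1, Finset.add_sum_erase _ (fun h => respMoment π σ (ν x) (fun t => q t * q' t)
      (fun _ => 1) g h) (Finset.mem_univ g)]
    unfold respMoment
    rw [← integral_finsetSum _ fun h _ => hint x h]
    congr 1
    ext y
    rw [← Finset.sum_mul, ← Finset.mul_sum]
    simp only [mul_one]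
    rw [sum_resp hπ hσ, mul_one, ← resp_mul_mix hπ hσ (ν x) g y]
    ring
  simp only [key]
  have h0 : Tendsto (fun x => ∑ h ∈ Finset.univ.erase g,
      respMoment π σ (ν x) (fun t => q t * q' t) (fun _ => 1) g h) l (𝓝 0) := by
    rw [← Finset.sum_const_zero (s := Finset.univ.erase g)]
    exact tendsto_finsetSum _ fun h hh => tendsto_respMoment_of_ne hπ hσ (mul_nonneg hA hB)
      zero_le_one hqq hone (hsep h (Finset.ne_of_mem_erase hh))
  simpa using h0.const_sub (π g * ∫ t, gaussianPDFReal 0 (σ g ^ 2).toNNReal t * (q t * q' t))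

end Mixture

/-! ### Moments of the centred normal density -/

section Moments

lemma integrable_gaussianPDFReal_mul {v : NNReal} (hv : v ≠ 0) {f : ℝ → ℝ} {A : ℝ} (hA : 0 ≤ A)
    (hf : ∀ t, |f t| ≤ A * (1 + t ^ 2) ^ 2) (hfc : Continuous f) :
    Integrable fun t => gaussianPDFReal 0 v t * f t := by
  have hv' : 0 < (v : ℝ) := NNReal.coe_pos.2 (pos_iff_ne_zero.2 hv)
  obtain ⟨C, hC, hCt⟩ := one_add_sq_sq_le_exp (a := 1 / (4 * v)) (by positivity)
  refine Integrable.mono' ((integrable_exp_neg_mul_sq (b := 1 / (4 * v)) (by positivity)).const_mul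
    ((√(2 * Real.pi * v))⁻¹ * (A * C))) (Continuous.aestronglyMeasurable ?_)
    (ae_of_all _ fun t => ?_)
  · unfold gaussianPDFReal
    fun_prop
  · rw [Real.norm_eq_abs, abs_mul, abs_of_nonneg (gaussianPDFReal_nonneg _ _ _), gaussianPDFReal,
      mul_assoc (√_)⁻¹, mul_assoc (√_)⁻¹]
    refine mul_le_mul_of_nonneg_left ?_ (inv_nonneg.2 (Real.sqrt_nonneg _))
    calc Real.exp (-(t - 0) ^ 2 / (2 * v)) * |f t|
        ≤ Real.exp (-(t - 0) ^ 2 / (2 * v)) * (A * (C * Real.exp (1 / (4 * v) * t ^ 2))) := by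
          have := hf t
          have := hCt t
          gcongr
          exact (hf t).trans (by gcongr)
      _ = (A * C) * (Real.exp (-(t - 0) ^ 2 / (2 * v)) * Real.exp (1 / (4 * v) * t ^ 2)) := by ring
      _ = A * C * Real.exp (-(1 / (4 * v)) * t ^ 2) := by
          rw [← Real.exp_add]
          congr 2
          field_simp
          ring

lemma integral_gaussianPDFReal_mul_odd (v : NNReal) {f : ℝ → ℝ} (hf : ∀ t, f (-t) = -f t) :
    ∫ t, gaussianPDFReal 0 v t * f t = 0 := by
  have h := integral_neg_eq_self (fun t => gaussianPDFReal 0 v t * f t) volume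
  have h2 : ∀ t, gaussianPDFReal 0 v (-t) * f (-t) = -(gaussianPDFReal 0 v t * f t) := by
    intro t
    rw [hf, gaussianPDFReal, gaussianPDFReal]
    simp
  simp only [h2, integral_neg] at h
  linarith

lemma integral_gaussianPDFReal_mul_sq {v : NNReal} (hv : v ≠ 0) :
    ∫ t, gaussianPDFReal 0 v t * t ^ 2 = v := by
  have h := variance_fun_id_gaussianReal (μ := 0) (v := v)
  rw [variance_eq_integral (by fun_prop), integral_id_gaussianReal] at h
  rw [integral_gaussianReal_eq_integral_smul hv] at h
  simpa using h

end Moments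

/-! ### Score and Fisher information of the regression mixture -/

section Score

variable {m p : ℕ} {β : Fin (m + 1) → Coef p → ℝ} {σ π : Fin (m + 1) → ℝ}

/-- Means of the clusters at regressor `x`. -/
noncomputable def clusterMean (β : Fin (m + 1) → Coef p → ℝ) (x : Coef p → ℝ) :
    Fin (m + 1) → ℝ := fun g => ∑ c, x c * β g c

/-- The polynomial in the residual of cluster `g` that appears in a coordinate of the score. -/
def scorePoly (σ : Fin (m + 1) → ℝ) : ParamIdx m p → Fin (m + 1) → ℝ → ℝ
  | Sum.inl _, _, t => t
  | Sum.inr (Sum.inl _), g, t => t ^ 2 - σ g ^ 2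
  | Sum.inr (Sum.inr _), _, _ => 1

/-- The coefficient of `scorePoly` in a coordinate of the score. -/
noncomputable def scoreCoef (σ π : Fin (m + 1) → ℝ) (x : Coef p → ℝ) :
    ParamIdx m p → Fin (m + 1) → ℝ
  | Sum.inl (h, c), g => if g = h then x c / σ g ^ 2 else 0
  | Sum.inr (Sum.inl h), g => if g = h then 1 / (2 * σ g ^ 4) else 0
  | Sum.inr (Sum.inr h), g =>
      (if g = h.castSucc then 1 / π g else 0) - if g = Fin.last m then 1 / π g else 0

lemma mixWeight_param (hπ_sum : ∑ g, π g = 1) (g : Fin (m + 1)) :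
    mixWeight (param β σ π) g = π g := by
  rw [Fin.sum_univ_castSucc] at hπ_sum
  refine Fin.lastCases ?_ (fun h => ?_) g
  · simp only [mixWeight, param, Sum.elim_inr, Fin.snoc_last]
    linarith
  · simp [mixWeight, param]

lemma mixDensity_param (hπ_sum : ∑ g, π g = 1) (x : Coef p → ℝ) :
    mixDensity (param β σ π) x = mix π σ (clusterMean β x) := by
  ext y
  simp only [mixDensity, mix, comp, mixWeight_param hπ_sum]
  rfl

lemma mixWeight_update_inl (θ : ParamIdx m p → ℝ) (a : Fin (m + 1) × Coef p) (t : ℝ) :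
    mixWeight (Function.update θ (Sum.inl a) t) = mixWeight θ := by
  simp [mixWeight]

lemma mixWeight_update_inr_inl (θ : ParamIdx m p → ℝ) (a : Fin (m + 1)) (t : ℝ) :
    mixWeight (Function.update θ (Sum.inr (Sum.inl a)) t) = mixWeight θ := by
  simp [mixWeight]

lemma hasDerivAt_mixWeight (θ : ParamIdx m p → ℝ) (h : Fin m) (g : Fin (m + 1)) (t : ℝ) :
    HasDerivAt (fun t => mixWeight (Function.update θ (Sum.inr (Sum.inr h)) t) g)
      ((if g = h.castSucc then 1 else 0) - if g = Fin.last m then 1 else 0) t := by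
  have hu : ∀ h' : Fin m, HasDerivAt
      (fun t => Function.update θ (Sum.inr (Sum.inr h)) t (Sum.inr (Sum.inr h')))
      (if h' = h then 1 else 0) t := by
    intro h'
    by_cases hh : h' = h
    · subst hh
      simpa using hasDerivAt_id' t
    · have : (Sum.inr (Sum.inr h') : ParamIdx m p) ≠ Sum.inr (Sum.inr h) := by simpa using hh
      simpa [Function.update_of_ne this, hh] using hasDerivAt_const t _
  refine Fin.lastCases ?_ (fun h' => ?_) g
  · have := (HasDerivAt.fun_sum (u := Finset.univ) fun h' _ => hu h').const_sub 1
    simp only [mixWeight, Fin.snoc_last]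
    refine this.congr_deriv ?_
    have hne : Fin.last m ≠ h.castSucc := (Fin.castSucc_lt_last h).ne'
    simp [hne]
  · simp only [mixWeight, Fin.snoc_castSucc]
    refine (hu h').congr_deriv ?_
    have hne : h'.castSucc ≠ Fin.last m := (Fin.castSucc_lt_last h').ne
    simp [hne]

lemma hasDerivAt_gaussianPDFReal_mean (μ : ℝ) {v : NNReal} (hv : v ≠ 0) (y : ℝ) :
    HasDerivAt (fun μ => gaussianPDFReal μ v y)
      (gaussianPDFReal μ v y * ((y - μ) / v)) μ := by
  have hv' : (v : ℝ) ≠ 0 := by simpa using hv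
  unfold gaussianPDFReal
  have h1 : HasDerivAt (fun μ : ℝ => -(y - μ) ^ 2 / (2 * v)) ((y - μ) / v) μ := by
    have := ((((hasDerivAt_id μ).const_sub y).pow 2).neg).div_const (2 * (v : ℝ))
    refine this.congr_deriv ?_
    simp
    field_simp
  refine (h1.exp.const_mul _).congr_deriv ?_
  ring

lemma hasDerivAt_gaussianPDFReal_var (μ : ℝ) {v : ℝ} (hv : 0 < v) (y : ℝ) :
    HasDerivAt (fun v => gaussianPDFReal μ v.toNNReal y)
      (gaussianPDFReal μ v.toNNReal y * (((y - μ) ^ 2 - v) / (2 * v ^ 2))) v := by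
  have h1 : HasDerivAt (fun v : ℝ => (√(2 * Real.pi * v))⁻¹ * Real.exp (-(y - μ) ^ 2 / (2 * v)))
      ((√(2 * Real.pi * v))⁻¹ * Real.exp (-(y - μ) ^ 2 / (2 * v)) *
        (((y - μ) ^ 2 - v) / (2 * v ^ 2))) v := by
    have hpos : 0 < 2 * Real.pi * v := by positivity
    have hs := (((hasDerivAt_id v).const_mul (2 * Real.pi)).sqrt hpos.ne').inv
      (Real.sqrt_pos.2 hpos).ne'
    have he := ((((hasDerivAt_id v).const_mul 2).inv (by simpa using hv.ne')).const_mul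
      (-(y - μ) ^ 2)).exp
    have h := hs.mul he
    simp only [id, mul_one, Pi.inv_apply] at h
    refine (h.congr_of_eventuallyEq (Eventually.of_forall fun w => ?_)).congr_deriv ?_
    · simp [div_eq_mul_inv]
    · have e1 : √(2 * Real.pi * v) ^ 2 = 2 * Real.pi * v := Real.sq_sqrt hpos.le
      have e2 : -(y - μ) ^ 2 / (2 * v) = -(y - μ) ^ 2 * (2 * v)⁻¹ := div_eq_mul_inv _ _
      rw [e2, e1]
      have e3 := (Real.sqrt_pos.2 hpos).ne'
      field_simp
      ring
  refine (h1.congr_of_eventuallyEq ?_).congr_deriv ?_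
  · filter_upwards [lt_mem_nhds hv] with w hw
    rw [gaussianPDFReal, Real.coe_toNNReal _ hw.le]
  · rw [gaussianPDFReal, Real.coe_toNNReal _ hv.le]

lemma hasDerivAt_mixDensity (hσ : ∀ g, 0 < σ g) (hπ : ∀ g, 0 < π g) (hπ_sum : ∑ g, π g = 1)
    (x : Coef p → ℝ) (y : ℝ) (a : ParamIdx m p) :
    HasDerivAt (fun t => mixDensity (Function.update (param β σ π) a t) x y)
      (∑ g, scoreCoef σ π x a g *
        (comp π σ (clusterMean β x) g y * scorePoly σ a g (y - clusterMean β x g)))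
      (param β σ π a) := by
  unfold mixDensity
  refine HasDerivAt.fun_sum fun g _ => ?_
  have hv : (σ g ^ 2).toNNReal ≠ 0 := by simpa using (hσ g).ne'
  have hσg := hσ g
  rcases a with ⟨h, c⟩ | h | h
  · simp only [mixWeight_update_inl, mixWeight_param hπ_sum, scoreCoef, scorePoly]
    have hvar : ∀ t, Function.update (param β σ π) (Sum.inl (h, c)) t (Sum.inr (Sum.inl g)) =
        σ g ^ 2 := fun t => by simp [param]
    simp only [hvar]
    by_cases hg : g = h
    · subst hg
      have hmean : HasDerivAt (fun t => ∑ c', x c' *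
          Function.update (param β σ π) (Sum.inl (g, c)) t (Sum.inl (g, c')))
          (x c) (param β σ π (Sum.inl (g, c))) := by
        have h1 : ∀ c' ∈ Finset.univ, HasDerivAt (fun t => x c' *
            Function.update (param β σ π) (Sum.inl (g, c)) t (Sum.inl (g, c')))
            (x c' * if c' = c then 1 else 0) (param β σ π (Sum.inl (g, c))) := by
          intro c' _
          refine HasDerivAt.const_mul _ ?_
          by_cases hc : c' = c
          · subst hc
            simpa using hasDerivAt_id' _
          · have : (Sum.inl (g, c') : ParamIdx m p) ≠ Sum.inl (g, c) := by simpa using hc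
            simpa [Function.update_of_ne this, hc] using hasDerivAt_const _ _
        refine (HasDerivAt.fun_sum h1).congr_deriv ?_
        simp
      have hpdf := hasDerivAt_gaussianPDFReal_mean (clusterMean β x g) hv y
      have hval : ∑ c', x c' * Function.update (param β σ π) (Sum.inl (g, c))
          (param β σ π (Sum.inl (g, c))) (Sum.inl (g, c')) = clusterMean β x g := by
        simp [Function.update_eq_self, param, clusterMean]
      refine ((HasDerivAt.comp_of_eq _ hpdf hmean hval.symm).const_mul (π g)).congr_deriv ?_
      rw [Real.coe_toNNReal _ (by positivity), if_pos rfl, comp]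
      field_simp
    · have hmean : ∀ t, ∑ c', x c' *
          Function.update (param β σ π) (Sum.inl (h, c)) t (Sum.inl (g, c')) =
          clusterMean β x g := by
        intro t
        refine Finset.sum_congr rfl fun c' _ => ?_
        have : (Sum.inl (g, c') : ParamIdx m p) ≠ Sum.inl (h, c) := by
          simp [hg]
        rw [Function.update_of_ne this]
        simp [param]
      simp only [hmean, if_neg hg, zero_mul]
      exact hasDerivAt_const _ _
  · simp only [mixWeight_update_inr_inl, mixWeight_param hπ_sum, scoreCoef, scorePoly]
    have hmean : ∀ t, ∑ c', x c' *
        Function.update (param β σ π) (Sum.inr (Sum.inl h)) t (Sum.inl (g, c')) =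
        clusterMean β x g := fun t => by simp [param, clusterMean]
    simp only [hmean]
    by_cases hg : g = h
    · subst hg
      have hval : param β σ π (Sum.inr (Sum.inl g)) = σ g ^ 2 := by simp [param]
      simp only [Function.update_self, hval]
      refine ((hasDerivAt_gaussianPDFReal_var (clusterMean β x g) (v := σ g ^ 2) (by positivity)
        y).const_mul (π g)).congr_deriv ?_
      rw [if_pos trivial, comp]
      field_simp
    · have hvar : ∀ t, Function.update (param β σ π) (Sum.inr (Sum.inl h)) t
          (Sum.inr (Sum.inl g)) = σ g ^ 2 := fun t => by
        have : (Sum.inr (Sum.inl g) : ParamIdx m p) ≠ Sum.inr (Sum.inl h) := by simpa using hg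
        rw [Function.update_of_ne this]
        simp [param]
      simp only [hvar, if_neg hg, zero_mul]
      exact hasDerivAt_const _ _
  · have hmean : ∀ t, ∑ c', x c' *
        Function.update (param β σ π) (Sum.inr (Sum.inr h)) t (Sum.inl (g, c')) =
        clusterMean β x g := fun t => by simp [param, clusterMean]
    have hvar : ∀ t, Function.update (param β σ π) (Sum.inr (Sum.inr h)) t
        (Sum.inr (Sum.inl g)) = σ g ^ 2 := fun t => by simp [param]
    simp only [hmean, hvar, scoreCoef, scorePoly]
    refine ((hasDerivAt_mixWeight (param β σ π) h g _).mul_const _).congr_deriv ?_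
    have := (hπ g).ne'
    rw [comp]
    split_ifs <;> field_simp <;> ring

/-- The score of the mixture is the posterior mean of the score with known label. This makes every
entry of the information a finite combination of the moments studied for mixtures. -/
lemma score_param (hσ : ∀ g, 0 < σ g) (hπ : ∀ g, 0 < π g) (hπ_sum : ∑ g, π g = 1)
    (x : Coef p → ℝ) (y : ℝ) (a : ParamIdx m p) :
    score (param β σ π) x y a = ∑ g, scoreCoef σ π x a g *
      (resp π σ (clusterMean β x) g y * scorePoly σ a g (y - clusterMean β x g)) := by
  have h := hasDerivAt_mixDensity (β := β) hσ hπ hπ_sum x y a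
  have hm := mix_pos hπ hσ (clusterMean β x) y
  have hval : mixDensity (Function.update (param β σ π) a (param β σ π a)) x y =
      mix π σ (clusterMean β x) y := by
    rw [Function.update_eq_self, mixDensity_param hπ_sum]
  rw [score, (h.log (by rw [hval]; exact hm.ne')).deriv, hval, Finset.sum_div]
  refine Finset.sum_congr rfl fun g _ => ?_
  rw [resp]
  ring

lemma abs_scorePoly_le (σ : Fin (m + 1) → ℝ) (a : ParamIdx m p) (g : Fin (m + 1)) (t : ℝ) :
    |scorePoly σ a g t| ≤ (1 + σ g ^ 2) * (1 + t ^ 2) := by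
  have h1 : 0 ≤ σ g ^ 2 * t ^ 2 := by positivity
  have h2 := sq_nonneg (σ g)
  have h3 := sq_nonneg t
  rcases a with ⟨h, c⟩ | h | h <;> simp only [scorePoly]
  · rw [abs_le]
    constructor <;> nlinarith [sq_nonneg (t - 1), sq_nonneg (t + 1)]
  · rw [abs_le]
    constructor <;> nlinarith
  · rw [abs_one]
    nlinarith

lemma continuous_scorePoly (σ : Fin (m + 1) → ℝ) (a : ParamIdx m p) (g : Fin (m + 1)) :
    Continuous (scorePoly σ a g) := by
  rcases a with ⟨h, c⟩ | h | h
  · exact continuous_id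
  · exact (continuous_pow 2).sub continuous_const
  · exact continuous_const

lemma integrable_score_mul (hσ : ∀ g, 0 < σ g) (hπ : ∀ g, 0 < π g) (ν : Fin (m + 1) → ℝ)
    (a b : ParamIdx m p) (g h : Fin (m + 1)) :
    Integrable fun y => resp π σ ν g y * scorePoly σ a g (y - ν g) *
      (resp π σ ν h y * scorePoly σ b h (y - ν h)) * mix π σ ν y :=
  integrable_respMoment hπ hσ (A := 1 + σ g ^ 2) (B := 1 + σ h ^ 2) (by positivity) (by positivity)
    (abs_le_one_add_sq_sq (by positivity) (abs_scorePoly_le σ a g))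
    (abs_le_one_add_sq_sq (by positivity) (abs_scorePoly_le σ b h))
    (continuous_scorePoly σ a g) (continuous_scorePoly σ b h) ν g h

lemma score_mul_score_mul_mixDensity (hσ : ∀ g, 0 < σ g) (hπ : ∀ g, 0 < π g)
    (hπ_sum : ∑ g, π g = 1) (x : Coef p → ℝ) (y : ℝ) (a b : ParamIdx m p) :
    score (param β σ π) x y a * score (param β σ π) x y b * mixDensity (param β σ π) x y =
      ∑ g, ∑ h, scoreCoef σ π x a g * scoreCoef σ π x b h *
        (resp π σ (clusterMean β x) g y * scorePoly σ a g (y - clusterMean β x g) *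
        (resp π σ (clusterMean β x) h y * scorePoly σ b h (y - clusterMean β x h)) *
          mix π σ (clusterMean β x) y) := by
  rw [score_param hσ hπ hπ_sum, score_param hσ hπ hπ_sum, mixDensity_param hπ_sum,
    Finset.sum_mul_sum, Finset.sum_mul]
  refine Finset.sum_congr rfl fun g _ => ?_
  rw [Finset.sum_mul]
  refine Finset.sum_congr rfl fun h _ => ?_
  ring

lemma integrable_score_mul_score (hσ : ∀ g, 0 < σ g) (hπ : ∀ g, 0 < π g)
    (hπ_sum : ∑ g, π g = 1) (x : Coef p → ℝ) (a b : ParamIdx m p) :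
    Integrable fun y => score (param β σ π) x y a * score (param β σ π) x y b *
      mixDensity (param β σ π) x y := by
  simp only [score_mul_score_mul_mixDensity hσ hπ hπ_sum]
  exact integrable_finsetSum _ fun g _ => integrable_finsetSum _ fun h _ =>
    (integrable_score_mul hσ hπ _ a b g h).const_mul _

lemma fisherInfo_param (hσ : ∀ g, 0 < σ g) (hπ : ∀ g, 0 < π g) (hπ_sum : ∑ g, π g = 1)
    (x : Coef p → ℝ) (a b : ParamIdx m p) :
    fisherInfo (param β σ π) x a b = ∑ g, ∑ h, scoreCoef σ π x a g * scoreCoef σ π x b h *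
      respMoment π σ (clusterMean β x) (scorePoly σ a g) (scorePoly σ b h) g h := by
  simp only [fisherInfo, Matrix.of_apply, score_mul_score_mul_mixDensity hσ hπ hπ_sum]
  rw [integral_finsetSum _ fun g _ => integrable_finsetSum _ fun h _ =>
    (integrable_score_mul hσ hπ _ a b g h).const_mul _]
  refine Finset.sum_congr rfl fun g _ => ?_
  rw [integral_finsetSum _ fun h _ => (integrable_score_mul hσ hπ _ a b g h).const_mul _]
  refine Finset.sum_congr rfl fun h _ => ?_
  rw [integral_const_mul]
  rfl

lemma fisherInfo_symm (θ : ParamIdx m p → ℝ) (x : Coef p → ℝ) (a b : ParamIdx m p) :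
    fisherInfo θ x a b = fisherInfo θ x b a := by
  simp only [fisherInfo, Matrix.of_apply, mul_comm (score θ x _ a)]

/-- The quadratic form at v is the second moment of the combination of scores with coefficients v;
integrability of the score products permits exchanging sum and integral. -/
lemma fisherInfo_posSemidef (hσ : ∀ g, 0 < σ g) (hπ : ∀ g, 0 < π g) (hπ_sum : ∑ g, π g = 1)
    (x : Coef p → ℝ) : (fisherInfo (param β σ π) x).PosSemidef := by
  refine Matrix.PosSemidef.of_dotProduct_mulVec_nonneg ?_ fun v => ?_
  · refine Matrix.IsHermitian.ext fun a b => ?_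
    rw [star_trivial]
    exact fisherInfo_symm _ _ _ _
  · have h : star v ⬝ᵥ (fisherInfo (param β σ π) x).mulVec v =
        ∫ y, (∑ a, v a * score (param β σ π) x y a) ^ 2 * mixDensity (param β σ π) x y := by
      have h1 : ∀ y, (∑ a, v a * score (param β σ π) x y a) ^ 2 * mixDensity (param β σ π) x y =
          ∑ a, ∑ b, v a * v b * (score (param β σ π) x y a * score (param β σ π) x y b *
            mixDensity (param β σ π) x y) := by
        intro y
        rw [pow_two, Finset.sum_mul_sum, Finset.sum_mul]
        refine Finset.sum_congr rfl fun a _ => ?_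
        rw [Finset.sum_mul]
        refine Finset.sum_congr rfl fun b _ => ?_
        ring
      simp only [h1]
      rw [integral_finsetSum _ fun a _ => integrable_finsetSum _ fun b _ =>
        (integrable_score_mul_score hσ hπ hπ_sum x a b).const_mul _]
      simp only [dotProduct, Matrix.mulVec, star_trivial, Finset.mul_sum]
      refine Finset.sum_congr rfl fun a _ => ?_
      rw [integral_finsetSum _ fun b _ =>
        (integrable_score_mul_score hσ hπ hπ_sum x a b).const_mul _]
      refine Finset.sum_congr rfl fun b _ => ?_
      rw [integral_const_mul, fisherInfo, Matrix.of_apply]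
      ring
    rw [h]
    refine integral_nonneg fun y => mul_nonneg (sq_nonneg _) ?_
    rw [mixDensity_param hπ_sum]
    exact (mix_pos hπ hσ _ y).le

/-- The right side is the information with an observed label. With posterior weight w_g ≤ 1 one has
w_g² f ≤ w_g f = f_g, so the squared score is dominated by that of weighted least squares. -/
lemma fisherInfo_coef_self_le (hσ : ∀ g, 0 < σ g) (hπ : ∀ g, 0 < π g) (hπ_sum : ∑ g, π g = 1)
    (x : Coef p → ℝ) (g : Fin (m + 1)) (c : Coef p) :
    fisherInfo (param β σ π) x (Sum.inl (g, c)) (Sum.inl (g, c)) ≤ π g / σ g ^ 2 * x c ^ 2 := by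
  have hσg := hσ g
  have hv : (σ g ^ 2).toNNReal ≠ 0 := by simpa using hσg.ne'
  have h1 : fisherInfo (param β σ π) x (Sum.inl (g, c)) (Sum.inl (g, c)) =
      (x c / σ g ^ 2) ^ 2 * respMoment π σ (clusterMean β x) id id g g := by
    rw [fisherInfo_param hσ hπ hπ_sum, Finset.sum_eq_single g (fun h _ hh => by
      simp [scoreCoef, hh]) (by simp), Finset.sum_eq_single g (fun h _ hh => by
      simp [scoreCoef, hh]) (by simp)]
    simp only [scoreCoef, if_true, pow_two]
    rfl
  have h2 : respMoment π σ (clusterMean β x) id id g g ≤ π g * σ g ^ 2 := by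
    have h3 := integral_comp_mul (π := π) (σ := σ) (clusterMean β x) (fun t => t ^ 2) g
    rw [integral_gaussianPDFReal_mul_sq hv, Real.coe_toNNReal _ (by positivity)] at h3
    rw [← h3]
    have hint : Integrable fun y => comp π σ (clusterMean β x) g y *
        (y - clusterMean β x g) ^ 2 := by
      have h4 := integrable_gaussianPDFReal_mul hv (A := 1) zero_le_one (f := fun t => t ^ 2)
        (fun t => by rw [abs_of_nonneg (sq_nonneg t)]; nlinarith [sq_nonneg t, sq_nonneg (t ^ 2)])
        (by fun_prop)
      have h5 := (h4.comp_sub_right (clusterMean β x g)).const_mul (π g)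
      refine h5.congr (ae_of_all _ fun y => ?_)
      simp only [comp]
      rw [gaussianPDFReal_sub, zero_add, mul_assoc]
    refine integral_mono (integrable_score_mul hσ hπ (clusterMean β x) (Sum.inl (g, c))
      (Sum.inl (g, c)) g g) hint fun y => ?_
    have h6 := resp_le_one hπ hσ (clusterMean β x) g y
    have h7 := resp_mul_mix hπ hσ (clusterMean β x) g y
    have h8 := comp_pos hπ hσ (clusterMean β x) g y
    calc _ = resp π σ (clusterMean β x) g y * (resp π σ (clusterMean β x) g y *
          mix π σ (clusterMean β x) y) * (y - clusterMean β x g) ^ 2 := by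
          change resp π σ (clusterMean β x) g y * (y - clusterMean β x g) *
            (resp π σ (clusterMean β x) g y * (y - clusterMean β x g)) *
              mix π σ (clusterMean β x) y = _
          ring
      _ ≤ 1 * comp π σ (clusterMean β x) g y * (y - clusterMean β x g) ^ 2 := by
          rw [h7]; gcongr
      _ = _ := by rw [one_mul]
  rw [h1]
  refine (mul_le_mul_of_nonneg_left h2 (sq_nonneg _)).trans (le_of_eq ?_)
  field_simp

end Score

/-! ### The information limit for separated clusters -/

section InfoLimit

variable {m p : ℕ} {β : Fin (m + 1) → Coef p → ℝ} {σ π : Fin (m + 1) → ℝ}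

/-- Limit of the information matrix of one observation with well separated clusters. -/
noncomputable def sepInfo (σ π : Fin (m + 1) → ℝ) (x : Coef p → ℝ) :
    Matrix (ParamIdx m p) (ParamIdx m p) ℝ :=
  Matrix.of fun a b => ∑ g, scoreCoef σ π x a g * scoreCoef σ π x b g *
    (π g * ∫ t, gaussianPDFReal 0 (σ g ^ 2).toNNReal t * (scorePoly σ a g t * scorePoly σ b g t))

/-- Rescaling of the parameter: `a` for the coefficients, `1` for the other parameters. -/
noncomputable def paramScale (a : Coef p → ℝ) : ParamIdx m p → ℝ :=
  Sum.elim (fun gc => a gc.2) (fun _ => 1)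

lemma scoreCoef_scale (σ π : Fin (m + 1) → ℝ) (x a : Coef p → ℝ) (i : ParamIdx m p)
    (g : Fin (m + 1)) :
    paramScale a i * scoreCoef σ π x i g = scoreCoef σ π (fun c => a c * x c) i g := by
  rcases i with ⟨h, c⟩ | h | h <;> simp only [paramScale, scoreCoef, Sum.elim_inl, Sum.elim_inr,
    one_mul]
  split_ifs
  · ring
  · ring

variable {α : Type*} {l : Filter α}

lemma tendsto_scoreCoef {x : α → Coef p → ℝ} {x₀ : Coef p → ℝ}
    (hx : ∀ c, Tendsto (fun q => x q c) l (𝓝 (x₀ c))) (i : ParamIdx m p) (g : Fin (m + 1)) :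
    Tendsto (fun q => scoreCoef σ π (x q) i g) l (𝓝 (scoreCoef σ π x₀ i g)) := by
  rcases i with ⟨h, c⟩ | h | h <;> simp only [scoreCoef]
  · split_ifs
    · exact (hx c).div_const _
    · exact tendsto_const_nhds
  · exact tendsto_const_nhds
  · exact tendsto_const_nhds

/-- The scale is absorbed into the regressor in the score coefficients only; the moments keep the
unscaled cluster means, which have to separate. In the limit only the terms with equal clusters
survive. -/
lemma tendsto_scaled_fisherInfo (hσ : ∀ g, 0 < σ g) (hπ : ∀ g, 0 < π g) (hπ_sum : ∑ g, π g = 1)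
    {x a : α → Coef p → ℝ} {x₀ : Coef p → ℝ}
    (hx : ∀ c, Tendsto (fun q => a q c * x q c) l (𝓝 (x₀ c)))
    (hsep : ∀ g h, g ≠ h → Tendsto (fun q => |clusterMean β (x q) g - clusterMean β (x q) h|)
      l atTop) (i j : ParamIdx m p) :
    Tendsto (fun q => paramScale (a q) i * fisherInfo (param β σ π) (x q) i j *
      paramScale (a q) j) l (𝓝 (sepInfo σ π x₀ i j)) := by
  have h1 : ∀ q, paramScale (a q) i * fisherInfo (param β σ π) (x q) i j * paramScale (a q) j =
      ∑ g, ∑ h, scoreCoef σ π (fun c => a q c * x q c) i g *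
        scoreCoef σ π (fun c => a q c * x q c) j h *
        respMoment π σ (clusterMean β (x q)) (scorePoly σ i g) (scorePoly σ j h) g h := by
    intro q
    rw [fisherInfo_param hσ hπ hπ_sum, Finset.mul_sum, Finset.sum_mul]
    refine Finset.sum_congr rfl fun g _ => ?_
    rw [Finset.mul_sum, Finset.sum_mul]
    refine Finset.sum_congr rfl fun h _ => ?_
    rw [← scoreCoef_scale, ← scoreCoef_scale]
    ring
  simp only [h1, sepInfo, Matrix.of_apply]
  refine tendsto_finsetSum _ fun g _ => ?_
  have h2 : scoreCoef σ π x₀ i g * scoreCoef σ π x₀ j g * (π g *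
      ∫ t, gaussianPDFReal 0 (σ g ^ 2).toNNReal t * (scorePoly σ i g t * scorePoly σ j g t)) =
      ∑ h, scoreCoef σ π x₀ i g * scoreCoef σ π x₀ j h * (if h = g then π g *
      ∫ t, gaussianPDFReal 0 (σ g ^ 2).toNNReal t * (scorePoly σ i g t * scorePoly σ j g t)
      else 0) := by
    simp
  rw [h2]
  refine tendsto_finsetSum _ fun h _ => ?_
  refine ((tendsto_scoreCoef hx i g).mul (tendsto_scoreCoef hx j h)).mul ?_
  by_cases hg : h = g
  · subst hg
    rw [if_pos rfl]
    exact tendsto_respMoment_self hπ hσ (A := 1 + σ h ^ 2) (B := 1 + σ h ^ 2) (by positivity)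
      (by positivity) (abs_scorePoly_le σ i h) (abs_scorePoly_le σ j h)
      (continuous_scorePoly σ i h) (continuous_scorePoly σ j h) fun g hg => hsep h g hg.symm
  · rw [if_neg hg]
    exact tendsto_respMoment_of_ne hπ hσ (A := 1 + σ g ^ 2) (B := 1 + σ h ^ 2) (by positivity)
      (by positivity) (abs_le_one_add_sq_sq (by positivity) (abs_scorePoly_le σ i g))
      (abs_le_one_add_sq_sq (by positivity) (abs_scorePoly_le σ j h)) (hsep g h (Ne.symm hg))

/-- The information about the coefficients in the separated limit. -/
lemma sepInfo_coef_coef (hσ : ∀ g, 0 < σ g) (x : Coef p → ℝ)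
    (g h : Fin (m + 1)) (c d : Coef p) :
    sepInfo σ π x (Sum.inl (g, c)) (Sum.inl (h, d)) =
      if g = h then π g / σ g ^ 2 * (x c * x d) else 0 := by
  have hσg := hσ g
  have hv : (σ g ^ 2).toNNReal ≠ 0 := by simpa using hσg.ne'
  rw [sepInfo, Matrix.of_apply, Finset.sum_eq_single g (fun k _ hk => by simp [scoreCoef, hk])
    (by simp)]
  simp only [scoreCoef, scorePoly, ← pow_two, integral_gaussianPDFReal_mul_sq hv, if_true]
  rw [Real.coe_toNNReal _ (by positivity)]
  split_ifs
  · field_simp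
  · ring

/-- The residual is odd while the other score polynomials are even, so their product integrates to
zero against the centred normal density. -/
lemma sepInfo_coef_other (x : Coef p → ℝ) (gc : Fin (m + 1) × Coef p)
    (b : Fin (m + 1) ⊕ Fin m) : sepInfo σ π x (Sum.inl gc) (Sum.inr b) = 0 := by
  rw [sepInfo, Matrix.of_apply]
  refine Finset.sum_eq_zero fun g _ => ?_
  rw [integral_gaussianPDFReal_mul_odd, mul_zero, mul_zero]
  intro t
  rcases b with b | b <;> simp [scorePoly]

lemma sepInfo_symm (x : Coef p → ℝ) (a b : ParamIdx m p) :
    sepInfo σ π x a b = sepInfo σ π x b a := by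
  simp only [sepInfo, Matrix.of_apply, mul_comm (scoreCoef σ π x a _), mul_comm (scorePoly σ a _ _)]

/-- `Var((t² - v))` for a centred normal variable `t` with variance `v`. -/
noncomputable def sqVar (v : NNReal) : ℝ := ∫ t, gaussianPDFReal 0 v t * (t ^ 2 - v) ^ 2

lemma sqVar_pos {v : NNReal} (hv : v ≠ 0) : 0 < sqVar v := by
  have hc : Continuous fun t : ℝ => gaussianPDFReal 0 v t * (t ^ 2 - v) ^ 2 := by
    unfold gaussianPDFReal
    have : (v : ℝ) ≠ 0 := by simpa using hv
    fun_prop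
  have hv0 : 0 < (v : ℝ) := NNReal.coe_pos.2 (pos_iff_ne_zero.2 hv)
  refine integral_pos_of_integrable_nonneg_nonzero (x := √(v + 1)) hc
    (integrable_gaussianPDFReal_mul hv (A := (1 + v) ^ 2) (by positivity) (fun t => ?_)
      (by fun_prop)) (fun t => mul_nonneg (gaussianPDFReal_nonneg _ _ _) (sq_nonneg _)) ?_
  · rw [abs_of_nonneg (sq_nonneg _), ← mul_pow, sq_le_sq]
    rw [abs_of_nonneg (a := (1 + (v : ℝ)) * (1 + t ^ 2)) (by positivity), abs_le]
    have : 0 ≤ (v : ℝ) * t ^ 2 := by positivity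
    constructor <;> nlinarith [sq_nonneg t]
  · rw [Real.sq_sqrt (by positivity)]
    simpa using (gaussianPDFReal_pos 0 v _ hv).ne'

lemma sepInfo_var_var (x : Coef p → ℝ) (g h : Fin (m + 1)) :
    sepInfo σ π x (Sum.inr (Sum.inl g)) (Sum.inr (Sum.inl h)) =
      if g = h then (1 / (2 * σ g ^ 4)) ^ 2 * (π g * sqVar (σ g ^ 2).toNNReal) else 0 := by
  rw [sepInfo, Matrix.of_apply, Finset.sum_eq_single g (fun k _ hk => by simp [scoreCoef, hk])
    (by simp)]
  simp only [scoreCoef, scorePoly, ← pow_two, if_true, sqVar]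
  rw [Real.coe_toNNReal _ (sq_nonneg _)]
  split_ifs
  · ring
  · ring

lemma sepInfo_var_weight (hσ : ∀ g, 0 < σ g) (x : Coef p → ℝ) (g : Fin (m + 1)) (h : Fin m) :
    sepInfo σ π x (Sum.inr (Sum.inl g)) (Sum.inr (Sum.inr h)) = 0 := by
  rw [sepInfo, Matrix.of_apply]
  refine Finset.sum_eq_zero fun k _ => ?_
  have hv : (σ k ^ 2).toNNReal ≠ 0 := by simpa using (hσ k).ne'
  have h1 : ∫ t, gaussianPDFReal 0 (σ k ^ 2).toNNReal t * ((t ^ 2 - σ k ^ 2) * 1) = 0 := by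
    have h2 : ∀ t, gaussianPDFReal 0 (σ k ^ 2).toNNReal t * ((t ^ 2 - σ k ^ 2) * 1) =
        gaussianPDFReal 0 (σ k ^ 2).toNNReal t * t ^ 2 -
          gaussianPDFReal 0 (σ k ^ 2).toNNReal t * σ k ^ 2 := fun t => by ring
    simp only [h2]
    rw [integral_sub, integral_gaussianPDFReal_mul_sq hv, integral_mul_const,
      integral_gaussianPDFReal_eq_one 0 hv, Real.coe_toNNReal _ (sq_nonneg _)]
    · ring
    · exact integrable_gaussianPDFReal_mul hv (A := 1) zero_le_one (f := fun t => t ^ 2)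
        (fun t => by rw [abs_of_nonneg (sq_nonneg t)]; nlinarith [sq_nonneg t, sq_nonneg (t ^ 2)])
        (by fun_prop)
    · exact (integrable_gaussianPDFReal _ _).mul_const _
  simp only [scorePoly, h1, mul_zero]

lemma sepInfo_weight_weight (hσ : ∀ g, 0 < σ g) (hπ : ∀ g, 0 < π g) (x : Coef p → ℝ)
    (h h' : Fin m) :
    sepInfo σ π x (Sum.inr (Sum.inr h)) (Sum.inr (Sum.inr h')) =
      (if h = h' then 1 / π h.castSucc else 0) + 1 / π (Fin.last m) := by
  have hv : ∀ k, (σ k ^ 2).toNNReal ≠ 0 := fun k => by simpa using (hσ k).ne'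
  have hne : ∀ i : Fin m, i.castSucc ≠ Fin.last m := fun i => (Fin.castSucc_lt_last i).ne
  rw [sepInfo, Matrix.of_apply]
  simp only [scorePoly, mul_one, integral_gaussianPDFReal_eq_one 0 (hv _)]
  rw [Fin.sum_univ_castSucc]
  simp only [scoreCoef, hne, (hne _).symm, if_false, if_true, sub_zero, zero_sub, Fin.castSucc_inj]
  have h2 := (hπ (Fin.last m)).ne'
  congr 1
  · rw [Finset.sum_eq_single h (fun k _ hk => by simp [hk]) (by simp)]
    have h1 := (hπ h.castSucc).ne'
    rw [if_pos rfl]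
    split_ifs
    · field_simp
    · ring
  · field_simp

/-- The right inverse of the limiting information matrix. -/
noncomputable def sepInfoInv (σ π : Fin (m + 1) → ℝ) (n : ℝ) (Y : Matrix (Coef p) (Coef p) ℝ) :
    Matrix (ParamIdx m p) (ParamIdx m p) ℝ :=
  Matrix.fromBlocks
    (Matrix.of fun gc hd => if gc.1 = hd.1 then σ gc.1 ^ 2 / π gc.1 * Y gc.2 hd.2 else 0) 0 0
    (Matrix.fromBlocks (Matrix.diagonal fun g =>
        (n * ((1 / (2 * σ g ^ 4)) ^ 2 * (π g * sqVar (σ g ^ 2).toNNReal)))⁻¹) 0 0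
      (Matrix.of fun h h' => n⁻¹ * ((if h = h' then π h.castSucc else 0) -
        π h.castSucc * π h'.castSucc)))

/-- Each diagonal block is inverted separately. The weight block is the multinomial information
diag(1/π_h) + 1/π_G with the last category eliminated, whose inverse is the multinomial covariance
diag(π) - ππᵀ. Here n is the total number of points, r in each of the groups. -/
lemma sum_sepInfo_mul_sepInfoInv (hσ : ∀ g, 0 < σ g) (hπ : ∀ g, 0 < π g)
    (hπ_sum : ∑ g, π g = 1) {κ : Type*} [Fintype κ] {r : ℝ} (x₀ : κ → Coef p → ℝ)
    {X Y : Matrix (Coef p) (Coef p) ℝ} (hX : ∀ c d, X c d = ∑ k, r * (x₀ k c * x₀ k d))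
    (hXY : X * Y = 1) (hn : r * Fintype.card κ ≠ 0) :
    (Matrix.of fun a b => ∑ k, r * sepInfo σ π (x₀ k) a b) *
      sepInfoInv σ π (r * Fintype.card κ) Y = (1 : Matrix (ParamIdx m p) (ParamIdx m p) ℝ) := by
  set n := r * Fintype.card κ with hn_def
  have hconst : ∀ t : ℝ, ∑ _k : κ, r * t = n * t := fun t => by
    rw [Finset.sum_const, Finset.card_univ, nsmul_eq_mul, hn_def]; ring
  have hL : (Matrix.of fun a b => ∑ k, r * sepInfo σ π (x₀ k) a b :
      Matrix (ParamIdx m p) (ParamIdx m p) ℝ) = Matrix.fromBlocks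
      (Matrix.of fun gc hd => if gc.1 = hd.1 then π gc.1 / σ gc.1 ^ 2 * X gc.2 hd.2 else 0) 0 0
      (Matrix.fromBlocks (Matrix.diagonal fun g =>
        n * ((1 / (2 * σ g ^ 4)) ^ 2 * (π g * sqVar (σ g ^ 2).toNNReal))) 0 0
      (Matrix.of fun h h' => n * ((if h = h' then 1 / π h.castSucc else 0) +
        1 / π (Fin.last m)))) := by
    ext a b
    rw [Matrix.of_apply]
    rcases a with ⟨g, c⟩ | a
    · rcases b with ⟨h, d⟩ | b
      · simp only [sepInfo_coef_coef hσ, Matrix.fromBlocks_apply₁₁, Matrix.of_apply, hX]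
        split_ifs
        · rw [Finset.mul_sum]
          exact Finset.sum_congr rfl fun k _ => by ring
        · simp
      · simp only [sepInfo_coef_other, Matrix.fromBlocks_apply₁₂]
        simp
    · rcases b with hd | b
      · simp only [sepInfo_symm _ (Sum.inr a), sepInfo_coef_other, Matrix.fromBlocks_apply₂₁]
        simp
      · rw [Matrix.fromBlocks_apply₂₂]
        rcases a with g | h <;> rcases b with g' | h'
        · simp only [sepInfo_var_var, Matrix.fromBlocks_apply₁₁, hconst, Matrix.diagonal_apply]
          split_ifs <;> simp
        · simp only [sepInfo_var_weight hσ, Matrix.fromBlocks_apply₁₂]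
          simp
        · simp only [sepInfo_symm _ (Sum.inr (Sum.inr h)), sepInfo_var_weight hσ,
            Matrix.fromBlocks_apply₂₁]
          simp
        · simp only [sepInfo_weight_weight hσ hπ, Matrix.fromBlocks_apply₂₂, hconst,
            Matrix.of_apply]
  rw [hL, sepInfoInv, Matrix.fromBlocks_multiply, Matrix.fromBlocks_multiply]
  simp only [Matrix.mul_zero, Matrix.zero_mul, add_zero, zero_add]
  have h1 : (Matrix.of fun gc hd : Fin (m + 1) × Coef p =>
      if gc.1 = hd.1 then π gc.1 / σ gc.1 ^ 2 * X gc.2 hd.2 else 0) *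
      (Matrix.of fun gc hd => if gc.1 = hd.1 then σ gc.1 ^ 2 / π gc.1 * Y gc.2 hd.2 else 0) =
      1 := by
    ext ⟨g, c⟩ ⟨h, d⟩
    have h2 := congrFun (congrFun hXY c) d
    rw [Matrix.mul_apply] at h2
    rw [Matrix.mul_apply, Fintype.sum_prod_type, Finset.sum_eq_single g (fun k _ hk => by
      simp [Ne.symm hk]) (by simp)]
    have h3 := (hσ g).ne'
    have h4 := (hπ g).ne'
    by_cases hg : g = h
    · subst hg
      have h5 : ∀ e, π g / σ g ^ 2 * X c e * (σ g ^ 2 / π g * Y e d) = X c e * Y e d := by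
        intro e; field_simp
      simp only [Matrix.of_apply, if_true, h5, h2, Matrix.one_apply, Prod.mk.injEq, true_and]
    · simp [Matrix.of_apply, hg]
  have h2 : (Matrix.diagonal fun g =>
        n * ((1 / (2 * σ g ^ 4)) ^ 2 * (π g * sqVar (σ g ^ 2).toNNReal))) *
      (Matrix.diagonal fun g : Fin (m + 1) =>
        (n * ((1 / (2 * σ g ^ 4)) ^ 2 * (π g * sqVar (σ g ^ 2).toNNReal)))⁻¹) = 1 := by
    rw [Matrix.diagonal_mul_diagonal, ← Matrix.diagonal_one]
    congr 1
    ext g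
    have h3 := hσ g
    have h4 := hπ g
    have h5 := sqVar_pos (v := (σ g ^ 2).toNNReal) (by simpa using h3.ne')
    refine mul_inv_cancel₀ (mul_ne_zero hn (by positivity))
  have h3 : (Matrix.of fun h h' : Fin m => n * ((if h = h' then 1 / π h.castSucc else 0) +
        1 / π (Fin.last m))) *
      (Matrix.of fun h h' : Fin m => n⁻¹ * ((if h = h' then π h.castSucc else 0) -
        π h.castSucc * π h'.castSucc)) = 1 := by
    ext h h'
    have hlast : ∑ i : Fin m, π i.castSucc = 1 - π (Fin.last m) := by
      rw [Fin.sum_univ_castSucc] at hπ_sum; linarith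
    have h4 := (hπ (Fin.last m)).ne'
    have h5 := (hπ h.castSucc).ne'
    rw [Matrix.mul_apply]
    simp only [Matrix.of_apply]
    have h6 : ∀ i : Fin m, n * ((if h = i then 1 / π h.castSucc else 0) + 1 / π (Fin.last m)) *
        (n⁻¹ * ((if i = h' then π i.castSucc else 0) - π i.castSucc * π h'.castSucc)) =
        (if h = i then 1 / π h.castSucc * ((if i = h' then π i.castSucc else 0) -
          π i.castSucc * π h'.castSucc) else 0) +
        (1 / π (Fin.last m) * (if i = h' then π i.castSucc else 0) -
          1 / π (Fin.last m) * π h'.castSucc * π i.castSucc) := by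
      intro i
      rw [mul_mul_mul_comm, mul_inv_cancel₀ hn]
      split_ifs <;> ring
    simp only [h6, Finset.sum_add_distrib, Finset.sum_sub_distrib, ← Finset.mul_sum, hlast,
      Finset.sum_ite_eq, Finset.sum_ite_eq', Finset.mem_univ, if_true, Matrix.one_apply]
    split_ifs with hh
    · subst hh
      field_simp
      ring
    · field_simp
      ring
  rw [h1, h2, h3]
  simp [Matrix.fromBlocks_one]

end InfoLimit

/-! ### From limits of the information to limits and bounds of the variance -/

section VarLimit

variable {m p : ℕ} {β : Fin (m + 1) → Coef p → ℝ} {σ π : Fin (m + 1) → ℝ}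

lemma inv_diagonal_of_ne_zero {n : Type*} [Fintype n] [DecidableEq n] {d : n → ℝ}
    (hd : ∀ i, d i ≠ 0) : (Matrix.diagonal d)⁻¹ = Matrix.diagonal fun i => (d i)⁻¹ := by
  refine Matrix.inv_eq_right_inv ?_
  rw [Matrix.diagonal_mul_diagonal, ← Matrix.diagonal_one]
  congr 1
  ext i
  exact mul_inv_cancel₀ (hd i)

lemma isUnit_det_of_scaled {n : Type*} [Fintype n] [DecidableEq n] {d : n → ℝ}
    {M : Matrix n n ℝ} (h : IsUnit (Matrix.diagonal d * M * Matrix.diagonal d).det) :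
    IsUnit M.det := by
  rw [Matrix.det_mul, Matrix.det_mul] at h
  exact isUnit_of_mul_isUnit_right (isUnit_of_mul_isUnit_left h)

/-- Scaling the variance by A means scaling the information by A⁻¹ on both sides. The limit can thus
be taken before the inversion, where it is nonsingular. -/
lemma scaled_varBeta (θ : ParamIdx m p → ℝ) (z : ℕ → EuclideanSpace ℝ (Fin p)) (δ : Finset ℕ)
    (g : Fin (m + 1)) {a : Coef p → ℝ} (ha : ∀ c, a c ≠ 0) (c d : Coef p) :
    (Matrix.diagonal a * varBeta θ z δ g * (Matrix.diagonal a).transpose) c d =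
      (Matrix.diagonal (paramScale (m := m) fun c => (a c)⁻¹) * subdataInfo θ z δ *
        Matrix.diagonal (paramScale (m := m) fun c => (a c)⁻¹))⁻¹ (Sum.inl (g, c))
        (Sum.inl (g, d)) := by
  have hd : ∀ i : ParamIdx m p, paramScale (fun c => (a c)⁻¹) i ≠ 0 := by
    rintro (⟨h, c⟩ | i)
    · exact inv_ne_zero (ha c)
    · exact one_ne_zero
  rw [Matrix.mul_inv_rev, Matrix.mul_inv_rev, inv_diagonal_of_ne_zero hd, ← mul_assoc,
    Matrix.diagonal_transpose, Matrix.mul_diagonal, Matrix.diagonal_mul, Matrix.mul_diagonal,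
    Matrix.diagonal_mul]
  simp [varBeta, paramScale]

variable {α : Type*} {l : Filter α}

/-- Convergence of the inverse information of subdata that consist of groups of points along which
the rescaled regressors converge and the clusters separate. -/
lemma tendsto_scaled_inverse (hσ : ∀ g, 0 < σ g) (hπ : ∀ g, 0 < π g) (hπ_sum : ∑ g, π g = 1)
    {κ : Type*} [Fintype κ] {r : ℕ} {z : α → ℕ → EuclideanSpace ℝ (Fin p)}
    {δ : α → Finset ℕ} {sel : κ → α → Finset ℕ} {a : α → Coef p → ℝ} {x₀ : κ → Coef p → ℝ}
    {X Y : Matrix (Coef p) (Coef p) ℝ}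
    (hdec : ∀ᶠ q in l, ∀ F : ℕ → ℝ, ∑ i ∈ δ q, F i = ∑ k, ∑ i ∈ sel k q, F i)
    (hcard : ∀ k, ∀ᶠ q in l, (sel k q).card = r)
    (hx : ∀ k c, Tendsto (fun w : α × ℕ => (a w.1 c)⁻¹ * regressor (z w.1 w.2) c)
      (onSel l (sel k)) (𝓝 (x₀ k c)))
    (hsep : ∀ k g h, g ≠ h → Tendsto (fun w : α × ℕ =>
      |clusterMean β (regressor (z w.1 w.2)) g - clusterMean β (regressor (z w.1 w.2)) h|)
      (onSel l (sel k)) atTop)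
    (hX : ∀ c d, X c d = ∑ k, r * (x₀ k c * x₀ k d)) (hXY : X * Y = 1)
    (hn : (r : ℝ) * Fintype.card κ ≠ 0) :
    (∀ᶠ q in l, IsUnit (Matrix.diagonal (paramScale fun c => (a q c)⁻¹) *
        subdataInfo (param β σ π) (z q) (δ q) *
        Matrix.diagonal (paramScale fun c => (a q c)⁻¹)).det) ∧
    Tendsto (fun q => (Matrix.diagonal (paramScale fun c => (a q c)⁻¹) *
        subdataInfo (param β σ π) (z q) (δ q) *
        Matrix.diagonal (paramScale fun c => (a q c)⁻¹))⁻¹) l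
      (𝓝 (sepInfoInv σ π (r * Fintype.card κ) Y)) := by
  set L : Matrix (ParamIdx m p) (ParamIdx m p) ℝ :=
    Matrix.of fun i j => ∑ k, (r : ℝ) * sepInfo σ π (x₀ k) i j with hL
  have hinv : L * sepInfoInv σ π (r * Fintype.card κ) Y = 1 :=
    sum_sepInfo_mul_sepInfoInv hσ hπ hπ_sum x₀ hX hXY hn
  have hlim : Tendsto (fun q => Matrix.diagonal (paramScale fun c => (a q c)⁻¹) *
        subdataInfo (param β σ π) (z q) (δ q) *
        Matrix.diagonal (paramScale fun c => (a q c)⁻¹)) l (𝓝 L) := by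
    refine tendsto_pi_nhds.2 fun i => tendsto_pi_nhds.2 fun j => ?_
    have h1 : Tendsto (fun q => ∑ k, ∑ i' ∈ sel k q, paramScale (fun c => (a q c)⁻¹) i *
        fisherInfo (param β σ π) (regressor (z q i')) i j * paramScale (fun c => (a q c)⁻¹) j) l
        (𝓝 (L i j)) := by
      rw [hL, Matrix.of_apply]
      exact tendsto_finsetSum _ fun k _ => tendsto_sum_onSel
        (F := fun w => paramScale (fun c => (a w.1 c)⁻¹) i *
          fisherInfo (param β σ π) (regressor (z w.1 w.2)) i j *
          paramScale (fun c => (a w.1 c)⁻¹) j)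
        (tendsto_scaled_fisherInfo hσ hπ hπ_sum (hx k) (hsep k) i j) (hcard k)
    refine h1.congr' ?_
    filter_upwards [hdec] with q hq
    rw [← hq, Matrix.mul_diagonal, Matrix.diagonal_mul, subdataInfo, Matrix.sum_apply,
      Finset.mul_sum, Finset.sum_mul]
  have hunit : IsUnit L.det := by
    have := congrArg Matrix.det hinv
    rw [Matrix.det_mul, Matrix.det_one] at this
    exact IsUnit.of_mul_eq_one _ this
  constructor
  · have h1 : Tendsto (fun q => (Matrix.diagonal (paramScale fun c => (a q c)⁻¹) *
        subdataInfo (param β σ π) (z q) (δ q) *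
        Matrix.diagonal (paramScale fun c => (a q c)⁻¹)).det) l (𝓝 L.det) :=
      (continuous_id.matrix_det.tendsto L).comp hlim
    filter_upwards [h1.eventually_ne hunit.ne_zero] with q hq using isUnit_iff_ne_zero.2 hq
  -- Matrix inversion is continuous at the nonsingular limit L, which the explicit right inverse
  -- supplies.
  · rw [← Matrix.inv_eq_right_inv hinv]
    refine Tendsto.comp (continuousAt_matrix_inv L ?_) hlim
    rw [Ring.inverse_eq_inv']
    exact continuousAt_inv₀ hunit.ne_zero

variable {Ω : Type*} [MeasurableSpace Ω] {P : Measure Ω}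

lemma tendsto_scaled_varBeta (hσ : ∀ g, 0 < σ g) (hπ : ∀ g, 0 < π g) (hπ_sum : ∑ g, π g = 1)
    {κ : Type*} [Fintype κ] {r : ℕ} {z : ℕ → Ω → EuclideanSpace ℝ (Fin p)}
    {δ : ℕ → Ω → Finset ℕ} {sel : κ → ℕ × Ω → Finset ℕ} {a : ℕ → Fin p → ℝ}
    {x₀ : κ → Fin p → ℝ} {X Y : Matrix (Coef p) (Coef p) ℝ}
    (ha : ∀ᶠ N in atTop, ∀ j, a N j ≠ 0)
    (hdec : ∀ᶠ q in whp P, ∀ F : ℕ → ℝ, ∑ i ∈ δ q.1 q.2, F i = ∑ k, ∑ i ∈ sel k q, F i)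
    (hcard : ∀ k, ∀ᶠ q in whp P, (sel k q).card = r)
    (hx : ∀ k j, Tendsto (fun w : (ℕ × Ω) × ℕ => (a w.1.1 j)⁻¹ * z w.2 w.1.2 j)
      (onSel (whp P) (sel k)) (𝓝 (x₀ k j)))
    (hsep : ∀ k g h, g ≠ h → Tendsto (fun w : (ℕ × Ω) × ℕ =>
      |clusterMean β (regressor (z w.2 w.1.2)) g - clusterMean β (regressor (z w.2 w.1.2)) h|)
      (onSel (whp P) (sel k)) atTop)
    (hX : ∀ c d, X c d = ∑ k, r * (Sum.elim (fun _ => 1) (x₀ k) c *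
      Sum.elim (fun _ => 1) (x₀ k) d)) (hXY : X * Y = 1)
    (hn : (r : ℝ) * Fintype.card κ ≠ 0) (g : Fin (m + 1)) :
    (∀ᶠ q in whp P,
      IsUnit (subdataInfo (param β σ π) (fun i => z i q.2) (δ q.1 q.2)).det) ∧
    ∀ c d, Tendsto (fun q : ℕ × Ω => (scaling (a q.1) *
        varBeta (param β σ π) (fun i => z i q.2) (δ q.1 q.2) g *
        (scaling (a q.1)).transpose) c d) (whp P) (𝓝 (σ g ^ 2 / π g * Y c d)) := by
  obtain ⟨h1, h2⟩ := tendsto_scaled_inverse (β := β) hσ hπ hπ_sum (l := whp P) (sel := sel)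
    (z := fun q i => z i q.2) (δ := fun q => δ q.1 q.2)
    (a := fun q => Sum.elim (fun _ => 1) (a q.1))
    (x₀ := fun k => Sum.elim (fun _ => 1) (x₀ k)) hdec hcard
    (fun k c => by
      rcases c with c | j
      · simpa [regressor] using tendsto_const_nhds
      · exact hx k j) hsep hX hXY hn
  refine ⟨h1.mono fun q hq => isUnit_det_of_scaled hq, fun c d => ?_⟩
  have h3 := tendsto_pi_nhds.1 (tendsto_pi_nhds.1 h2 (Sum.inl (g, c))) (Sum.inl (g, d))
  have h4 : sepInfoInv σ π (r * Fintype.card κ) Y (Sum.inl (g, c)) (Sum.inl (g, d)) =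
      σ g ^ 2 / π g * Y c d := by
    simp [sepInfoInv]
  rw [h4] at h3
  refine h3.congr' ?_
  filter_upwards [tendsto_fst_whp.eventually ha] with q hq
  rw [scaling, scaled_varBeta]
  rintro (c | j)
  · exact one_ne_zero
  · exact hq j

lemma scaledVarTendsto_of_whp {z : ℕ → Ω → EuclideanSpace ℝ (Fin p)} {δ : ℕ → Ω → Finset ℕ}
    {θ : ParamIdx m p → ℝ} {g : Fin (m + 1)} {A : ℕ → Matrix (Coef p) (Coef p) ℝ}
    {L : Matrix (Coef p) (Coef p) ℝ}
    (h1 : ∀ᶠ q in whp P, IsUnit (subdataInfo θ (fun i => z i q.2) (δ q.1 q.2)).det)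
    (h2 : ∀ c d, Tendsto (fun q : ℕ × Ω => (A q.1 *
        varBeta θ (fun i => z i q.2) (δ q.1 q.2) g * (A q.1).transpose) c d) (whp P)
        (𝓝 (L c d))) :
    ScaledVarTendsto P θ z δ g A L :=
  ⟨(eventually_whp_iff (A := fun q => IsUnit
      (subdataInfo θ (fun i => z i q.2) (δ q.1 q.2)).det)).1 h1,
    fun c d => tendstoInMeasure_of_tendsto_whp (f := fun N ω => (A N *
      varBeta θ (fun i => z i ω) (δ N ω) g * (A N).transpose) c d) (h2 c d)⟩

lemma subdataInfo_posSemidef (hσ : ∀ g, 0 < σ g) (hπ : ∀ g, 0 < π g) (hπ_sum : ∑ g, π g = 1)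
    (z : ℕ → EuclideanSpace ℝ (Fin p)) (s : Finset ℕ) :
    (subdataInfo (param β σ π) z s).PosSemidef := by
  unfold subdataInfo
  exact Matrix.posSemidef_sum s fun i _ => fisherInfo_posSemidef hσ hπ hπ_sum _

/-- A diagonal entry of the inverse of a positive semidefinite matrix is at least the inverse of the
diagonal entry. -/
lemma inv_le_inv_apply_self {n : Type*} [Fintype n] [DecidableEq n] {M : Matrix n n ℝ}
    (hM : M.PosSemidef) (hu : IsUnit M.det) {i : n} {B : ℝ} (hB : 0 < B) (hi : M i i ≤ B) :
    B⁻¹ ≤ M⁻¹ i i := by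
  -- At v = e_i - B M⁻¹ e_i the quadratic form is M_ii - 2B + B² (M⁻¹)_ii. Its nonnegativity and
  -- M_ii ≤ B give the claim.
  have h := hM.dotProduct_mulVec_nonneg (Pi.single i 1 - B • M⁻¹.mulVec (Pi.single i 1))
  have h1 : M.mulVec (M⁻¹.mulVec (Pi.single i 1)) = Pi.single i 1 := by
    rw [Matrix.mulVec_mulVec, Matrix.mul_nonsing_inv _ hu, Matrix.one_mulVec]
  have h2 : (M⁻¹.mulVec (Pi.single i 1)) ⬝ᵥ (M.mulVec (Pi.single i 1)) = 1 := by
    rw [Matrix.dotProduct_mulVec, ← Matrix.mulVec_transpose]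
    have : M.transpose = M := by
      have := hM.1
      rwa [Matrix.IsHermitian, Matrix.conjTranspose_eq_transpose_of_trivial] at this
    rw [this, h1]
    simp
  simp only [star_trivial, Matrix.mulVec_sub, Matrix.mulVec_smul, h1, sub_dotProduct,
    dotProduct_sub, smul_dotProduct, dotProduct_smul, h2] at h
  simp [Matrix.mulVec_single] at h
  have h3 : B ≤ B * B * M⁻¹ i i := by nlinarith
  rw [inv_le_iff_one_le_mul₀ hB]
  nlinarith

/-- All other parameters are unknown too, and the bound on the inverse entry needs only the single
diagonal entry of the information for this slope. -/
lemma le_varBeta_of_sq_le (hσ : ∀ g, 0 < σ g) (hπ : ∀ g, 0 < π g) (hπ_sum : ∑ g, π g = 1)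
    (z : ℕ → EuclideanSpace ℝ (Fin p)) {s : Finset ℕ} (g : Fin (m + 1)) (j : Fin p) {B : ℝ}
    (hB : 0 < B) (hs : s.Nonempty) (hz : ∀ i ∈ s, z i j ^ 2 ≤ B)
    (hu : IsUnit (subdataInfo (param β σ π) z s).det) :
    (s.card * (π g / σ g ^ 2) * B)⁻¹ ≤
      varBeta (param β σ π) z s g (Sum.inr j) (Sum.inr j) := by
  have hc : 0 < (s.card : ℝ) := by exact_mod_cast hs.card_pos
  have h1 := hσ g
  have h2 := hπ g
  refine inv_le_inv_apply_self (subdataInfo_posSemidef hσ hπ hπ_sum z s) hu (by positivity) ?_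
  rw [subdataInfo, Matrix.sum_apply]
  calc _ ≤ ∑ i ∈ s, π g / σ g ^ 2 * B := by
        refine Finset.sum_le_sum fun i hi => ?_
        refine (fisherInfo_coef_self_le hσ hπ hπ_sum _ g (Sum.inr j)).trans ?_
        have := hz i hi
        gcongr
        exact this
    _ = _ := by rw [Finset.sum_const, nsmul_eq_mul, mul_assoc]

/-- Rate optimality from convergence of the scaled variance and a bound for the covariates. -/
lemma rateOptimal_of_whp (hσ : ∀ g, 0 < σ g) (hπ : ∀ g, 0 < π g) (hπ_sum : ∑ g, π g = 1)
    {z : ℕ → Ω → EuclideanSpace ℝ (Fin p)} {δ : ℕ → Ω → Finset ℕ} {g : Fin (m + 1)}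
    {a : ℕ → Fin p → ℝ} {L : Matrix (Coef p) (Coef p) ℝ} {k : ℕ} (hk : 0 < k) {j : Fin p}
    {rate : ℕ → ℝ} (ha : ∀ᶠ N in atTop, 0 < a N j ∧ rate N = (a N j ^ 2)⁻¹)
    (hlim : Tendsto (fun q : ℕ × Ω => (scaling (a q.1) *
        varBeta (param β σ π) (fun i => z i q.2) (δ q.1 q.2) g *
        (scaling (a q.1)).transpose) (Sum.inr j) (Sum.inr j)) (whp P)
        (𝓝 (L (Sum.inr j) (Sum.inr j))))
    {B : ℝ} (hB : 0 < B)
    (hz : ∀ᶠ q in whp P, ∀ i < q.1, z i q.2 j ^ 2 ≤ B * a q.1 j ^ 2) :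
    RateOptimal P (param β σ π) z δ k g j rate := by
  have h1 := hσ g
  have h2 := hπ g
  have ha' := tendsto_fst_whp (P := P).eventually ha
  constructor
  · refine ⟨|L (Sum.inr j) (Sum.inr j)| + 1, by positivity, ?_⟩
    have h3 : ∀ᶠ q in whp P, ¬ ((|L (Sum.inr j) (Sum.inr j)| + 1) * rate q.1 <
        varBeta (param β σ π) (fun i => z i q.2) (δ q.1 q.2) g (Sum.inr j) (Sum.inr j)) := by
      filter_upwards [hlim.eventually_lt_const (u := |L (Sum.inr j) (Sum.inr j)| + 1)
        (by linarith [le_abs_self (L (Sum.inr j) (Sum.inr j))]), ha'] with q h4 h5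
      simp only [scaling, Matrix.diagonal_transpose, Matrix.mul_diagonal, Matrix.diagonal_mul,
        Sum.elim_inr] at h4
      rw [not_lt, h5.2, ← div_eq_mul_inv, le_div_iff₀ (pow_pos h5.1 2)]
      nlinarith
    rw [eventually_whp_iff] at h3
    simpa only [not_not] using h3
  -- The bound on the covariates holds for all of the first N points on one event, so a single
  -- constant serves all subsets of size k simultaneously.
  · refine ⟨(k * (π g / σ g ^ 2) * B)⁻¹, by positivity, ?_⟩
    have h3 : ∀ᶠ q in whp P, ¬ ∃ s ⊆ Finset.range q.1, s.card = k ∧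
        IsUnit (subdataInfo (param β σ π) (fun i => z i q.2) s).det ∧
        varBeta (param β σ π) (fun i => z i q.2) s g (Sum.inr j) (Sum.inr j) <
          (k * (π g / σ g ^ 2) * B)⁻¹ * rate q.1 := by
      filter_upwards [hz, ha'] with q h4 h5
      rintro ⟨s, hs, hsk, hu, hlt⟩
      have h6 := pow_pos h5.1 2
      refine absurd hlt (not_lt.2 ?_)
      have h7 := le_varBeta_of_sq_le hσ hπ hπ_sum (fun i => z i q.2) g j
        (B := B * a q.1 j ^ 2) (by positivity) (Finset.card_pos.1 (hsk ▸ hk))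
        (fun i hi => h4 i (Finset.mem_range.1 (hs hi))) hu
      rw [h5.2, ← mul_inv, mul_assoc _ B, ← hsk]
      exact h7
    rw [eventually_whp_iff] at h3
    simpa only [not_not] using h3

end VarLimit

/-! ### Asymptotic location of the selected points -/

section Selection

variable {Ω : Type*} [MeasurableSpace Ω] {P : Measure Ω} {m p : ℕ}
  {μ : EuclideanSpace ℝ (Fin p)} {σ : Fin p → ℝ} {ρ : Matrix (Fin p) (Fin p) ℝ}
  {u : ℕ → Ω → EuclideanSpace ℝ (Fin p)}

/-- The sign of an extreme: `1` for the largest values, `-1` for the smallest. -/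
def extSign (b : Bool) : ℝ := if b then 1 else -1

lemma extSign_sq (b : Bool) : extSign b ^ 2 = 1 := by cases b <;> simp [extSign]

/-- The IBOSS subdata split into `2 p` groups of `r` points, and the standardized `j`-th coordinate
in the groups of covariate `j` is asymptotically at the extreme. -/
lemma exists_selection [IsProbabilityMeasure P] (hσ : ∀ j, 0 < σ j) (hρ : ∀ j, ρ j j = 1)
    (hcov : (covMatrix σ ρ).PosDef)
    (hu : ∀ i, HasLaw (u i) (multivariateGaussian μ (covMatrix σ ρ)) P) (hind : iIndepFun u P)
    (r : ℕ) :
    ∃ sel : Fin p × Bool → ℕ × Ω → Finset ℕ,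
      (∀ᶠ q in whp P, ∀ F : ℕ → ℝ, ∑ i ∈ iboss r q.1 (fun i => u i q.2), F i =
        ∑ k, ∑ i ∈ sel k q, F i) ∧
      (∀ k, ∀ᶠ q in whp P, (sel k q).card = r) ∧
      (∀ k, ∀ᶠ q in whp P, ∀ i ∈ sel k q, i < q.1) ∧
      (∀ k, ∀ δ > 0, ∀ᶠ q in whp P, ∀ i ∈ sel k q,
        maxRate q.1 - δ ≤ extSign k.2 * std μ σ (u i q.2) k.1) := by
  have hex : ∀ q : ℕ × Ω, ∃ R : Fin p → Finset ℕ, 2 * p * r ≤ q.1 →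
      (∀ j, R j ⊆ Finset.range q.1 ∧ q.1 ≤ (R j).card + 2 * p * r ∧ 2 * r ≤ (R j).card) ∧
      ∀ F : ℕ → ℝ, ∑ i ∈ iboss r q.1 (fun i => u i q.2), F i =
        ∑ j, (∑ i ∈ smallest (R j) (fun i => u i q.2 j) r, F i +
          ∑ i ∈ largest (R j) (fun i => u i q.2 j) r, F i) := by
    intro q
    by_cases h : 2 * p * r ≤ q.1
    · obtain ⟨R, hR⟩ := iboss_decomposition r q.1 (fun i => u i q.2) h
      exact ⟨R, fun _ => hR⟩
    -- Samples too small for a full selection receive a dummy value; they do not affect the limit.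
    · exact ⟨fun _ => ∅, fun h' => absurd h' h⟩
  choose R hR using hex
  have hN : ∀ᶠ q : ℕ × Ω in whp P, 2 * p * r ≤ q.1 :=
    tendsto_fst_whp.eventually (eventually_ge_atTop _)
  refine ⟨fun k q => if k.2 then largest (R q k.1) (fun i => u i q.2 k.1) r else
    smallest (R q k.1) (fun i => u i q.2 k.1) r, ?_, ?_, ?_, ?_⟩
  · filter_upwards [hN] with q hq F
    rw [(hR q hq).2, Fintype.sum_prod_type]
    refine Finset.sum_congr rfl fun j _ => ?_
    simp [add_comm]
  · rintro ⟨j, b⟩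
    filter_upwards [hN] with q hq
    have h1 := ((hR q hq).1 j).2.2
    cases b
    · simpa using card_smallest _ (by omega)
    · simpa using card_largest _ (by omega)
  · rintro ⟨j, b⟩
    filter_upwards [hN] with q hq i hi
    have h1 := ((hR q hq).1 j).1
    refine Finset.mem_range.1 (h1 ?_)
    cases b
    · exact smallest_subset _ _ _ (by simpa using hi)
    · exact largest_subset _ _ _ (by simpa using hi)
  · rintro ⟨j, b⟩ δ hδ
    -- At most 2pr points are missing when coordinate j is treated, so 2pr + r extreme points leave
    -- at least r to choose from.
    filter_upwards [hN, eventually_le_card_std_ge hσ hρ hcov hu hind (extSign_sq b) j hδ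
      (2 * p * r + r)] with q hq hc i hi
    obtain ⟨h1, h2, -⟩ := (hR q hq).1 j
    have hσj := hσ j
    cases b
    · have hi' : i ∈ smallest (R q j) (fun i => u i q.2 j) r := by simpa using hi
      have key : ∀ i, maxRate q.1 - δ ≤ extSign false * std μ σ (u i q.2) j ↔
          u i q.2 j ≤ μ j - σ j * (maxRate q.1 - δ) := by
        intro i
        rw [eq_add_mul_std (μ := μ) hσ (u i q.2) j, extSign]
        simp only [Bool.false_eq_true, if_false]
        constructor <;> intro h <;> nlinarith
      simp only [key] at hc ⊢
      exact ge_of_mem_smallest h1 h2 hc hi'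
    · have hi' : i ∈ largest (R q j) (fun i => u i q.2 j) r := by simpa using hi
      have key : ∀ i, maxRate q.1 - δ ≤ extSign true * std μ σ (u i q.2) j ↔
          μ j + σ j * (maxRate q.1 - δ) ≤ u i q.2 j := by
        intro i
        rw [eq_add_mul_std (μ := μ) hσ (u i q.2) j, extSign]
        simp only [if_true, one_mul]
        constructor <;> intro h <;> nlinarith
      simp only [key] at hc ⊢
      exact le_of_mem_largest h1 h2 hc hi'

variable {sel : ℕ × Ω → Finset ℕ} {b : Bool} {j : Fin p}

lemma tendsto_maxRate_onSel :
    Tendsto (fun w : (ℕ × Ω) × ℕ => maxRate w.1.1) (onSel (whp P) sel) atTop :=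
  tendsto_maxRate.comp (tendsto_fst_whp.comp tendsto_fst_onSel)

/-- The selection gives the lower bound T - δ and the sample maximum the upper bound T + δ. The
additive precision o(1), not merely o(T), is needed once coordinates are exponentiated. -/
lemma tendsto_std_sub_maxRate (hσ : ∀ j, 0 < σ j) (hρ : ∀ j, ρ j j = 1)
    (hcov : (covMatrix σ ρ).PosDef)
    (hu : ∀ i, HasLaw (u i) (multivariateGaussian μ (covMatrix σ ρ)) P)
    (hlt : ∀ᶠ q in whp P, ∀ i ∈ sel q, i < q.1)
    (hext : ∀ δ > 0, ∀ᶠ q in whp P, ∀ i ∈ sel q,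
      maxRate q.1 - δ ≤ extSign b * std μ σ (u i q.2) j) :
    Tendsto (fun w : (ℕ × Ω) × ℕ => extSign b * std μ σ (u w.2 w.1.2) j - maxRate w.1.1)
      (onSel (whp P) sel) (𝓝 0) := by
  rw [Metric.tendsto_nhds]
  intro ε hε
  rw [eventually_onSel_iff]
  filter_upwards [hlt, hext (ε / 2) (by positivity),
    eventually_std_lt hσ hρ hcov hu (extSign_sq b) j hε] with q h1 h2 h3 i hi
  have h4 := h2 i hi
  have h5 := h3 i (h1 i hi)
  rw [dist_zero_right, Real.norm_eq_abs, abs_lt]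
  constructor <;> linarith

/-- Splitting W_l into its regression on W_j and noise: the noise is o(T) at extreme points, and W_j
/ T tends to the sign of the extreme. -/
lemma tendsto_std_div_maxRate (hσ : ∀ j, 0 < σ j) (hρ : ∀ j, ρ j j = 1)
    (hcov : (covMatrix σ ρ).PosDef)
    (hu : ∀ i, HasLaw (u i) (multivariateGaussian μ (covMatrix σ ρ)) P)
    (hlt : ∀ᶠ q in whp P, ∀ i ∈ sel q, i < q.1)
    (hext : ∀ δ > 0, ∀ᶠ q in whp P, ∀ i ∈ sel q,
      maxRate q.1 - δ ≤ extSign b * std μ σ (u i q.2) j) (l : Fin p) :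
    Tendsto (fun w : (ℕ × Ω) × ℕ => std μ σ (u w.2 w.1.2) l / maxRate w.1.1)
      (onSel (whp P) sel) (𝓝 (extSign b * ρ l j)) := by
  have hT := tendsto_maxRate_onSel (P := P) (sel := sel)
  have h1 : Tendsto (fun w : (ℕ × Ω) × ℕ => (std μ σ (u w.2 w.1.2) l -
      ρ l j * std μ σ (u w.2 w.1.2) j) / maxRate w.1.1) (onSel (whp P) sel) (𝓝 0) := by
    rw [Metric.tendsto_nhds]
    intro ε hε
    have hpos := hT.eventually_gt_atTop 0
    rw [eventually_onSel_iff] at hpos ⊢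
    filter_upwards [hlt, hext 1 one_pos, hpos,
      eventually_abs_noise_lt hσ hρ hcov hu (extSign_sq b) l j 1 hε] with q h1 h2 h3 h4 i hi
    rw [dist_zero_right, norm_div, Real.norm_eq_abs, Real.norm_of_nonneg (h3 i hi).le,
      div_lt_iff₀ (h3 i hi)]
    exact h4 i (h1 i hi) (h2 i hi)
  have h2 := ((tendsto_std_sub_maxRate hσ hρ hcov hu hlt hext).div_atTop hT).add_const 1
  have h3 := h1.add (h2.const_mul (extSign b * ρ l j))
  have hlim : 0 + extSign b * ρ l j * (0 + 1) = extSign b * ρ l j := by ring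
  rw [hlim] at h3
  refine h3.congr' ?_
  filter_upwards [hT.eventually_gt_atTop 0] with w hw
  have hs := extSign_sq b
  have e1 : ∀ x : ℝ, extSign b * ρ l j * ((extSign b * x - maxRate w.1.1) / maxRate w.1.1 + 1) =
      ρ l j * x / maxRate w.1.1 := by
    intro x
    have : extSign b * ρ l j * ((extSign b * x - maxRate w.1.1) / maxRate w.1.1 + 1) =
      extSign b ^ 2 * (ρ l j * x / maxRate w.1.1) := by
      field_simp
      ring
    rw [this, hs, one_mul]
  rw [e1]
  ring

lemma clusterMean_regressor_sub (β : Fin (m + 1) → Coef p → ℝ) (z : EuclideanSpace ℝ (Fin p))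
    (g h : Fin (m + 1)) :
    clusterMean β (regressor z) g - clusterMean β (regressor z) h =
      (β g (Sum.inl ()) - β h (Sum.inl ())) +
        ∑ l, (β g (Sum.inr l) - β h (Sum.inr l)) * z l := by
  simp only [clusterMean, regressor, Fintype.sum_sum_type, Sum.elim_inl, Sum.elim_inr,
    Finset.univ_unique, Finset.sum_singleton, one_mul, sub_mul, Finset.sum_sub_distrib]
  simp only [mul_comm (z _)]
  ring_nf

end Selection

/-! ### Normal covariates -/

section Normal

variable {Ω : Type*} [MeasurableSpace Ω] {P : Measure Ω} {m p : ℕ}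
  {μ : EuclideanSpace ℝ (Fin p)} {σ : Fin p → ℝ} {ρ : Matrix (Fin p) (Fin p) ℝ}
  {u : ℕ → Ω → EuclideanSpace ℝ (Fin p)} {sel : ℕ × Ω → Finset ℕ} {b : Bool} {j : Fin p}

lemma tendsto_coord_div_maxRate (hσ : ∀ j, 0 < σ j) (hρ : ∀ j, ρ j j = 1)
    (hcov : (covMatrix σ ρ).PosDef)
    (hu : ∀ i, HasLaw (u i) (multivariateGaussian μ (covMatrix σ ρ)) P)
    (hlt : ∀ᶠ q in whp P, ∀ i ∈ sel q, i < q.1)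
    (hext : ∀ δ > 0, ∀ᶠ q in whp P, ∀ i ∈ sel q,
      maxRate q.1 - δ ≤ extSign b * std μ σ (u i q.2) j) (l : Fin p) :
    Tendsto (fun w : (ℕ × Ω) × ℕ => u w.2 w.1.2 l / maxRate w.1.1)
      (onSel (whp P) sel) (𝓝 (extSign b * (ρ l j * σ l))) := by
  have h1 := tendsto_std_div_maxRate hσ hρ hcov hu hlt hext l
  have h2 := (tendsto_maxRate_onSel (P := P) (sel := sel)).const_div_atTop (μ l)
  have h3 := h2.add (h1.const_mul (σ l))
  have e : 0 + σ l * (extSign b * ρ l j) = extSign b * (ρ l j * σ l) := by ring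
  rw [e] at h3
  refine h3.congr fun w => ?_
  conv_rhs => rw [eq_add_mul_std (μ := μ) hσ (u w.2 w.1.2) l]
  ring

lemma sqrt_log_eq (N : ℕ) : √(Real.log N) = maxRate N / √2 := by
  rw [maxRate, Real.sqrt_mul zero_le_two, mul_div_cancel_left₀ _ (by positivity)]

/-- Divided by T, the intercepts disappear and the difference of the means tends to ± the sum in the
separation condition, so the difference itself diverges. -/
lemma tendsto_abs_clusterMean_sub_normal (hσ : ∀ j, 0 < σ j) (hρ : ∀ j, ρ j j = 1)
    (hcov : (covMatrix σ ρ).PosDef)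
    (hu : ∀ i, HasLaw (u i) (multivariateGaussian μ (covMatrix σ ρ)) P)
    (hlt : ∀ᶠ q in whp P, ∀ i ∈ sel q, i < q.1)
    (hext : ∀ δ > 0, ∀ᶠ q in whp P, ∀ i ∈ sel q,
      maxRate q.1 - δ ≤ extSign b * std μ σ (u i q.2) j)
    {β : Fin (m + 1) → Coef p → ℝ} {g h : Fin (m + 1)}
    (hβ : ∑ l, ρ l j * σ l * (β g (Sum.inr l) - β h (Sum.inr l)) ≠ 0) :
    Tendsto (fun w : (ℕ × Ω) × ℕ => |clusterMean β (regressor (u w.2 w.1.2)) g -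
      clusterMean β (regressor (u w.2 w.1.2)) h|) (onSel (whp P) sel) atTop := by
  have hT := tendsto_maxRate_onSel (P := P) (sel := sel)
  have h1 := (hT.const_div_atTop (β g (Sum.inl ()) - β h (Sum.inl ()))).add
    (tendsto_finsetSum Finset.univ fun l _ =>
      (tendsto_coord_div_maxRate hσ hρ hcov hu hlt hext l).const_mul
        (β g (Sum.inr l) - β h (Sum.inr l)))
  have e : 0 + ∑ l, (β g (Sum.inr l) - β h (Sum.inr l)) * (extSign b * (ρ l j * σ l)) =
      extSign b * ∑ l, ρ l j * σ l * (β g (Sum.inr l) - β h (Sum.inr l)) := by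
    rw [zero_add, Finset.mul_sum]
    exact Finset.sum_congr rfl fun l _ => by ring
  rw [e] at h1
  have hb : extSign b ≠ 0 := by
    have := extSign_sq b
    intro h
    rw [h] at this
    norm_num at this
  have h2 := hT.atTop_mul_pos (abs_pos.2 (mul_ne_zero hb hβ)) h1.abs
  refine h2.congr' ?_
  filter_upwards [hT.eventually_gt_atTop 0] with w hw
  rw [clusterMean_regressor_sub]
  conv_lhs => rw [← abs_of_pos hw]
  rw [← abs_mul, mul_add, Finset.mul_sum, abs_of_pos hw]
  congr 2
  · field_simp
  · exact Finset.sum_congr rfl fun l _ => by field_simp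

/-- The limiting second moment matrix of the rescaled normal regressors and its inverse. -/
lemma normal_moment_mul_inv {r : ℕ} (hp : 1 ≤ p) (hr : 1 ≤ r) (hσ : ∀ j, 0 < σ j)
    (hcov : (covMatrix σ ρ).PosDef) :
    (Matrix.of fun c d : Coef p => ∑ k : Fin p × Bool, (r : ℝ) *
      ((Sum.elim (fun _ => (1 : ℝ)) (fun l => √2 * (extSign k.2 * (ρ l k.1 * σ l))) c) *
        Sum.elim (fun _ => (1 : ℝ)) (fun l => √2 * (extSign k.2 * (ρ l k.1 * σ l))) d)) *
    Matrix.fromBlocks (Matrix.of fun _ _ => 1 / (2 * p * r : ℝ)) 0 0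
      ((1 / (4 * r : ℝ)) • (Matrix.diagonal σ * ρ ^ 2 * Matrix.diagonal σ)⁻¹) = 1 := by
  have hp0 : (p : ℝ) ≠ 0 := by positivity
  have hr0 : (r : ℝ) ≠ 0 := by positivity
  have hX : (Matrix.of fun c d : Coef p => ∑ k : Fin p × Bool, (r : ℝ) *
      ((Sum.elim (fun _ => (1 : ℝ)) (fun l => √2 * (extSign k.2 * (ρ l k.1 * σ l))) c) *
        Sum.elim (fun _ => (1 : ℝ)) (fun l => √2 * (extSign k.2 * (ρ l k.1 * σ l))) d)) =
      Matrix.fromBlocks (Matrix.of fun _ _ => (2 * p * r : ℝ)) 0 0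
        ((4 * r : ℝ) • (Matrix.diagonal σ * ρ ^ 2 * Matrix.diagonal σ)) := by
    ext c d
    rw [Matrix.of_apply]
    rcases c with c | c <;> rcases d with d | d
    · simp only [Sum.elim_inl, mul_one, Finset.sum_const, Finset.card_univ, Fintype.card_prod,
        Fintype.card_fin, Fintype.card_bool, nsmul_eq_mul, Matrix.fromBlocks_apply₁₁,
        Matrix.of_apply]
      push_cast
      ring
    -- The groups of smallest and largest values enter with opposite signs, so intercept and slopes
    -- decouple.
    · simp [Fintype.sum_prod_type, extSign]
    · simp [Fintype.sum_prod_type, extSign]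
    · rw [Matrix.fromBlocks_apply₂₂, Matrix.smul_apply, Matrix.mul_diagonal, Matrix.diagonal_mul,
        pow_two ρ, Matrix.mul_apply]
      simp only [Sum.elim_inr, smul_eq_mul, Finset.mul_sum, Finset.sum_mul,
        Fintype.sum_prod_type]
      refine Finset.sum_congr rfl fun j _ => ?_
      rw [corr_symm hσ hcov j d]
      -- The factor √2 comes from T = √2 √(log N). Its square and the two signs turn r into 4r, and
      -- the sum over j forms ρ².
      have h2 : √2 * √2 = (2 : ℝ) := Real.mul_self_sqrt zero_le_two
      simp only [extSign, Fintype.sum_bool, if_true, Bool.false_eq_true, if_false]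
      linear_combination (2 * r * ρ c j * σ c * ρ d j * σ d) * h2
  have hdet : IsUnit (Matrix.diagonal σ * ρ ^ 2 * Matrix.diagonal σ).det := by
    have h := hcov.det_pos.ne'
    rw [covMatrix, Matrix.det_mul, Matrix.det_mul] at h
    rw [isUnit_iff_ne_zero, Matrix.det_mul, Matrix.det_mul, Matrix.det_pow]
    have h1 := left_ne_zero_of_mul (left_ne_zero_of_mul h)
    have h2 := right_ne_zero_of_mul (left_ne_zero_of_mul h)
    positivity
  rw [hX, Matrix.fromBlocks_multiply]
  simp only [Matrix.mul_zero, Matrix.zero_mul, add_zero, zero_add]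
  rw [Matrix.smul_mul, Matrix.mul_smul, Matrix.mul_nonsing_inv _ hdet, smul_smul,
    mul_one_div_cancel (by positivity), one_smul, ← Matrix.fromBlocks_one]
  congr 1
  ext i k
  simp [Matrix.mul_apply]
  field_simp

theorem normal_case {r : ℕ} (hp : 1 ≤ p) (hr : 1 ≤ r)
    (β : Fin (m + 1) → Coef p → ℝ) (σ π : Fin (m + 1) → ℝ)
    (hσ : ∀ g, 0 < σ g) (hπ : ∀ g, 0 < π g) (hπ_sum : ∑ g, π g = 1)
    (μz : EuclideanSpace ℝ (Fin p)) (σz : Fin p → ℝ) (hσz : ∀ j, 0 < σz j)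
    (ρ : Matrix (Fin p) (Fin p) ℝ) (hρ : ∀ j, ρ j j = 1)
    (hcov : (covMatrix σz ρ).PosDef) [IsProbabilityMeasure P]
    (z : ℕ → Ω → EuclideanSpace ℝ (Fin p)) (hz : iIndepFun z P)
    (hlaw : ∀ i, HasLaw (z i) (multivariateGaussian μz (covMatrix σz ρ)) P)
    (hsep : ∀ g g' : Fin (m + 1), g ≠ g' → ∀ j : Fin p,
      ∑ l, ρ l j * σz l * (β g (Sum.inr l) - β g' (Sum.inr l)) ≠ 0) (g : Fin (m + 1)) :
    ScaledVarTendsto P (param β σ π) z (fun N ω => iboss r N fun i => z i ω) g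
        (fun N => scaling fun _ => √(Real.log N)) (normalLimit r σz ρ (σ g) (π g)) ∧
      ∀ j : Fin p, RateOptimal P (param β σ π) z (fun N ω => iboss r N fun i => z i ω)
          (2 * p * r) g j (fun N => 1 / Real.log N) := by
  obtain ⟨sel, hdec, hcard, hlt, hext⟩ := exists_selection hσz hρ hcov hlaw hz r
  have hlogpos : ∀ᶠ N : ℕ in atTop, 0 < √(Real.log N) := by
    filter_upwards [tendsto_maxRate.eventually_gt_atTop 0] with N hN
    rw [sqrt_log_eq]
    positivity
  obtain ⟨h1, h2⟩ := tendsto_scaled_varBeta (β := β) (P := P) (z := z) (sel := sel)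
    (δ := fun N ω => iboss r N fun i => z i ω) (a := fun N _ => √(Real.log N))
    (x₀ := fun k l => √2 * (extSign k.2 * (ρ l k.1 * σz l))) hσ hπ hπ_sum
    (hlogpos.mono fun N hN _ => hN.ne') hdec hcard
    (fun k l => by
      refine ((tendsto_coord_div_maxRate hσz hρ hcov hlaw (hlt k) (hext k) l).const_mul
        √2).congr fun w => ?_
      rw [sqrt_log_eq, inv_div]
      ring)
    (fun k g h hgh => tendsto_abs_clusterMean_sub_normal hσz hρ hcov hlaw (hlt k) (hext k)
      (hsep g h hgh k.1))
    (fun c d => rfl) (normal_moment_mul_inv hp hr hσz hcov)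
    (by
      have : Nonempty (Fin p) := ⟨⟨0, hp⟩⟩
      have : (Fintype.card (Fin p × Bool) : ℝ) ≠ 0 := by
        exact_mod_cast Fintype.card_ne_zero
      positivity) g
  have h3 : ∀ c d, Tendsto (fun q : ℕ × Ω => (scaling (p := p) (fun _ => √(Real.log q.1)) *
      varBeta (param β σ π) (fun i => z i q.2) (iboss r q.1 fun i => z i q.2) g *
      (scaling (p := p) (fun _ => √(Real.log q.1))).transpose) c d) (whp P)
      (𝓝 (normalLimit r σz ρ (σ g) (π g) c d)) := h2
  refine ⟨scaledVarTendsto_of_whp h1 h3, fun j => ?_⟩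
  refine rateOptimal_of_whp hσ hπ hπ_sum (a := fun N _ => √(Real.log N)) (by positivity) ?_
    -- For T ≥ 1, |μ| + σ(T + 1) ≤ (|μ| + 2σ)T; the leading 2 comes from T² = 2 log N.
    (h3 _ _) (B := 2 * (|μz j| + 2 * σz j) ^ 2) (by have := hσz j; positivity) ?_
  · filter_upwards [hlogpos] with N hN
    refine ⟨hN, ?_⟩
    rw [Real.sq_sqrt (Real.sqrt_pos.1 hN).le, one_div]
  · have hT : Tendsto (fun q : ℕ × Ω => maxRate q.1) (whp P) atTop :=
      tendsto_maxRate.comp tendsto_fst_whp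
    filter_upwards [eventually_abs_std_lt hσz hρ hcov hlaw j one_pos,
      hT.eventually_ge_atTop 1] with q h4 h5 i hi
    have h6 := (h4 i hi).le
    have h7 := hσz j
    have h8 : |z i q.2 j| ≤ (|μz j| + 2 * σz j) * maxRate q.1 := by
      rw [eq_add_mul_std (μ := μz) hσz (z i q.2) j]
      refine (abs_add_le _ _).trans ?_
      rw [abs_mul, abs_of_pos h7]
      nlinarith [abs_nonneg (μz j)]
    rw [sqrt_log_eq, div_pow, Real.sq_sqrt zero_le_two, ← sq_abs]
    calc |z i q.2 j| ^ 2 ≤ ((|μz j| + 2 * σz j) * maxRate q.1) ^ 2 := by gcongr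
      _ = _ := by ring

end Normal

/-! ### Lognormal covariates -/

section LogNormal

variable {Ω : Type*} [MeasurableSpace Ω] {P : Measure Ω} {m p : ℕ}
  {μ : EuclideanSpace ℝ (Fin p)} {σ : Fin p → ℝ} {ρ : Matrix (Fin p) (Fin p) ℝ}
  {u : ℕ → Ω → EuclideanSpace ℝ (Fin p)} {sel : ℕ × Ω → Finset ℕ} {b : Bool} {j : Fin p}

/-- Coordinatewise logarithm. -/
noncomputable def logVec (x : EuclideanSpace ℝ (Fin p)) : EuclideanSpace ℝ (Fin p) :=
  WithLp.toLp 2 fun l => Real.log (x l)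

lemma measurable_logVec : Measurable (logVec (p := p)) := by
  unfold logVec
  fun_prop

lemma measurable_expVec : Measurable fun u : EuclideanSpace ℝ (Fin p) =>
    (WithLp.toLp 2 fun j => Real.exp (u j) : EuclideanSpace ℝ (Fin p)) := by
  fun_prop

lemma hasLaw_logVec {S : Matrix (Fin p) (Fin p) ℝ} {z : Ω → EuclideanSpace ℝ (Fin p)}
    (hz : HasLaw z (multivariateLogNormal μ S) P) :
    HasLaw (fun ω => logVec (z ω)) (multivariateGaussian μ S) P := by
  have h : HasLaw logVec (multivariateGaussian μ S) (multivariateLogNormal μ S) := by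
    refine ⟨measurable_logVec.aemeasurable, ?_⟩
    rw [multivariateLogNormal, Measure.map_map measurable_logVec measurable_expVec]
    have : (logVec ∘ fun u : EuclideanSpace ℝ (Fin p) =>
        (WithLp.toLp 2 fun j => Real.exp (u j) : EuclideanSpace ℝ (Fin p))) = id := by
      ext x l
      simp [logVec]
    rw [this, Measure.map_id]
  exact h.comp hz

/-- Lognormal coordinates are positive only almost surely, and `Real.log` inverts `Real.exp` only
there. -/
lemma ae_eq_exp_logVec {S : Matrix (Fin p) (Fin p) ℝ} {z : Ω → EuclideanSpace ℝ (Fin p)}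
    (hz : HasLaw z (multivariateLogNormal μ S) P) :
    ∀ᵐ ω ∂P, ∀ l, z ω l = Real.exp (logVec (z ω) l) := by
  refine ae_all_iff.2 fun l => ?_
  have h : ∀ᵐ x ∂(multivariateLogNormal μ S), 0 < x l := by
    rw [multivariateLogNormal, ae_map_iff measurable_expVec.aemeasurable
      (measurableSet_lt measurable_const (by fun_prop))]
    exact ae_of_all _ fun x => Real.exp_pos _
  rw [← hz.map_eq] at h
  filter_upwards [ae_of_ae_map hz.aemeasurable h] with ω hω
  simp [logVec, Real.exp_log hω]

lemma extSign_mul_corr_lt_one (hσ : ∀ j, 0 < σ j) (hρ : ∀ j, ρ j j = 1)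
    (hcov : (covMatrix σ ρ).PosDef) {l : Fin p} (h : ¬ (b = true ∧ l = j)) :
    extSign b * ρ l j < 1 := by
  by_cases hl : l = j
  · subst hl
    have hb : b = false := by simpa using h
    rw [hb, hρ, extSign]
    norm_num
  · have h1 := corr_sq_lt_one hσ hρ hcov hl
    have h2 : (extSign b * ρ l j) ^ 2 < 1 := by rw [mul_pow, extSign_sq, one_mul]; exact h1
    exact (abs_lt.1 ((sq_lt_one_iff_abs_lt_one _).1 h2)).2

/-- The scaled coordinate is exp(μ_l + σ_l (W_l - T)). Only among the largest values of coordinate l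
itself does W_l - T tend to 0; in every other group W_l / T has a limit below 1 and the exponent
tends to -∞. -/
lemma tendsto_scaled_exp_coord (hσ : ∀ j, 0 < σ j) (hρ : ∀ j, ρ j j = 1)
    (hcov : (covMatrix σ ρ).PosDef)
    (hu : ∀ i, HasLaw (u i) (multivariateGaussian μ (covMatrix σ ρ)) P)
    (hlt : ∀ᶠ q in whp P, ∀ i ∈ sel q, i < q.1)
    (hext : ∀ δ > 0, ∀ᶠ q in whp P, ∀ i ∈ sel q,
      maxRate q.1 - δ ≤ extSign b * std μ σ (u i q.2) j) (l : Fin p) :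
    Tendsto (fun w : (ℕ × Ω) × ℕ =>
      (Real.exp (σ l * maxRate w.1.1))⁻¹ * Real.exp (u w.2 w.1.2 l)) (onSel (whp P) sel)
      (𝓝 (if b = true ∧ l = j then Real.exp (μ l) else 0)) := by
  have hT := tendsto_maxRate_onSel (P := P) (sel := sel)
  have e : ∀ w : (ℕ × Ω) × ℕ, (Real.exp (σ l * maxRate w.1.1))⁻¹ * Real.exp (u w.2 w.1.2 l) =
      Real.exp (μ l + σ l * (std μ σ (u w.2 w.1.2) l - maxRate w.1.1)) := by
    intro w
    rw [← Real.exp_neg, ← Real.exp_add, eq_add_mul_std (μ := μ) hσ (u w.2 w.1.2) l]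
    congr 1
    ring
  simp only [e]
  split_ifs with h
  · obtain ⟨rfl, rfl⟩ := h
    have h1 := tendsto_std_sub_maxRate hσ hρ hcov hu hlt hext
    have h2 := (Real.continuous_exp.tendsto _).comp ((h1.const_mul (σ l)).const_add (μ l))
    rw [mul_zero, add_zero] at h2
    refine h2.congr fun w => ?_
    simp [extSign]
  · refine Real.tendsto_exp_atBot.comp (tendsto_atBot_add_const_left _ _ ?_)
    have h1 := (tendsto_std_div_maxRate hσ hρ hcov hu hlt hext l).sub_const 1
    have h2 := hT.atTop_mul_neg
      (sub_neg.2 (extSign_mul_corr_lt_one hσ hρ hcov h)) h1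
    refine (h2.const_mul_atBot (hσ l)).congr' ?_
    filter_upwards [hT.eventually_gt_atTop 0] with w hw
    field_simp

/-- If an extreme drives no other coordinate to infinity, exponential combinations are dominated by
the coordinate itself. -/
lemma tendsto_abs_exp_combination_of_nonpos (hσ : ∀ j, 0 < σ j) (hρ : ∀ j, ρ j j = 1)
    (hcov : (covMatrix σ ρ).PosDef)
    (hu : ∀ i, HasLaw (u i) (multivariateGaussian μ (covMatrix σ ρ)) P)
    (hlt : ∀ᶠ q in whp P, ∀ i ∈ sel q, i < q.1)
    (hext : ∀ δ > 0, ∀ᶠ q in whp P, ∀ i ∈ sel q,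
      maxRate q.1 - δ ≤ extSign true * std μ σ (u i q.2) j)
    (hneg : ∀ l, l ≠ j → ρ l j ≤ 0) {a : Fin p → ℝ} (a₀ : ℝ) (ha : a j ≠ 0) :
    Tendsto (fun w : (ℕ × Ω) × ℕ => |a₀ + ∑ l, a l * Real.exp (u w.2 w.1.2 l)|)
      (onSel (whp P) sel) atTop := by
  have hT := tendsto_maxRate_onSel (P := P) (sel := sel)
  have hdiv : ∀ l, Tendsto (fun w : (ℕ × Ω) × ℕ => u w.2 w.1.2 l / maxRate w.1.1)
      (onSel (whp P) sel) (𝓝 (ρ l j * σ l)) := fun l => by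
    simpa [extSign] using tendsto_coord_div_maxRate hσ hρ hcov hu hlt hext l
  have huj : Tendsto (fun w : (ℕ × Ω) × ℕ => u w.2 w.1.2 j) (onSel (whp P) sel) atTop := by
    have h1 := hT.atTop_mul_pos (by rw [hρ, one_mul]; exact hσ j) (hdiv j)
    refine h1.congr' ?_
    filter_upwards [hT.eventually_gt_atTop 0] with w hw
    field_simp
  have hexp := Real.tendsto_exp_atTop.comp huj
  have hratio : ∀ l, Tendsto (fun w : (ℕ × Ω) × ℕ =>
      Real.exp (u w.2 w.1.2 l - u w.2 w.1.2 j)) (onSel (whp P) sel)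
      (𝓝 (if l = j then 1 else 0)) := by
    intro l
    split_ifs with h
    · subst h
      simpa using tendsto_const_nhds
    · refine Real.tendsto_exp_atBot.comp ?_
      have h1 : ρ l j * σ l - ρ j j * σ j < 0 := by
        rw [hρ, one_mul]
        have := mul_nonpos_of_nonpos_of_nonneg (hneg l h) (hσ l).le
        linarith [hσ j]
      refine (hT.atTop_mul_neg h1 ((hdiv l).sub (hdiv j))).congr' ?_
      filter_upwards [hT.eventually_gt_atTop 0] with w hw
      field_simp
  have h2 := (hexp.const_div_atTop a₀).add (tendsto_finsetSum Finset.univ fun l _ =>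
    (hratio l).const_mul (a l))
  have e : (0 : ℝ) + ∑ l, a l * (if l = j then 1 else 0) = a j := by simp
  rw [e] at h2
  refine (hexp.atTop_mul_pos (abs_pos.2 ha) h2.abs).congr fun w => ?_
  simp only [Function.comp]
  conv_lhs => rw [← abs_of_pos (Real.exp_pos (u w.2 w.1.2 j))]
  rw [← abs_mul, abs_of_pos (Real.exp_pos _), mul_add, Finset.mul_sum,
    mul_div_cancel₀ _ (Real.exp_pos _).ne']
  congr 2
  refine Finset.sum_congr rfl fun l _ => ?_
  rw [Real.exp_sub]
  field_simp

/-- If the extreme pushes some other coordinate upwards, anti-concentration excludes cancellation.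
Among smallest values a negative correlation always provides such a coordinate. What remains are
largest values with no positive correlation to another coordinate, where the j-th exponential
dominates. -/
lemma tendsto_abs_exp_combination (hσ : ∀ j, 0 < σ j) (hρ : ∀ j, ρ j j = 1)
    (hcov : (covMatrix σ ρ).PosDef)
    (hu : ∀ i, HasLaw (u i) (multivariateGaussian μ (covMatrix σ ρ)) P)
    (hlt : ∀ᶠ q in whp P, ∀ i ∈ sel q, i < q.1)
    (hext : ∀ δ > 0, ∀ᶠ q in whp P, ∀ i ∈ sel q,
      maxRate q.1 - δ ≤ extSign b * std μ σ (u i q.2) j)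
    (hmin : ∃ l, ρ l j < 0) {a : Fin p → ℝ} (a₀ : ℝ) (ha : ∀ l, a l ≠ 0) :
    Tendsto (fun w : (ℕ × Ω) × ℕ => |a₀ + ∑ l, a l * Real.exp (u w.2 w.1.2 l)|)
      (onSel (whp P) sel) atTop := by
  by_cases hl : ∃ l, l ≠ j ∧ 0 < extSign b * ρ l j
  · obtain ⟨l, hlj, hpos⟩ := hl
    obtain ⟨δ, hδ, h⟩ := eventually_le_abs_exp_combination hσ hρ hcov hu (extSign_sq b) hlj hpos a
      a₀ (ha l)
    rw [tendsto_atTop]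
    intro D
    rw [eventually_onSel_iff]
    filter_upwards [hlt, hext δ hδ, h (max D 1) (by positivity)] with q h1 h2 h3 i hi
    exact (le_max_left _ _).trans (h3 i (h1 i hi) (h2 i hi))
  · push Not at hl
    cases b
    · obtain ⟨l, hl'⟩ := hmin
      have hlj : l ≠ j := by
        rintro rfl
        rw [hρ] at hl'
        linarith
      have := hl l hlj
      simp only [extSign, Bool.false_eq_true, if_false] at this
      linarith
    · refine tendsto_abs_exp_combination_of_nonpos hσ hρ hcov hu hlt hext (fun l hlj => ?_) a₀
        (ha j)
      simpa [extSign] using hl l hlj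

/-- The limiting second moment matrix of the rescaled lognormal regressors and its inverse. -/
lemma logNormal_moment_mul_inv {r : ℕ} (hp : 1 ≤ p) (hr : 1 ≤ r) :
    (Matrix.of fun c d : Coef p => ∑ k : Fin p × Bool, (r : ℝ) *
      ((Sum.elim (fun _ => (1 : ℝ))
          (fun l => if k.2 = true ∧ l = k.1 then Real.exp (μ l) else 0) c) *
        Sum.elim (fun _ => (1 : ℝ))
          (fun l => if k.2 = true ∧ l = k.1 then Real.exp (μ l) else 0) d)) *
    ((2 / (2 * p * r : ℝ)) • Matrix.fromBlocks (Matrix.of fun _ _ => 1)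
      (Matrix.of fun _ j => -Real.exp (-μ j)) (Matrix.of fun j _ => -Real.exp (-μ j))
      ((p : ℝ) • Matrix.diagonal (fun j => Real.exp (-2 * μ j)) +
        Matrix.vecMulVec (fun j => Real.exp (-μ j)) (fun j => Real.exp (-μ j)))) = 1 := by
  have hp0 : (p : ℝ) ≠ 0 := by positivity
  have hr0 : (r : ℝ) ≠ 0 := by positivity
  have hX : (Matrix.of fun c d : Coef p => ∑ k : Fin p × Bool, (r : ℝ) *
      ((Sum.elim (fun _ => (1 : ℝ))
          (fun l => if k.2 = true ∧ l = k.1 then Real.exp (μ l) else 0) c) *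
        Sum.elim (fun _ => (1 : ℝ))
          (fun l => if k.2 = true ∧ l = k.1 then Real.exp (μ l) else 0) d)) =
      -- An arrow matrix: slope l is informed only by the r points with the largest l-th covariate,
      -- so different slopes interact only through the intercept.
      Matrix.fromBlocks (Matrix.of fun _ _ => (2 * p * r : ℝ))
        (Matrix.of fun _ l => r * Real.exp (μ l)) (Matrix.of fun l _ => r * Real.exp (μ l))
        (Matrix.diagonal fun l => r * Real.exp (μ l) ^ 2) := by
    ext c d
    rw [Matrix.of_apply]
    rcases c with c | c <;> rcases d with d | d
    · simp only [Sum.elim_inl, mul_one, Finset.sum_const, Finset.card_univ, Fintype.card_prod,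
        Fintype.card_fin, Fintype.card_bool, nsmul_eq_mul, Matrix.fromBlocks_apply₁₁,
        Matrix.of_apply]
      push_cast
      ring
    · simp [Fintype.sum_prod_type]
    · simp [Fintype.sum_prod_type]
    · by_cases h : c = d
      · subst h
        simp [Fintype.sum_prod_type, pow_two]
      · simp only [Fintype.sum_prod_type, Fintype.sum_bool, Sum.elim_inr,
          Matrix.fromBlocks_apply₂₂, Matrix.diagonal_apply_ne _ h]
        refine Finset.sum_eq_zero fun j _ => ?_
        by_cases h1 : c = j
        · subst h1
          simp [Ne.symm h]
        · simp [h1]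
  have he : ∀ l, Real.exp (-μ l) = (Real.exp (μ l))⁻¹ := fun l => Real.exp_neg _
  have he2 : ∀ l, Real.exp (-2 * μ l) = (Real.exp (μ l))⁻¹ ^ 2 := fun l => by
    rw [← he, ← Real.exp_nat_mul]
    congr 1
    push_cast
    ring
  have hE : ∀ l, Real.exp (μ l) ≠ 0 := fun l => (Real.exp_pos _).ne'
  rw [hX, Matrix.mul_smul, Matrix.fromBlocks_multiply, Matrix.fromBlocks_smul,
    ← Matrix.fromBlocks_one]
  simp only [he, he2]
  congr 1
  · ext c d
    simp [Matrix.mul_apply, hE, mul_assoc]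
    field_simp
    ring
  · ext c d
    simp [Matrix.mul_apply, Matrix.vecMulVec_apply, Matrix.diagonal_apply, mul_add,
      Finset.sum_add_distrib]
    have h1 : ∀ l, r * Real.exp (μ l) * ((Real.exp (μ l))⁻¹ * (Real.exp (μ d))⁻¹) =
        r * (Real.exp (μ d))⁻¹ := fun l => by
      have := hE l
      field_simp
    simp only [h1]
    simp
    have := hE d
    field_simp
    ring
  · ext c d
    have := hE c
    simp [Matrix.mul_apply, Matrix.diagonal_apply]
    field_simp
    simp
  · ext c d
    have h1 := hE c
    have h2 := hE d
    by_cases h : c = d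
    · subst h
      simp [Matrix.mul_apply, Matrix.vecMulVec_apply, Matrix.diagonal_apply, mul_add]
      field_simp
      ring
    · simp [Matrix.mul_apply, Matrix.vecMulVec_apply, Matrix.diagonal_apply, h, mul_add]
      field_simp
      ring

theorem logNormal_case {r : ℕ} (hp : 1 ≤ p) (hr : 1 ≤ r)
    (β : Fin (m + 1) → Coef p → ℝ) (σ π : Fin (m + 1) → ℝ)
    (hσ : ∀ g, 0 < σ g) (hπ : ∀ g, 0 < π g) (hπ_sum : ∑ g, π g = 1)
    (μz : EuclideanSpace ℝ (Fin p)) (σz : Fin p → ℝ) (hσz : ∀ j, 0 < σz j)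
    (ρ : Matrix (Fin p) (Fin p) ℝ) (hρ : ∀ j, ρ j j = 1)
    (hcov : (covMatrix σz ρ).PosDef) [IsProbabilityMeasure P]
    (z : ℕ → Ω → EuclideanSpace ℝ (Fin p)) (hz : iIndepFun z P)
    (hlaw : ∀ i, HasLaw (z i) (multivariateLogNormal μz (covMatrix σz ρ)) P)
    (hsep : ∀ g g' : Fin (m + 1), g ≠ g' → ∀ j : Fin p,
      β g (Sum.inr j) - β g' (Sum.inr j) ≠ 0 ∧ minCorr ρ j < 0) (g : Fin (m + 1)) :
    ScaledVarTendsto P (param β σ π) z (fun N ω => iboss r N fun i => z i ω) g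
        (fun N => scaling fun j => Real.exp (σz j * √(2 * Real.log N)))
        (logNormalLimit r μz (σ g) (π g)) ∧
      ∀ j : Fin p, RateOptimal P (param β σ π) z (fun N ω => iboss r N fun i => z i ω)
          (2 * p * r) g j (fun N => Real.exp (-(2 * σz j * √(2 * Real.log N)))) := by
  have : Nonempty (Fin p) := ⟨⟨0, hp⟩⟩
  -- Taking logarithms makes the data Gaussian without changing the selected indices.
  set u : ℕ → Ω → EuclideanSpace ℝ (Fin p) := fun i ω => logVec (z i ω) with hu_def
  have hu : ∀ i, HasLaw (u i) (multivariateGaussian μz (covMatrix σz ρ)) P :=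
    fun i => hasLaw_logVec (hlaw i)
  have hind : iIndepFun u P := hz.comp (fun _ => logVec) fun _ => measurable_logVec
  have hzu : ∀ᶠ q in whp P, ∀ i l, z i q.2 l = Real.exp (u i q.2 l) :=
    eventually_whp_of_ae (A := fun ω => ∀ i l, z i ω l = Real.exp (u i ω l))
      (ae_all_iff.2 fun i => ae_eq_exp_logVec (hlaw i))
  obtain ⟨sel, hdec, hcard, hlt, hext⟩ := exists_selection hσz hρ hcov hu hind r
  have hzu' : ∀ k, ∀ᶠ w in onSel (whp P) (sel k), ∀ l,
      z w.2 w.1.2 l = Real.exp (u w.2 w.1.2 l) := fun k =>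
    (tendsto_fst_onSel.eventually hzu).mono fun w hw => hw w.2
  obtain ⟨h1, h2⟩ := tendsto_scaled_varBeta (β := β) (P := P) (z := z) (sel := sel)
    (δ := fun N ω => iboss r N fun i => z i ω) (a := fun N l => Real.exp (σz l * maxRate N))
    (x₀ := fun k l => if k.2 = true ∧ l = k.1 then Real.exp (μz l) else 0) hσ hπ hπ_sum
    (Eventually.of_forall fun N l => (Real.exp_pos _).ne')
    (by
      filter_upwards [hdec, hzu] with q h1 h2 F
      rw [← h1]
      exact Finset.sum_congr (iboss_congr r q.1 Real.exp_strictMono h2) fun _ _ => rfl)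
    hcard
    (fun k l => by
      refine (tendsto_scaled_exp_coord hσz hρ hcov hu (hlt k) (hext k) l).congr' ?_
      filter_upwards [hzu' k] with w hw
      rw [hw])
    (fun k g h hgh => by
      have hmin : ∃ l, ρ l k.1 < 0 := by
        by_contra hc
        push Not at hc
        exact absurd (hsep g h hgh k.1).2 (not_lt.2 (le_ciInf hc))
      refine (tendsto_abs_exp_combination hσz hρ hcov hu (hlt k) (hext k) hmin
        (β g (Sum.inl ()) - β h (Sum.inl ())) fun l => (hsep g h hgh l).1).congr' ?_
      filter_upwards [hzu' k] with w hw
      rw [clusterMean_regressor_sub]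
      simp only [hw])
    (fun c d => rfl) (logNormal_moment_mul_inv hp hr)
    (by
      have : (Fintype.card (Fin p × Bool) : ℝ) ≠ 0 := by
        exact_mod_cast Fintype.card_ne_zero
      positivity) g
  have h3 : ∀ c d, Tendsto (fun q : ℕ × Ω =>
      (scaling (fun l => Real.exp (σz l * maxRate q.1)) *
      varBeta (param β σ π) (fun i => z i q.2) (iboss r q.1 fun i => z i q.2) g *
      (scaling (fun l => Real.exp (σz l * maxRate q.1))).transpose) c d) (whp P)
      (𝓝 (logNormalLimit r μz (σ g) (π g) c d)) := by
    intro c d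
    have h4 := h2 c d
    have e : logNormalLimit r μz (σ g) (π g) c d = σ g ^ 2 / π g *
        ((2 / (2 * p * r : ℝ)) • Matrix.fromBlocks (Matrix.of fun _ _ => 1)
        (Matrix.of fun _ j => -Real.exp (-μz j)) (Matrix.of fun j _ => -Real.exp (-μz j))
        ((p : ℝ) • Matrix.diagonal (fun j => Real.exp (-2 * μz j)) +
        Matrix.vecMulVec (fun j => Real.exp (-μz j)) (fun j => Real.exp (-μz j)))) c d := by
      rw [logNormalLimit, Matrix.smul_apply, Matrix.smul_apply, smul_eq_mul, smul_eq_mul,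
        ← mul_assoc]
      congr 1
      have := (hπ g).ne'
      field_simp
    rw [e]
    exact h4
  refine ⟨scaledVarTendsto_of_whp h1 h3, fun j => ?_⟩
  refine rateOptimal_of_whp hσ hπ hπ_sum (a := fun N l => Real.exp (σz l * maxRate N))
    (by positivity) (Eventually.of_forall fun N => ⟨Real.exp_pos _, ?_⟩)
    -- The bound W_j < T + 1 for all points gives z_j² ≤ exp(2(μ_j + σ_j)) exp(2σ_j T).
    (h3 _ _) (B := Real.exp (2 * (μz j + σz j))) (Real.exp_pos _) ?_
  · rw [← Real.exp_nat_mul, ← Real.exp_neg, maxRate]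
    congr 1
    push_cast
    ring
  · filter_upwards [eventually_std_lt hσz hρ hcov hu (s := 1) (by norm_num) j one_pos,
      hzu] with q h4 h5 i hi
    have h6 := h4 i hi
    rw [h5, eq_add_mul_std (μ := μz) hσz (u i q.2) j, ← Real.exp_nat_mul, ← Real.exp_nat_mul,
      ← Real.exp_add, Real.exp_le_exp]
    push_cast
    nlinarith [hσz j]

end LogNormal

end CLR

theorem mainTheorem3 {m p r : ℕ} (hp : 1 ≤ p) (hr : 1 ≤ r)
    (β : Fin (m + 1) → CLR.Coef p → ℝ) (σ π : Fin (m + 1) → ℝ)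
    (hσ : ∀ g, 0 < σ g) (hπ : ∀ g, 0 < π g) (hπ_sum : ∑ g, π g = 1)
    (μz : EuclideanSpace ℝ (Fin p)) (σz : Fin p → ℝ) (hσz : ∀ j, 0 < σz j)
    (ρ : Matrix (Fin p) (Fin p) ℝ) (hρ : ∀ j, ρ j j = 1)
    (hcov : (CLR.covMatrix σz ρ).PosDef)
    {Ω : Type*} [MeasurableSpace Ω] (P : Measure Ω) [IsProbabilityMeasure P]
    (z : ℕ → Ω → EuclideanSpace ℝ (Fin p)) (hz : iIndepFun z P) :
    ((∀ i, HasLaw (z i) (multivariateGaussian μz (CLR.covMatrix σz ρ)) P) →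
      (∀ g g' : Fin (m + 1), g ≠ g' → ∀ j : Fin p,
        ∑ l, ρ l j * σz l * (β g (Sum.inr l) - β g' (Sum.inr l)) ≠ 0) →
      ∀ g : Fin (m + 1),
        CLR.ScaledVarTendsto P (CLR.param β σ π) z (fun N ω => CLR.iboss r N fun i => z i ω) g
          (fun N => CLR.scaling fun _ => √(Real.log N))
          (CLR.normalLimit r σz ρ (σ g) (π g)) ∧
        ∀ j : Fin p,
          CLR.RateOptimal P (CLR.param β σ π) z (fun N ω => CLR.iboss r N fun i => z i ω)
            (2 * p * r) g j (fun N => 1 / Real.log N)) ∧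
    ((∀ i, HasLaw (z i) (CLR.multivariateLogNormal μz (CLR.covMatrix σz ρ)) P) →
      (∀ g g' : Fin (m + 1), g ≠ g' → ∀ j : Fin p,
        β g (Sum.inr j) - β g' (Sum.inr j) ≠ 0 ∧
        CLR.minCorr ρ j < 0 ∧
        ∑ l with ρ l j = CLR.minCorr ρ j, (β g (Sum.inr l) - β g' (Sum.inr l)) ≠ 0) →
      ∀ g : Fin (m + 1),
        CLR.ScaledVarTendsto P (CLR.param β σ π) z (fun N ω => CLR.iboss r N fun i => z i ω) g
          (fun N => CLR.scaling fun j => Real.exp (σz j * √(2 * Real.log N)))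
          (CLR.logNormalLimit r μz (σ g) (π g)) ∧
        ∀ j : Fin p,
          CLR.RateOptimal P (CLR.param β σ π) z (fun N ω => CLR.iboss r N fun i => z i ω)
            (2 * p * r) g j (fun N => Real.exp (-(2 * σz j * √(2 * Real.log N))))) :=
  ⟨fun hlaw hsep g =>
      CLR.normal_case hp hr β σ π hσ hπ hπ_sum μz σz hσz ρ hρ hcov z hz hlaw hsep g,
    fun hlaw hsep g =>
      CLR.logNormal_case hp hr β σ π hσ hπ hπ_sum μz σz hσz ρ hρ hcov z hz hlaw
        (fun g g' h j => ⟨(hsep g g' h j).1, (hsep g g' h j).2.1⟩) g⟩
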